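/- For $\theta\in\mathbb R$ let $\mathbb{C}_\theta=\{s\in\mathbb C:\operatorname{Re}s>\theta\}$ and $\mathbb C_+=\mathbb C_0$. Let $h\ge 0$ be integrable on $(0,\infty)$ with $\int_0^\infty h=1$, such that $0$ lies in the support of the probability measure $d\mu=h(\sigma)\,d\sigma$. Put $$w_h(n)=\int_0^\infty n^{-2\sigma}h(\sigma)\,d\sigma,\qquad \beta_h(\sigma)=\int_0^\sigma(\sigma-u)h(u)\,du .$$ Let $\mathcal A^2_\mu$ be the space of Dirichlet series $f=\sum_{n\ge1}a_n n^{-s}$ with $\|f\|^2=\sum_n|a_n|^2w_h(n)<\infty$, and let $\mathcal H^2$ be the space of Dirichlet series with $\|f\|^2=\sum_n|a_n|^2<\infty$. Both are spaces of analytic functions on $\mathbb C_{1/2}$. Let $c_0\ge1$ be an integer and let $\Phi(s)=c_0s+\varphi(s)$ be a $c_0$-symbol, that is: $\Phi:\mathbb C_{1/2}\to\mathbb C_{1/2}$ is analytic, $\varphi$ is represented by a convergent Dirichlet series in some half-plane, and $C_\Phi f=f\circ\Phi$ is a bounded operator on $\mathcal A^2_\mu$. Denote by $\varphi$ and $\Phi$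 also their analytic continuations to $\mathbb C_+$, and assume that $\operatorname{Im}\varphi$ is bounded on $\mathbb C_+$. For $\beta:(0,\infty)\to(0,\infty)$ put $$N_{\beta,\Phi}(s)=\sum_{a\in\mathbb C_+,\ \Phi(a)=s}\beta(\operatorname{Re}a)$$ (a sum over distinct points, equal to $0$ if there are none), and write $N_\Phi$ when $\beta(\sigma)=\sigma$. The essential norm is $\|T\|_{H,e}=\inf\{\|T-K\|: K \text{ compact on } H\}$. Then $$\|C_\Phi\|_{\mathcal A^2_\mu,e}^{2}\le\Bigl(2\sup_{\mathbb C_+}|\operatorname{Im}\varphi|+c_0\Bigr)\limsup_{\operatorname{Re}s\to0^+}\frac{N_{\beta_h,\Phi}(s)}{\beta_h(\operatorname{Re}s)} ,$$ and $C_\Phi$ is also bounded on $\mathcal H^2$, with $$\|C_\Phi\|_{\mathcal H^2,e}^{2}\le\Bigl(2\sup_{\mathbb C_+}|\operatorname{Im}\varphi|+c_0\Bigr)\limsup_{\operatorname{Re}s\to0^+}\frac{N_{\Phi}(s)}{\operatorname{Re}s} .$$ Here $\limsup_{\operatorname{Re}s\to0^+}F(s)$ means $\lim_{\theta\to0^+}\sup_{0<\operatorname{Re}s<\theta}F(s)$.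 -/

import Mathlib

open Set Filter Topology MeasureTheory
open scoped ENNReal

noncomputable section

namespace DirichletComposition

/-- The open half-plane `{s : θ < Re s}`. -/
def halfPlane (θ : ℝ) : Set ℂ := {s | θ < s.re}

/-! ### Weighted Hilbert spaces of Dirichlet series -/

/-- A sequence of positive weights `w 1, w 2, …`. -/
structure Weight where
  toFun : ℕ+ → ℝ
  pos : ∀ n, 0 < toFun n

/-- Coefficient sequences `a` with `∑ |a n|² w n < ∞`. -/
def coeffs (w : Weight) : Submodule ℂ (ℕ+ → ℂ) where
  carrier := {a | Summable fun n => ‖a n‖ ^ 2 * w.toFun n}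
  zero_mem' := by simp [summable_zero]
  add_mem' := by
    intro a b ha hb
    refine Summable.of_nonneg_of_le (fun n => ?_) (fun n => ?_) ((ha.add hb).mul_left 2)
    · have := (w.pos n).le
      positivity
    · have h1 : ‖(a + b) n‖ ^ 2 ≤ 2 * (‖a n‖ ^ 2 + ‖b n‖ ^ 2) := by
        have h2 : ‖(a + b) n‖ ≤ ‖a n‖ + ‖b n‖ := norm_add_le _ _
        nlinarith [norm_nonneg ((a + b) n), sq_nonneg (‖a n‖ - ‖b n‖)]
      nlinarith [mul_le_mul_of_nonneg_right h1 (w.pos n).le]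
  smul_mem' := by
    intro c a ha
    refine (Summable.mul_left (‖c‖ ^ 2) ha).congr fun n => ?_
    simp only [Pi.smul_apply, smul_eq_mul, norm_mul]
    ring

/-- The space of Dirichlet series `∑ a n n^{-s}` with `∑ |a n|² w n < ∞`, an element being given
by its coefficient sequence. -/
def DirichletSpace (w : Weight) : Type := coeffs w

instance (w : Weight) : AddCommGroup (DirichletSpace w) := inferInstanceAs (AddCommGroup (coeffs w))

instance (w : Weight) : Module ℂ (DirichletSpace w) := inferInstanceAs (Module ℂ (coeffs w))

/-- The `n`-th coefficient of a Dirichlet series. -/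
def DirichletSpace.coeff {w : Weight} (f : DirichletSpace w) (n : ℕ+) : ℂ := f.1 n

theorem DirichletSpace.memlp {w : Weight} (f : DirichletSpace w) :
    Memℓp (fun n => (Real.sqrt (w.toFun n) : ℂ) * f.coeff n) 2 := by
  refine memℓp_gen ?_
  refine Summable.congr (f := fun n => ‖f.coeff n‖ ^ 2 * w.toFun n) f.2 fun n => ?_
  have h := Real.sq_sqrt (w.pos n).le
  simp only [ENNReal.toReal_ofNat, Real.rpow_ofNat, norm_mul, Complex.norm_real, Real.norm_eq_abs,
    mul_pow, sq_abs]
  rw [h, mul_comm]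

/-- The linear injection `(a n) ↦ (√(w n) a n)` into `ℓ²`, used to put the norm
`(∑ |a n|² w n)^{1/2}` on the space (see `DirichletSpace.norm_sq`). -/
def DirichletSpace.toLp (w : Weight) : DirichletSpace w →ₗ[ℂ] lp (fun _ : ℕ+ => ℂ) 2 where
  toFun f := ⟨fun n => (Real.sqrt (w.toFun n) : ℂ) * f.coeff n, f.memlp⟩
  map_add' f g := by
    ext n
    exact mul_add _ _ _
  map_smul' c f := by
    ext n
    exact mul_left_comm _ _ _

theorem DirichletSpace.toLp_injective (w : Weight) :
    Function.Injective (DirichletSpace.toLp w) := by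
  intro f g hfg
  refine Subtype.ext (funext fun n => ?_)
  have h1 : (Real.sqrt (w.toFun n) : ℂ) * f.coeff n = (Real.sqrt (w.toFun n) : ℂ) * g.coeff n :=
    congrFun (congrArg Subtype.val hfg) n
  have h2 : (Real.sqrt (w.toFun n) : ℂ) ≠ 0 :=
    Complex.ofReal_ne_zero.2 (Real.sqrt_pos.2 (w.pos n)).ne'
  exact mul_left_cancel₀ h2 h1

instance (w : Weight) : NormedAddCommGroup (DirichletSpace w) :=
  NormedAddCommGroup.induced _ _ (DirichletSpace.toLp w) (DirichletSpace.toLp_injective w)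

instance (w : Weight) : NormedSpace ℂ (DirichletSpace w) :=
  NormedSpace.induced ℂ _ _ (DirichletSpace.toLp w)

theorem DirichletSpace.norm_sq {w : Weight} (f : DirichletSpace w) :
    ‖f‖ ^ 2 = ∑' n, ‖f.coeff n‖ ^ 2 * w.toFun n := by
  have h0 : ‖f‖ = ‖DirichletSpace.toLp w f‖ := rfl
  have h1 := lp.norm_rpow_eq_tsum (p := 2) (by norm_num) (DirichletSpace.toLp w f)
  simp only [ENNReal.toReal_ofNat, Real.rpow_ofNat] at h1
  rw [h0, h1]
  refine tsum_congr fun n => ?_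
  have h2 : (DirichletSpace.toLp w f) n = (Real.sqrt (w.toFun n) : ℂ) * f.coeff n := rfl
  rw [h2, norm_mul, mul_pow, Complex.norm_real, Real.norm_eq_abs, sq_abs,
    Real.sq_sqrt (w.pos n).le, mul_comm]

/-- The value at `s` of the sum of the Dirichlet series `f`. -/
def DirichletSpace.eval {w : Weight} (f : DirichletSpace w) (s : ℂ) : ℂ :=
  ∑' n : ℕ+, f.coeff n * ((n : ℕ) : ℂ) ^ (-s)

/-- The weight `w = 1` of the Hardy space `ℋ²`. -/
def hardyWeight : Weight := ⟨fun _ => 1, fun _ => one_pos⟩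

/-- A density `h` on `(0, ∞)` such that `dμ = h(σ) dσ` is a probability measure on `(0, ∞)` with
`0` in its support. Only the values of `h` on `(0, ∞)` matter. -/
structure BergmanDensity where
  toFun : ℝ → ℝ
  nonneg : ∀ σ, 0 < σ → 0 ≤ toFun σ
  integrable : IntegrableOn toFun (Ioi 0)
  integral_eq_one : ∫ σ in Ioi 0, toFun σ = 1
  zero_mem_support : ∀ ε, 0 < ε → 0 < ∫ σ in Ioo 0 ε, toFun σ

/-- `w_h(n) = ∫_0^∞ n^{-2σ} h(σ) dσ`. -/
def bergmanWeightFun (h : BergmanDensity) (n : ℕ+) : ℝ :=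
  ∫ σ in Ioi (0 : ℝ), ((n : ℕ) : ℝ) ^ (-2 * σ) * h.toFun σ

theorem bergmanWeightFun_pos (h : BergmanDensity) (n : ℕ+) : 0 < bergmanWeightFun h n := by
  have hn : (1 : ℝ) ≤ ((n : ℕ) : ℝ) := by exact_mod_cast n.2
  have hn0 : (0 : ℝ) < ((n : ℕ) : ℝ) := by linarith
  have hcont : Continuous fun σ : ℝ => ((n : ℕ) : ℝ) ^ (-2 * σ) :=
    continuous_const.rpow (by fun_prop) fun _ => Or.inl hn0.ne'
  have hint : IntegrableOn (fun σ => ((n : ℕ) : ℝ) ^ (-2 * σ) * h.toFun σ) (Ioi 0) := by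
    refine Integrable.bdd_mul (c := 1) h.integrable hcont.aestronglyMeasurable ?_
    filter_upwards [ae_restrict_mem measurableSet_Ioi] with σ hσ
    have hσ' : (0 : ℝ) < σ := hσ
    rw [Real.norm_eq_abs, abs_of_nonneg (Real.rpow_nonneg hn0.le _)]
    exact Real.rpow_le_one_of_one_le_of_nonpos hn (by linarith)
  have hnn : 0 ≤ᵐ[volume.restrict (Ioi 0)] h.toFun := by
    filter_upwards [ae_restrict_mem measurableSet_Ioi] with σ hσ using h.nonneg σ hσ
  have hnn' : 0 ≤ᵐ[volume.restrict (Ioi 0)]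
      fun σ => ((n : ℕ) : ℝ) ^ (-2 * σ) * h.toFun σ := by
    filter_upwards [hnn] with σ hσ using mul_nonneg (Real.rpow_nonneg hn0.le _) hσ
  have h1 : 0 < ∫ σ in Ioi 0, h.toFun σ := by rw [h.integral_eq_one]; exact one_pos
  rw [integral_pos_iff_support_of_nonneg_ae hnn h.integrable] at h1
  rw [bergmanWeightFun, integral_pos_iff_support_of_nonneg_ae hnn' hint]
  refine lt_of_lt_of_le h1 (measure_mono fun σ hσ => ?_)
  exact mul_ne_zero (Real.rpow_pos_of_pos hn0 _).ne' hσ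

/-- The weight of the Bergman space `𝒜²_μ`, `dμ = h(σ) dσ`. -/
def bergmanWeight (h : BergmanDensity) : Weight := ⟨bergmanWeightFun h, bergmanWeightFun_pos h⟩

/-- The Hardy space `ℋ²` of Dirichlet series. -/
abbrev HardySpace : Type := DirichletSpace hardyWeight

/-- The weighted Bergman space `𝒜²_μ` of Dirichlet series, `dμ = h(σ) dσ`. -/
abbrev BergmanSpace (h : BergmanDensity) : Type := DirichletSpace (bergmanWeight h)

/-! ### Composition operators, symbols, essential norm -/

/-- `T f = f ∘ Φ` on the half-plane `Re s > 1/2`, for all `f`. -/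
def IsCompositionOperator {w : Weight} (Φ : ℂ → ℂ)
    (T : DirichletSpace w →L[ℂ] DirichletSpace w) : Prop :=
  ∀ f : DirichletSpace w, ∀ s ∈ halfPlane (1 / 2), (T f).eval s = f.eval (Φ s)

/-- The class `𝒟`: in some half-plane, `f` is the sum of a convergent Dirichlet series. -/
def InClassD (f : ℂ → ℂ) : Prop :=
  ∃ (c : ℕ → ℂ) (θ : ℝ), ∀ s ∈ halfPlane θ,
    Tendsto (fun N : ℕ => ∑ n ∈ Finset.Icc 1 N, c n * (n : ℂ) ^ (-s)) atTop (𝓝 (f s))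

/-- `Φ(s) = c₀ s + φ(s)`. -/
def symbolMap (c₀ : ℕ) (φ : ℂ → ℂ) (s : ℂ) : ℂ := c₀ * s + φ s

/-- `Φ(s) = c₀ s + φ(s)` is a `c₀`-symbol: an analytic self-map of the half-plane `Re s > 1/2` with
`φ ∈ 𝒟`, such that `C_Φ` is bounded on `𝒜²_μ`. -/
structure IsSymbol (h : BergmanDensity) (c₀ : ℕ) (φ : ℂ → ℂ) : Prop where
  analytic : DifferentiableOn ℂ (symbolMap c₀ φ) (halfPlane (1 / 2))
  mapsTo : MapsTo (symbolMap c₀ φ) (halfPlane (1 / 2)) (halfPlane (1 / 2))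
  inClassD : InClassD φ
  bounded : ∃ T : BergmanSpace h →L[ℂ] BergmanSpace h, IsCompositionOperator (symbolMap c₀ φ) T

/-- The essential norm: the distance to the compact operators. -/
def essNorm {E : Type*} [NormedAddCommGroup E] [NormedSpace ℂ E] (T : E →L[ℂ] E) : ℝ :=
  sInf {r : ℝ | ∃ K : E →L[ℂ] E, IsCompactOperator K ∧ r = ‖T - K‖}

/-! ### Nevanlinna counting functions -/

/-- `β_h(σ) = ∫_0^σ (σ - u) h(u) du`. -/
def betaFun (h : BergmanDensity) (σ : ℝ) : ℝ := ∫ u in (0 : ℝ)..σ, (σ - u) * h.toFun u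

/-- `N_{β,Φ}(s) = ∑ β(Re a)`, the sum over the distinct points `a` with `Re a > 0` and
`Φ(a) = s` (it is `0` if there are none). -/
def nevanlinna (β : ℝ → ℝ) (Φ : ℂ → ℂ) (s : ℂ) : ℝ≥0∞ :=
  ∑' a : {a : ℂ // a ∈ halfPlane 0 ∧ Φ a = s}, ENNReal.ofReal (β a.1.re)

/-- The upper limit of `N_{β,Φ}(s) / β(Re s)` as `Re s → 0⁺`, uniformly in `Im s`: the infimum
over `θ > 0` of the supremum over the strip `0 < Re s < θ`. -/
def nevanlinnaLimsup (β : ℝ → ℝ) (Φ : ℂ → ℂ) : ℝ≥0∞ :=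
  limsup (fun s : ℂ => nevanlinna β Φ s / ENNReal.ofReal (β s.re)) (comap Complex.re (𝓝[>] 0))

end DirichletComposition

end

open DirichletComposition

/-! The engine is a Littlewood–Paley formula. If `∫ β(σ) n^(-2σ) dσ = w(n) / (4 log² n)` for `n ≠
1`, then for `f = ∑ a_n n^(-s)` the quantity `∑_{n ≥ 2} |a_n|² w(n)` is four times the mean over
`|Im s| < T`, `T → ∞`, of `|f'|²` integrated against `β(Re s)`. This applies to the pair `β_h, w_h`
by Tonelli and to the pair `σ, 1` by a Gamma integral, so that both spaces are treated at once
(`IsLittlewoodPaley`).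

For a Dirichlet polynomial `f`, the change of variables `w = Φ(s)` turns the integral of `|(f ∘
Φ)'|² β` into one of `|f'|²` against the counting function `N_{β,Φ}`. Since `Im Φ(s)` differs from
`c₀ Im s` by at most `M`, a strip of half-height `T` goes into one of half-height `c₀ T + M`; after
division by `2T` only the factor `c₀` survives. This is `sum_coeff_comp_le`. The argument thus gives
the constant `c₀`, and the stated one is larger.

Littlewood's inequality (`sum_re_le_of_selfMap`) gives `N_{β,Φ} ≤ β / c₀` everywhere, while near the
boundary `N_{β,Φ} ≤ l β` for any `l` above the upper limit. The region `Re s ≥ θ` is negligible for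
high frequencies (`eventually_tail_le`), so on polynomials with frequencies beyond some `m` the
squared norm of the operator is at most `c₀ l + ε`. The low frequencies are removed by a finite-rank
truncation, which gives the essential norm.

Two things must be known beforehand. First, `Φ` maps `Re s > 0` into itself: the operator is bounded
along the powers of `2^(-s)`, which forces `|2^(-Φ)| ≤ 1`. Second, the operator acts on `ℋ²`:
Littlewood's inequality makes it a contraction on polynomials, and the operator already given on the
Bergman space supplies the Dirichlet coefficients of the image. -/

namespace DirichletComposition

/-! ### Analytic functions on half-planes -/

theorem isOpen_halfPlane (θ : ℝ) : IsOpen (halfPlane θ) :=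
  isOpen_lt continuous_const Complex.continuous_re

theorem convex_halfPlane (θ : ℝ) : Convex ℝ (halfPlane θ) :=
  convex_halfSpace_re_gt θ

theorem differentiableAt_of_halfPlane {f : ℂ → ℂ} {θ : ℝ}
    (hf : DifferentiableOn ℂ f (halfPlane θ)) {s : ℂ} (hs : θ < s.re) : DifferentiableAt ℂ f s :=
  hf.differentiableAt ((isOpen_halfPlane θ).mem_nhds hs)

theorem re_le_of_mem_closedBall {s z : ℂ} {θ : ℝ}
    (hz : z ∈ Metric.closedBall s ((s.re - θ) / 2)) : θ + (s.re - θ) / 2 ≤ z.re := by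
  have h1 : |(z - s).re| ≤ (s.re - θ) / 2 :=
    (Complex.abs_re_le_norm _).trans (by simpa [dist_eq_norm] using hz)
  rw [Complex.sub_re] at h1
  linarith [(abs_le.1 h1).1]

/-- Cauchy's estimate for a bounded function on a half-plane. -/
theorem norm_deriv_le_of_bounded {f : ℂ → ℂ} {θ B : ℝ} (hf : DifferentiableOn ℂ f (halfPlane θ))
    (hB : ∀ s ∈ halfPlane θ, ‖f s‖ ≤ B) {s : ℂ} (hs : θ < s.re) :
    ‖deriv f s‖ ≤ 2 * B / (s.re - θ) := by
  have hr : 0 < (s.re - θ) / 2 := by linarith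
  have hsub : Metric.closedBall s ((s.re - θ) / 2) ⊆ halfPlane θ := fun z hz => by
    have := re_le_of_mem_closedBall hz
    exact lt_of_lt_of_le (by linarith) this
  have h := Complex.norm_deriv_le_of_forall_mem_sphere_norm_le hr (f := f) (C := B) (c := s)
    ((hf.mono hsub).diffContOnCl_ball subset_rfl)
    fun z hz => hB z (hsub (Metric.sphere_subset_closedBall hz))
  refine h.trans_eq ?_
  field_simp

/-- An analytic function with bounded imaginary part on a half-plane has a derivative which is
bounded away from the boundary. -/
theorem norm_deriv_le_of_abs_im_le {f : ℂ → ℂ} {M : ℝ} (hf : DifferentiableOn ℂ f (halfPlane 0))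
    (hM : ∀ s ∈ halfPlane 0, |(f s).im| ≤ M) {s : ℂ} (hs : 0 < s.re) :
    ‖deriv f s‖ ≤ 2 * Real.exp M / s.re * Real.exp M := by
  -- The modulus of `exp(-i f)` is `exp(Im f)`, which lies between `exp(-M)` and `exp M`. Cauchy's
  -- estimate uses the upper bound, and the lower bound recovers `f'` from the derivative of the
  -- exponential.
  have hd : DifferentiableOn ℂ (fun z => Complex.exp (-Complex.I * f z)) (halfPlane 0) :=
    (hf.const_mul _).cexp
  have hnorm : ∀ z, ‖Complex.exp (-Complex.I * f z)‖ = Real.exp (f z).im := fun z => by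
    rw [Complex.norm_exp]; simp
  have h1 := norm_deriv_le_of_bounded (B := Real.exp M) hd (fun z hz => by
    rw [hnorm]
    exact Real.exp_le_exp.2 ((le_abs_self _).trans (hM z hz))) hs
  have h2 : HasDerivAt (fun z => Complex.exp (-Complex.I * f z))
      (Complex.exp (-Complex.I * f s) * (-Complex.I * deriv f s)) s :=
    ((differentiableAt_of_halfPlane hf hs).hasDerivAt.const_mul _).cexp
  rw [h2.deriv, norm_mul, norm_mul, norm_neg, Complex.norm_I, one_mul, hnorm, sub_zero] at h1
  have h3 : Real.exp (-M) ≤ Real.exp (f s).im :=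
    Real.exp_le_exp.2 (abs_le.1 (hM s hs)).1
  have h4 : Real.exp (-M) * ‖deriv f s‖ ≤ 2 * Real.exp M / s.re :=
    (mul_le_mul_of_nonneg_right h3 (norm_nonneg _)).trans h1
  calc ‖deriv f s‖ = Real.exp (-M) * ‖deriv f s‖ * Real.exp M := by
        rw [mul_right_comm, ← Real.exp_add]; simp
    _ ≤ _ := mul_le_mul_of_nonneg_right h4 (Real.exp_pos _).le

/-- Integrating the derivative bound over a segment gives a Lipschitz constant on `Re ≥ δ`. It
serves to carry a bound known far to the right back to `Re = δ`. -/
theorem norm_sub_le_of_abs_im_le {f : ℂ → ℂ} {M δ : ℝ} (hδ : 0 < δ)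
    (hf : DifferentiableOn ℂ f (halfPlane 0)) (hM : ∀ s ∈ halfPlane 0, |(f s).im| ≤ M)
    {s z : ℂ} (hs : δ ≤ s.re) (hz : δ ≤ z.re) :
    ‖f z - f s‖ ≤ 2 * Real.exp M / δ * Real.exp M * ‖z - s‖ := by
  have hconv : Convex ℝ {w : ℂ | δ ≤ w.re} := convex_halfSpace_re_ge δ
  refine hconv.norm_image_sub_le_of_norm_deriv_le (𝕜 := ℂ) (fun w hw => ?_) (fun w hw => ?_) hs hz
  · exact differentiableAt_of_halfPlane hf (lt_of_lt_of_le hδ hw)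
  · refine (norm_deriv_le_of_abs_im_le hf hM (lt_of_lt_of_le hδ hw)).trans ?_
    have hw' : δ ≤ w.re := hw
    gcongr

/-! ### Functions of class `𝒟` -/

/-- Convergence at one real point `x` bounds the partial sums there, so each term, a difference of
two of them, is bounded and `c n = O(n^x)`. Hence the series converges absolutely once `Re s > x +
1`; the margin `x + 2` makes the half-plane closed. -/
theorem InClassD.exists_LSeries {f : ℂ → ℂ} (hf : InClassD f) :
    ∃ (c : ℕ → ℂ) (X : ℝ), ∀ s : ℂ, X ≤ s.re → LSeriesSummable c s ∧ f s = LSeries c s := by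
  obtain ⟨c, θ, h⟩ := hf
  set x : ℝ := θ + 1 with hx
  have h0 := h (x : ℂ) (by simp [halfPlane, hx])
  obtain ⟨B, hB⟩ := h0.norm.bddAbove_range
  have hS : ∀ N, ‖∑ n ∈ Finset.Icc 1 N, c n * (n : ℂ) ^ (-(x : ℂ))‖ ≤ B := fun N => hB ⟨N, rfl⟩
  have hc : ∀ n : ℕ, n ≠ 0 → ‖c n‖ ≤ (2 * B) * (n : ℝ) ^ x := by
    intro n hn
    obtain ⟨m, rfl⟩ := Nat.exists_eq_succ_of_ne_zero hn
    have h1 : c (m + 1) * ((m + 1 : ℕ) : ℂ) ^ (-(x : ℂ)) =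
        (∑ n ∈ Finset.Icc 1 (m + 1), c n * (n : ℂ) ^ (-(x : ℂ))) -
          ∑ n ∈ Finset.Icc 1 m, c n * (n : ℂ) ^ (-(x : ℂ)) := by
      rw [Finset.sum_Icc_succ_top (by omega)]; ring
    have h2 : ‖c (m + 1) * ((m + 1 : ℕ) : ℂ) ^ (-(x : ℂ))‖ ≤ 2 * B := by
      rw [h1]
      refine (norm_sub_le _ _).trans ?_
      linarith [hS (m + 1), hS m]
    rw [norm_mul, Complex.norm_natCast_cpow_of_pos (by omega), Complex.neg_re, Complex.ofReal_re,
      Real.rpow_neg (by positivity), ← div_eq_mul_inv, div_le_iff₀ (by positivity)] at h2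
    exact h2
  have hsum : ∀ s : ℂ, x + 2 ≤ s.re → LSeriesSummable c s := fun s hs =>
    LSeriesSummable_of_le_const_mul_rpow (x := x + 1) (by linarith) ⟨2 * B, fun n hn => by
      simpa using hc n hn⟩
  refine ⟨c, x + 2, fun s hs => ⟨hsum s hs, ?_⟩⟩
  have h1 := h s (show θ < s.re by linarith)
  have h2 := ((hsum s hs).hasSum.tendsto_sum_nat).comp (tendsto_add_atTop_nat 1)
  refine tendsto_nhds_unique h1 (h2.congr fun N => ?_)
  rw [Function.comp, Finset.sum_range_succ', LSeries.term_zero, add_zero,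
    ← Finset.Ico_add_one_right_eq_Icc, Finset.sum_Ico_eq_sum_range, Nat.add_sub_cancel]
  refine Finset.sum_congr rfl fun k _ => ?_
  rw [LSeries.term_of_ne_zero (by omega), Complex.cpow_neg, add_comm, div_eq_mul_inv]

theorem norm_LSeries_le_of_re_le {c : ℕ → ℂ} {X : ℝ} {s : ℂ} (hX : LSeriesSummable c X)
    (hs : X ≤ s.re) : ‖LSeries c s‖ ≤ ∑' n, ‖LSeries.term c X n‖ := by
  refine tsum_of_norm_bounded hX.norm.hasSum fun n => ?_
  exact LSeries.norm_term_le_of_re_le_re c (by simpa using hs) n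

theorem InClassD.exists_bound {f : ℂ → ℂ} (hf : InClassD f) :
    ∃ X C : ℝ, ∀ s : ℂ, X ≤ s.re → ‖f s‖ ≤ C := by
  obtain ⟨c, X, h⟩ := hf.exists_LSeries
  refine ⟨X, ∑' n, ‖LSeries.term c X n‖, fun s hs => ?_⟩
  rw [(h s hs).2]
  exact norm_LSeries_le_of_re_le (h X (by simp)).1 hs

/-- A function of class `𝒟` with bounded imaginary part on `Re s > 0` is bounded on each smaller
half-plane. -/
theorem InClassD.bounded_of_abs_im_le {f : ℂ → ℂ} {M δ : ℝ} (hD : InClassD f) (hδ : 0 < δ)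
    (hf : DifferentiableOn ℂ f (halfPlane 0)) (hM : ∀ s ∈ halfPlane 0, |(f s).im| ≤ M) :
    ∃ C : ℝ, ∀ s : ℂ, δ ≤ s.re → ‖f s‖ ≤ C := by
  obtain ⟨X, C, h⟩ := hD.exists_bound
  refine ⟨C + 2 * Real.exp M / δ * Real.exp M * |X|, fun s hs => ?_⟩
  -- The shifted point satisfies `Re z ≥ X` and lies at distance `|X|` from `s`, whatever `s` is.
  set z : ℂ := s + (|X| : ℝ) with hz
  have hzre : z.re = s.re + |X| := by simp [hz]
  have h1 : ‖f z‖ ≤ C := h z (by rw [hzre]; linarith [le_abs_self X])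
  have h2 := norm_sub_le_of_abs_im_le hδ hf hM (s := z) (z := s)
    (by rw [hzre]; linarith [abs_nonneg X]) hs
  have h3 : ‖s - z‖ = |X| := by simp [hz]
  rw [h3] at h2
  calc ‖f s‖ = ‖f z + (f s - f z)‖ := by congr 1; ring
    _ ≤ ‖f z‖ + ‖f s - f z‖ := norm_add_le _ _
    _ ≤ _ := by linarith

/-! ### Littlewood's inequality -/

theorem blaschke_denom_ne_zero {a s : ℂ} (ha : 0 < a.re) (hs : 0 < s.re) :
    s + (starRingEnd ℂ) a ≠ 0 := by
  intro h
  have := congrArg Complex.re h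
  simp at this
  linarith

/-- This is `|s + ā|² - |s - a|² = 4 Re s Re a`. Its sign shows that Blaschke factors are
contractive, and its size at `+∞` produces Littlewood's inequality. -/
theorem one_sub_normSq_blaschke {a s : ℂ} (ha : 0 < a.re) (hs : 0 < s.re) :
    1 - ‖(s - a) / (s + (starRingEnd ℂ) a)‖ ^ 2 =
      4 * s.re * a.re / ‖s + (starRingEnd ℂ) a‖ ^ 2 := by
  have h0 : ‖s + (starRingEnd ℂ) a‖ ≠ 0 := norm_ne_zero_iff.2 (blaschke_denom_ne_zero ha hs)
  rw [norm_div, div_pow, eq_div_iff (pow_ne_zero 2 h0), sub_mul, div_mul_cancel₀ _ (pow_ne_zero 2 h0),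
    one_mul, ← Complex.normSq_eq_norm_sq, ← Complex.normSq_eq_norm_sq, Complex.normSq_apply,
    Complex.normSq_apply]
  simp
  ring

theorem norm_blaschke_lt_one {a s : ℂ} (ha : 0 < a.re) (hs : 0 < s.re) :
    ‖(s - a) / (s + (starRingEnd ℂ) a)‖ < 1 := by
  have h0 : 0 < ‖s + (starRingEnd ℂ) a‖ := norm_pos_iff.2 (blaschke_denom_ne_zero ha hs)
  have h := one_sub_normSq_blaschke ha hs
  have : 0 < 4 * s.re * a.re / ‖s + (starRingEnd ℂ) a‖ ^ 2 := by positivity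
  nlinarith [norm_nonneg ((s - a) / (s + (starRingEnd ℂ) a))]

/-- The Schwarz lemma on the half-plane. -/
theorem norm_le_blaschke {q : ℂ → ℂ} {a s : ℂ} (hq : DifferentiableOn ℂ q (halfPlane 0))
    (hq1 : ∀ z ∈ halfPlane 0, ‖q z‖ ≤ 1) (ha : 0 < a.re) (hqa : q a = 0) (hs : 0 < s.re) :
    ‖q s‖ ≤ ‖(s - a) / (s + (starRingEnd ℂ) a)‖ := by
  -- The inverse of the Blaschke factor of `a`: it maps the unit disc into the half-plane and sends
  -- `0` to `a`, so the Schwarz lemma on the disc applies to `q ∘ m`.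
  set m : ℂ → ℂ := fun z => (a + (starRingEnd ℂ) a * z) / (1 - z) with hm
  have hne : ∀ z ∈ Metric.ball (0 : ℂ) 1, 1 - z ≠ 0 := by
    intro z hz h
    rw [← sub_eq_zero.1 h] at hz
    simp at hz
  have hmd : DifferentiableOn ℂ m (Metric.ball 0 1) := by
    intro z hz
    exact (((differentiableAt_const _).add ((differentiableAt_id).const_mul _)).div
      ((differentiableAt_const _).sub differentiableAt_id) (hne z hz)).differentiableWithinAt
  have hmm : MapsTo m (Metric.ball 0 1) (halfPlane 0) := by
    intro z hz
    have hz1 : ‖z‖ < 1 := by simpa using hz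
    have h0 : 0 < ‖1 - z‖ := norm_pos_iff.2 (hne z hz)
    have h1 : (m z).re = a.re * (1 - ‖z‖ ^ 2) / ‖1 - z‖ ^ 2 := by
      rw [hm]
      simp only
      rw [Complex.div_re, ← Complex.normSq_eq_norm_sq, ← Complex.normSq_eq_norm_sq, ← add_div]
      congr 1
      simp [Complex.normSq_apply]
      ring
    show 0 < (m z).re
    rw [h1]
    have : 0 < 1 - ‖z‖ ^ 2 := by nlinarith [norm_nonneg z]
    positivity
  have hsb := norm_blaschke_lt_one ha hs
  have h := Complex.norm_le_norm_of_mapsTo_ball (R := 1) (f := q ∘ m)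
    (z := (s - a) / (s + (starRingEnd ℂ) a)) (hq.comp hmd hmm)
    (fun z hz => by simpa using hq1 _ (hmm hz)) (by simp [hm, hqa]) hsb
  have hms : m ((s - a) / (s + (starRingEnd ℂ) a)) = s := by
    have h1 := blaschke_denom_ne_zero ha hs
    have h2 := blaschke_denom_ne_zero ha ha
    rw [hm]
    simp only
    have h3 : 1 - (s - a) / (s + (starRingEnd ℂ) a) =
        (a + (starRingEnd ℂ) a) / (s + (starRingEnd ℂ) a) := by
      field_simp; ring
    rw [h3]
    field_simp
    ring
  simpa [hms] using h

/-- Division by a Blaschke factor. -/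
theorem exists_blaschke_quotient {q : ℂ → ℂ} {a : ℂ} (hq : DifferentiableOn ℂ q (halfPlane 0))
    (hq1 : ∀ z ∈ halfPlane 0, ‖q z‖ ≤ 1) (ha : 0 < a.re) (hqa : q a = 0) :
    ∃ r : ℂ → ℂ, DifferentiableOn ℂ r (halfPlane 0) ∧ (∀ z ∈ halfPlane 0, ‖r z‖ ≤ 1) ∧
      ∀ z ∈ halfPlane 0, q z = (z - a) / (z + (starRingEnd ℂ) a) * r z := by
  -- Writing the quotient with `dslope` makes it analytic at `a` too. The bound by `1` comes from
  -- the Schwarz lemma off `a`, and from continuity at `a`.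
  have hrd : DifferentiableOn ℂ (fun z => (z + (starRingEnd ℂ) a) * dslope q a z)
      (halfPlane 0) :=
    (differentiableOn_id.add_const _).mul
      ((Complex.differentiableOn_dslope ((isOpen_halfPlane 0).mem_nhds ha)).2 hq)
  have hfac : ∀ z ∈ halfPlane 0, q z = (z - a) / (z + (starRingEnd ℂ) a) *
      ((z + (starRingEnd ℂ) a) * dslope q a z) := by
    intro z hz
    have h1 := blaschke_denom_ne_zero ha hz
    have h2 := sub_smul_dslope q a z
    rw [hqa, sub_zero, smul_eq_mul] at h2
    rw [← mul_assoc, div_mul_cancel₀ _ h1, h2]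
  refine ⟨_, hrd, ?_, hfac⟩
  have hoff : ∀ z ∈ halfPlane 0, z ≠ a → ‖(z + (starRingEnd ℂ) a) * dslope q a z‖ ≤ 1 := by
    intro z hz hza
    have h1 := norm_le_blaschke hq hq1 ha hqa hz
    rw [hfac z hz, norm_mul] at h1
    have h2 : 0 < ‖(z - a) / (z + (starRingEnd ℂ) a)‖ :=
      norm_pos_iff.2 (div_ne_zero (sub_ne_zero.2 hza) (blaschke_denom_ne_zero ha hz))
    by_contra! h3
    nlinarith
  intro z hz
  by_cases hza : z = a
  · subst hza
    have hc : ContinuousAt (fun w => ‖(w + (starRingEnd ℂ) z) * dslope q z w‖) z :=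
      (differentiableAt_of_halfPlane hrd hz).continuousAt.norm
    refine le_of_tendsto (hc.tendsto.mono_left (nhdsWithin_le_nhds (s := {z}ᶜ))) ?_
    filter_upwards [self_mem_nhdsWithin, nhdsWithin_le_nhds ((isOpen_halfPlane 0).mem_nhds hz)]
      with w hw hw' using hoff w hw' hw
  · exact hoff z hz hza

/-- Blaschke factors are divided out one at a time: the quotient is again bounded by `1` and still
vanishes at the remaining points, since these differ from the one removed. The induction therefore
has to run over all `q`. -/
theorem norm_le_prod_blaschke (F : Finset ℂ) : ∀ {q : ℂ → ℂ},
    DifferentiableOn ℂ q (halfPlane 0) → (∀ z ∈ halfPlane 0, ‖q z‖ ≤ 1) →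
    (∀ a ∈ F, a ∈ halfPlane 0 ∧ q a = 0) → ∀ s ∈ halfPlane 0,
    ‖q s‖ ≤ ∏ a ∈ F, ‖(s - a) / (s + (starRingEnd ℂ) a)‖ := by
  classical
  induction F using Finset.induction_on with
  | empty => intro q _ hq1 _ s hs; simpa using hq1 s hs
  | insert a F haF ih =>
    intro q hq hq1 hF s hs
    obtain ⟨ha, hqa⟩ := hF a (Finset.mem_insert_self _ _)
    obtain ⟨r, hr, hr1, hfac⟩ := exists_blaschke_quotient hq hq1 ha hqa
    have hrF : ∀ b ∈ F, b ∈ halfPlane 0 ∧ r b = 0 := by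
      intro b hb
      obtain ⟨hb0, hqb⟩ := hF b (Finset.mem_insert_of_mem hb)
      refine ⟨hb0, ?_⟩
      rw [hfac b hb0] at hqb
      refine (mul_eq_zero.1 hqb).resolve_left
        (div_ne_zero (sub_ne_zero.2 ?_) (blaschke_denom_ne_zero ha hb0))
      rintro rfl
      exact haF hb
    rw [Finset.prod_insert haF, hfac s hs, norm_mul]
    exact mul_le_mul_of_nonneg_left (ih hr hr1 hrF s hs) (norm_nonneg _)

/-- First-order expansion at `+∞`: if each factor is `1 - l_i / x + o(1/x)`, so is the product, with
the `l_i` added. The induction uses `1 - uP = (1 - u) + u (1 - P)`. -/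
theorem tendsto_mul_one_sub_prod {ι : Type*} {u : ι → ℝ → ℝ} {l : ι → ℝ} (F : Finset ι)
    (h : ∀ i ∈ F, Tendsto (fun x => x * (1 - u i x)) atTop (𝓝 (l i))) :
    Tendsto (fun x => x * (1 - ∏ i ∈ F, u i x)) atTop (𝓝 (∑ i ∈ F, l i)) := by
  classical
  induction F using Finset.induction_on with
  | empty => simp
  | insert a F haF ih =>
    have h1 := h a (Finset.mem_insert_self _ _)
    have h2 := ih fun i hi => h i (Finset.mem_insert_of_mem hi)
    have h3 : Tendsto (fun x => u a x) atTop (𝓝 1) := by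
      have h4 : Tendsto (fun x : ℝ => 1 - x⁻¹ * (x * (1 - u a x))) atTop (𝓝 (1 - 0 * l a)) :=
        tendsto_const_nhds.sub (tendsto_inv_atTop_zero.mul h1)
      rw [zero_mul, sub_zero] at h4
      refine h4.congr' ?_
      filter_upwards [eventually_gt_atTop 0] with x hx
      field_simp
      ring
    have h5 := h1.add (h3.mul h2)
    rw [one_mul] at h5
    rw [Finset.sum_insert haF]
    refine h5.congr fun x => ?_
    rw [Finset.prod_insert haF]
    ring

/-- The hypothesis gives `Φ(x) / x → c`, and the defect equals `4 Re Φ(x) Re w / |Φ(x) + w̄|²`,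
hence is asymptotic to `4 Re w / (c x)`. The case `Φ = id` covers the Blaschke factors themselves.
-/
theorem tendsto_mul_blaschke_defect {Φ : ℂ → ℂ} {c C : ℝ} (hc : 0 < c)
    (h : ∀ᶠ x : ℝ in atTop, ‖Φ x - c * x‖ ≤ C) {w : ℂ} (hw : 0 < w.re) :
    Tendsto (fun x : ℝ => x * (1 - ‖(Φ x - w) / (Φ x + (starRingEnd ℂ) w)‖ ^ 2)) atTop
      (𝓝 (4 * w.re / c)) := by
  have hi : Tendsto (fun x : ℝ => x⁻¹) atTop (𝓝 0) := tendsto_inv_atTop_zero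
  have h1 : Tendsto (fun x : ℝ => ((x⁻¹ : ℝ) : ℂ) * (Φ x - c * x)) atTop (𝓝 0) := by
    rw [tendsto_zero_iff_norm_tendsto_zero]
    refine squeeze_zero' (Eventually.of_forall fun _ => norm_nonneg _) ?_
      (by simpa using hi.mul_const C)
    filter_upwards [h, eventually_gt_atTop 0] with x hx hx0
    rw [norm_mul, Complex.norm_real, Real.norm_of_nonneg (inv_pos.2 hx0).le]
    gcongr
  have h2 : Tendsto (fun x : ℝ => ((x⁻¹ : ℝ) : ℂ) * Φ x) atTop (𝓝 c) := by
    have := h1.add_const (c : ℂ)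
    rw [zero_add] at this
    refine this.congr' ?_
    filter_upwards [eventually_gt_atTop 0] with x hx0
    have : (x : ℂ) ≠ 0 := Complex.ofReal_ne_zero.2 hx0.ne'
    push_cast
    field_simp
    ring
  have h3 : Tendsto (fun x : ℝ => ((x⁻¹ : ℝ) : ℂ) * (Φ x + (starRingEnd ℂ) w)) atTop (𝓝 c) := by
    have h4 : Tendsto (fun x : ℝ => ((x⁻¹ : ℝ) : ℂ) * (starRingEnd ℂ) w) atTop (𝓝 0) := by
      have := ((Complex.continuous_ofReal.tendsto 0).comp hi).mul_const ((starRingEnd ℂ) w)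
      simpa using this
    simpa [mul_add] using h2.add h4
  have hre : Tendsto (fun x : ℝ => (((x⁻¹ : ℝ) : ℂ) * Φ x).re) atTop (𝓝 c) := by
    exact (Complex.continuous_re.tendsto _).comp h2
  have hpos : ∀ᶠ x : ℝ in atTop, 0 < (((x⁻¹ : ℝ) : ℂ) * Φ x).re := hre.eventually_const_lt hc
  have h5 : Tendsto (fun x : ℝ => 4 * (((x⁻¹ : ℝ) : ℂ) * Φ x).re * w.re /
      ‖((x⁻¹ : ℝ) : ℂ) * (Φ x + (starRingEnd ℂ) w)‖ ^ 2) atTop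
      (𝓝 (4 * c * w.re / ‖(c : ℂ)‖ ^ 2)) := by
    refine ((hre.const_mul 4).mul_const _).div (h3.norm.pow 2) ?_
    simpa using hc.ne'
  have h6 : 4 * c * w.re / ‖(c : ℂ)‖ ^ 2 = 4 * w.re / c := by
    rw [Complex.norm_real, Real.norm_of_nonneg hc.le]
    field_simp
  rw [h6] at h5
  refine h5.congr' ?_
  filter_upwards [hpos, eventually_gt_atTop 0] with x hx hx0
  rw [Complex.re_ofReal_mul] at hx ⊢
  have hΦ : 0 < (Φ x).re := pos_of_mul_pos_right hx (inv_pos.2 hx0).le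
  rw [one_sub_normSq_blaschke hw hΦ, norm_mul, Complex.norm_real,
    Real.norm_of_nonneg (inv_pos.2 hx0).le]
  field_simp

/-- Littlewood's inequality for a self-map of the right half-plane with `Φ(s) = c s + O(1)`. -/
theorem sum_re_le_of_selfMap {Φ : ℂ → ℂ} {c C : ℝ} (hc : 0 < c)
    (hΦ : DifferentiableOn ℂ Φ (halfPlane 0)) (hmaps : MapsTo Φ (halfPlane 0) (halfPlane 0))
    (h : ∀ᶠ x : ℝ in atTop, ‖Φ x - c * x‖ ≤ C) {w : ℂ} (hw : 0 < w.re) (F : Finset ℂ)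
    (hF : ∀ a ∈ F, a ∈ halfPlane 0 ∧ Φ a = w) : ∑ a ∈ F, a.re ≤ w.re / c := by
  set q : ℂ → ℂ := fun s => (Φ s - w) / (Φ s + (starRingEnd ℂ) w) with hqdef
  have hq : DifferentiableOn ℂ q (halfPlane 0) := by
    intro s hs
    exact ((hΦ s hs).sub_const _).div ((hΦ s hs).add_const _)
      (blaschke_denom_ne_zero hw (hmaps hs))
  have hq1 : ∀ z ∈ halfPlane 0, ‖q z‖ ≤ 1 := fun z hz => (norm_blaschke_lt_one hw (hmaps hz)).le
  have hFq : ∀ a ∈ F, a ∈ halfPlane 0 ∧ q a = 0 := fun a ha =>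
    ⟨(hF a ha).1, by simp [hqdef, (hF a ha).2]⟩
  -- The inequality `|q|² ≤ ∏ |b_a|²` on the positive axis is compared to first order at `+∞`: it
  -- becomes `4 ∑ Re a ≤ 4 Re w / c`.
  have h1 : Tendsto (fun x : ℝ =>
      x * (1 - ∏ a ∈ F, ‖((x : ℂ) - a) / (x + (starRingEnd ℂ) a)‖ ^ 2)) atTop
      (𝓝 (∑ a ∈ F, 4 * a.re / 1)) :=
    tendsto_mul_one_sub_prod F fun a ha =>
      tendsto_mul_blaschke_defect (Φ := fun s => s) (C := 0) one_pos
        (Eventually.of_forall fun x => by simp) (hF a ha).1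
  have h2 := tendsto_mul_blaschke_defect hc h hw
  have h3 := le_of_tendsto_of_tendsto h1 h2 (by
    filter_upwards [eventually_gt_atTop 0] with x hx
    have h4 := norm_le_prod_blaschke F hq hq1 hFq (x : ℂ) (by simpa [halfPlane] using hx)
    have h5 : ‖q x‖ ^ 2 ≤ ∏ a ∈ F, ‖((x : ℂ) - a) / (x + (starRingEnd ℂ) a)‖ ^ 2 := by
      rw [Finset.prod_pow]
      gcongr
    have h6 : 1 - ∏ a ∈ F, ‖((x : ℂ) - a) / (x + (starRingEnd ℂ) a)‖ ^ 2 ≤ 1 - ‖q x‖ ^ 2 := by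
      linarith
    exact mul_le_mul_of_nonneg_left h6 hx.le)
  simp only [div_one] at h3
  rw [← Finset.mul_sum, mul_div_assoc] at h3
  linarith

end DirichletComposition

namespace DirichletComposition

/-! ### Dirichlet series with square summable coefficients -/

/-- The coefficients as a function on `ℕ`, with value `0` at `0`. -/
noncomputable def DirichletSpace.seq {w : Weight} (f : DirichletSpace w) (n : ℕ) : ℂ :=
  if h : 0 < n then f.coeff ⟨n, h⟩ else 0

theorem DirichletSpace.seq_coe {w : Weight} (f : DirichletSpace w) (n : ℕ+) :
    f.seq n = f.coeff n := by
  rw [seq, dif_pos n.pos]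
  rfl

theorem DirichletSpace.eval_eq_LSeries {w : Weight} (f : DirichletSpace w) (s : ℂ) :
    f.eval s = LSeries f.seq s := by
  rw [eval, LSeries, ← PNat.coe_injective.tsum_eq]
  · refine tsum_congr fun n => ?_
    rw [LSeries.term_of_ne_zero n.ne_zero, f.seq_coe, Complex.cpow_neg, div_eq_mul_inv]
  · intro n hn
    have : n ≠ 0 := by
      rintro rfl
      simp at hn
    exact ⟨⟨n, Nat.pos_of_ne_zero this⟩, rfl⟩

theorem DirichletSpace.coeff_sub {w : Weight} (f g : DirichletSpace w) (n : ℕ+) :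
    (f - g).coeff n = f.coeff n - g.coeff n := rfl

theorem DirichletSpace.coeff_add {w : Weight} (f g : DirichletSpace w) (n : ℕ+) :
    (f + g).coeff n = f.coeff n + g.coeff n := rfl

theorem DirichletSpace.coeff_smul {w : Weight} (c : ℂ) (f : DirichletSpace w) (n : ℕ+) :
    (c • f).coeff n = c * f.coeff n := rfl

theorem DirichletSpace.summable {w : Weight} (f : DirichletSpace w) :
    Summable fun n => ‖f.coeff n‖ ^ 2 * w.toFun n := f.2

theorem DirichletSpace.sum_le_norm_sq {w : Weight} (f : DirichletSpace w) (S : Finset ℕ+) :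
    ∑ n ∈ S, ‖f.coeff n‖ ^ 2 * w.toFun n ≤ ‖f‖ ^ 2 := by
  rw [f.norm_sq]
  exact f.summable.sum_le_tsum S fun n _ => mul_nonneg (sq_nonneg _) (w.pos n).le

theorem DirichletSpace.norm_coeff_le {w : Weight} (f : DirichletSpace w) (n : ℕ+) :
    ‖f.coeff n‖ ≤ ‖f‖ / Real.sqrt (w.toFun n) := by
  have h := f.sum_le_norm_sq {n}
  rw [Finset.sum_singleton] at h
  rw [le_div_iff₀ (Real.sqrt_pos.2 (w.pos n))]
  refine abs_le_of_sq_le_sq' ?_ (norm_nonneg _) |>.2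
  rw [mul_pow, Real.sq_sqrt (w.pos n).le]
  exact h

/-- The Dirichlet polynomial `∑_{n ∈ S} a n n^{-s}`. -/
noncomputable def polynomial (w : Weight) (S : Finset ℕ+) (a : ℕ+ → ℂ) : DirichletSpace w :=
  ⟨fun n => if n ∈ S then a n else 0, by
    refine summable_of_ne_finset_zero (s := S) fun n hn => ?_
    simp [hn]⟩

theorem coeff_polynomial (w : Weight) (S : Finset ℕ+) (a : ℕ+ → ℂ) (n : ℕ+) :
    (polynomial w S a).coeff n = if n ∈ S then a n else 0 := rfl

theorem eval_polynomial (w : Weight) (S : Finset ℕ+) (a : ℕ+ → ℂ) (s : ℂ) :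
    (polynomial w S a).eval s = ∑ n ∈ S, a n * ((n : ℕ) : ℂ) ^ (-s) := by
  rw [DirichletSpace.eval, tsum_eq_sum (s := S)]
  · exact Finset.sum_congr rfl fun n hn => by rw [coeff_polynomial, if_pos hn]
  · intro n hn
    rw [coeff_polynomial, if_neg hn, zero_mul]

theorem norm_sq_polynomial (w : Weight) (S : Finset ℕ+) (a : ℕ+ → ℂ) :
    ‖polynomial w S a‖ ^ 2 = ∑ n ∈ S, ‖a n‖ ^ 2 * w.toFun n := by
  rw [DirichletSpace.norm_sq, tsum_eq_sum (s := S)]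
  · exact Finset.sum_congr rfl fun n hn => by rw [coeff_polynomial, if_pos hn]
  · intro n hn
    rw [coeff_polynomial, if_neg hn, norm_zero]
    simp

/-- Dirichlet polynomials are dense: partial sums converge. -/
theorem tendsto_polynomial {w : Weight} (f : DirichletSpace w) :
    Tendsto (fun S => polynomial w S f.coeff) atTop (𝓝 f) := by
  rw [tendsto_iff_norm_sub_tendsto_zero]
  have h1 : ∀ S, ‖polynomial w S f.coeff - f‖ ^ 2 =
      ‖f‖ ^ 2 - ∑ n ∈ S, ‖f.coeff n‖ ^ 2 * w.toFun n := by
    intro S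
    rw [DirichletSpace.norm_sq, f.norm_sq, eq_sub_iff_add_eq]
    have h2 := (hasSum_sum_of_ne_finset_zero (L := SummationFilter.unconditional _) (f := fun n : ℕ+ => if n ∈ S then
      ‖f.coeff n‖ ^ 2 * w.toFun n else 0) (s := S) fun n hn => if_neg hn)
    have h3 := ((polynomial w S f.coeff - f).summable.hasSum).add h2
    have h4 : ∑ n ∈ S, (if n ∈ S then ‖f.coeff n‖ ^ 2 * w.toFun n else 0) =
        ∑ n ∈ S, ‖f.coeff n‖ ^ 2 * w.toFun n := Finset.sum_congr rfl fun n hn => if_pos hn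
    rw [h4] at h3
    refine (h3.tsum_eq.symm.trans (tsum_congr fun n => ?_))
    rw [DirichletSpace.coeff_sub, coeff_polynomial]
    split_ifs <;> simp
  have h5 : Tendsto (fun S => ‖polynomial w S f.coeff - f‖ ^ 2) atTop (𝓝 0) := by
    simp_rw [h1]
    have := f.summable.hasSum
    rw [← f.norm_sq] at this
    rw [HasSum, SummationFilter.unconditional_filter] at this
    rw [← sub_self (‖f‖ ^ 2)]
    exact tendsto_const_nhds.sub this
  have h6 := (Real.continuous_sqrt.tendsto 0).comp h5
  simpa [Function.comp_def, Real.sqrt_sq (norm_nonneg _)] using h6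

/-! ### The Bergman weight -/

theorem integrableOn_bergmanWeight (h : BergmanDensity) (n : ℕ+) :
    IntegrableOn (fun σ => ((n : ℕ) : ℝ) ^ (-2 * σ) * h.toFun σ) (Ioi 0) := by
  have hn : (1 : ℝ) ≤ ((n : ℕ) : ℝ) := by exact_mod_cast n.2
  have hn0 : (0 : ℝ) < ((n : ℕ) : ℝ) := by linarith
  have hcont : Continuous fun σ : ℝ => ((n : ℕ) : ℝ) ^ (-2 * σ) :=
    continuous_const.rpow (by fun_prop) fun _ => Or.inl hn0.ne'
  refine Integrable.bdd_mul (c := 1) h.integrable hcont.aestronglyMeasurable ?_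
  filter_upwards [ae_restrict_mem measurableSet_Ioi] with σ hσ
  have hσ' : (0 : ℝ) < σ := hσ
  rw [Real.norm_eq_abs, abs_of_nonneg (Real.rpow_nonneg hn0.le _)]
  exact Real.rpow_le_one_of_one_le_of_nonpos hn (by linarith)

theorem bergmanWeight_le_one (h : BergmanDensity) (n : ℕ+) : (bergmanWeight h).toFun n ≤ 1 := by
  have hn : (1 : ℝ) ≤ ((n : ℕ) : ℝ) := by exact_mod_cast n.2
  rw [← h.integral_eq_one]
  refine setIntegral_mono_on (integrableOn_bergmanWeight h n) h.integrable measurableSet_Ioi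
    fun σ hσ => ?_
  have hσ' : (0 : ℝ) < σ := hσ
  exact mul_le_of_le_one_left (h.nonneg σ hσ)
    (Real.rpow_le_one_of_one_le_of_nonpos hn (by linarith))

/-- Since `0` is in the support, `c = μ(0, ε/2)` is positive, and `n^(-2σ) ≥ n^(-ε)` on that
interval. So the weight decays more slowly than any power, and Bergman functions behave like `ℋ²`
functions up to an arbitrarily small exponent. -/
theorem exists_le_bergmanWeight (h : BergmanDensity) {ε : ℝ} (hε : 0 < ε) :
    ∃ c : ℝ, 0 < c ∧ ∀ n : ℕ+, c * ((n : ℕ) : ℝ) ^ (-ε) ≤ (bergmanWeight h).toFun n := by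
  refine ⟨_, h.zero_mem_support (ε / 2) (by positivity), fun n => ?_⟩
  have hn : (1 : ℝ) ≤ ((n : ℕ) : ℝ) := by exact_mod_cast n.2
  have hsub : Ioo 0 (ε / 2) ⊆ Ioi (0 : ℝ) := fun x hx => hx.1
  have hint := integrableOn_bergmanWeight h n
  rw [← integral_mul_const]
  refine (setIntegral_mono_on ((h.integrable.mono_set hsub).mul_const _) (hint.mono_set hsub)
    measurableSet_Ioo fun σ hσ => ?_).trans (setIntegral_mono_set hint ?_ hsub.eventuallyLE)
  · rw [mul_comm]
    refine mul_le_mul_of_nonneg_right (Real.rpow_le_rpow_of_exponent_le hn ?_) (h.nonneg σ hσ.1)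
    linarith [hσ.2]
  · filter_upwards [ae_restrict_mem measurableSet_Ioi] with σ hσ
    exact mul_nonneg (Real.rpow_nonneg (by linarith) _) (h.nonneg σ hσ)

/-- Weighted Cauchy–Schwarz estimate for the partial series over a set of integers. -/
theorem LSeries_indicator_bound {w : Weight} {c ε : ℝ} (hc : 0 < c)
    (hw : ∀ n : ℕ+, c * ((n : ℕ) : ℝ) ^ (-ε) ≤ w.toFun n) {A : Set ℕ} {x : ℝ}
    (hA : Summable (A.indicator fun n : ℕ => (n : ℝ) ^ (ε - 2 * x))) :
    ∃ C : ℝ, ∀ (f : DirichletSpace w) (s : ℂ), s.re = x →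
      LSeriesSummable (A.indicator f.seq) s ∧ ‖LSeries (A.indicator f.seq) s‖ ≤ ‖f‖ * C := by
  -- The power `n^(-x)` is split as `n^(ε/2 - x) n^(-ε/2)`; the second factor is at most `√(w n) /
  -- √c`. Cauchy–Schwarz then pairs `v` with `|a_n| √(w n)`, uniformly in `Im s`.
  set v : ℕ → ℝ := A.indicator fun n : ℕ => (n : ℝ) ^ (ε / 2 - x) with hv
  have hv0 : ∀ n, 0 ≤ v n := fun n => indicator_nonneg (fun n _ => by positivity) n
  have hv2 : ∀ n : ℕ+, v n ^ 2 = A.indicator (fun n : ℕ => (n : ℝ) ^ (ε - 2 * x)) n := by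
    intro n
    have hn : (0 : ℝ) < ((n : ℕ) : ℝ) := by exact_mod_cast n.2
    by_cases h : (n : ℕ) ∈ A
    · rw [hv, indicator_of_mem h, indicator_of_mem h, ← Real.rpow_natCast, ← Real.rpow_mul hn.le]
      congr 1
      push_cast
      ring
    · rw [hv, indicator_of_notMem h, indicator_of_notMem h]
      simp
  have hvs : Summable fun n : ℕ+ => v n ^ 2 := by
    simp_rw [hv2]
    exact hA.comp_injective PNat.coe_injective
  refine ⟨Real.sqrt (∑' n : ℕ+, v n ^ 2) / Real.sqrt c, fun f s hs => ?_⟩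
  set u : ℕ+ → ℝ := fun n => ‖f.coeff n‖ * Real.sqrt (w.toFun n) with hu
  have hu0 : ∀ n, 0 ≤ u n := fun n => by positivity
  have hu2 : ∀ n, u n ^ 2 = ‖f.coeff n‖ ^ 2 * w.toFun n := fun n => by
    rw [hu]
    simp only
    rw [mul_pow, Real.sq_sqrt (w.pos n).le]
  have hus : Summable fun n => u n ^ 2 := by
    simp_rw [hu2]
    exact f.summable
  have hterm : ∀ n : ℕ+, ‖LSeries.term (A.indicator f.seq) s n‖ ≤ u n * v n / Real.sqrt c := by
    intro n
    have hn : (0 : ℝ) < ((n : ℕ) : ℝ) := by exact_mod_cast n.2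
    rw [LSeries.norm_term_eq, if_neg n.ne_zero, hs]
    by_cases h : (n : ℕ) ∈ A
    · rw [indicator_of_mem h, f.seq_coe, hv, indicator_of_mem h, hu, le_div_iff₀ (Real.sqrt_pos.2 hc)]
      have h1 : Real.sqrt c * ((n : ℕ) : ℝ) ^ (-(ε / 2)) ≤ Real.sqrt (w.toFun n) := by
        refine Real.le_sqrt_of_sq_le ?_
        rw [mul_pow, Real.sq_sqrt hc.le, ← Real.rpow_natCast, ← Real.rpow_mul hn.le]
        convert hw n using 3
        push_cast
        ring
      have h2 : ((n : ℕ) : ℝ) ^ (ε / 2 - x) =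
          ((n : ℕ) : ℝ) ^ (ε / 2) * (((n : ℕ) : ℝ) ^ x)⁻¹ := by
        rw [Real.rpow_sub hn, div_eq_mul_inv]
      have h3 : Real.sqrt c ≤ Real.sqrt (w.toFun n) * ((n : ℕ) : ℝ) ^ (ε / 2) := by
        rw [Real.rpow_neg hn.le, ← div_eq_mul_inv, div_le_iff₀ (by positivity)] at h1
        exact h1
      simp only
      rw [h2, div_eq_mul_inv]
      calc ‖f.coeff n‖ * (((n : ℕ) : ℝ) ^ x)⁻¹ * Real.sqrt c
          ≤ ‖f.coeff n‖ * (((n : ℕ) : ℝ) ^ x)⁻¹ *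
            (Real.sqrt (w.toFun n) * ((n : ℕ) : ℝ) ^ (ε / 2)) := by gcongr
        _ = _ := by ring
    · rw [indicator_of_notMem h, norm_zero, zero_div]
      have := hu0 n
      have := hv0 n
      positivity
  have hcs := Real.summable_and_inner_le_Lp_mul_Lq_tsum_of_nonneg Real.HolderConjugate.two_two hu0
    (fun n : ℕ+ => hv0 n) (by simpa using hus) (by simpa using hvs)
  have hnorm : ‖f‖ = Real.sqrt (∑' n, u n ^ 2) := by
    rw [← Real.sqrt_sq (norm_nonneg f), f.norm_sq]
    simp_rw [hu2]
  have hsum : Summable fun n : ℕ+ => ‖LSeries.term (A.indicator f.seq) s n‖ :=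
    Summable.of_nonneg_of_le (fun _ => norm_nonneg _) hterm (hcs.1.div_const _)
  have hsupp : Function.support (fun n => ‖LSeries.term (A.indicator f.seq) s n‖) ⊆
      range ((↑) : ℕ+ → ℕ) := by
    intro n hn
    have : n ≠ 0 := by
      rintro rfl
      simp at hn
    exact ⟨⟨n, Nat.pos_of_ne_zero this⟩, rfl⟩
  have hsum' : Summable fun n : ℕ => ‖LSeries.term (A.indicator f.seq) s n‖ :=
    (PNat.coe_injective.summable_iff fun n hn => by
      by_contra h
      exact hn (hsupp h)).1 hsum
  refine ⟨hsum'.of_norm, (norm_tsum_le_tsum_norm hsum').trans ?_⟩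
  rw [← PNat.coe_injective.tsum_eq hsupp, ← mul_div_assoc, hnorm]
  refine (hsum.tsum_le_tsum hterm (hcs.1.div_const _)).trans ?_
  rw [tsum_div_const]
  gcongr
  simpa [Real.sqrt_eq_rpow] using hcs.2

theorem DirichletSpace.LSeriesSummable_seq {h : BergmanDensity} (f : BergmanSpace h) {s : ℂ}
    (hs : 1 / 2 < s.re) : LSeriesSummable f.seq s := by
  -- With this `ε` the exponent `ε - 2 Re s` equals `-1/2 - Re s < -1`.
  obtain ⟨c, hc, hw⟩ := exists_le_bergmanWeight h (ε := s.re - 1 / 2) (by linarith)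
  have hA : Summable (univ.indicator fun n : ℕ => (n : ℝ) ^ ((s.re - 1 / 2) - 2 * s.re)) := by
    rw [indicator_univ]
    exact Real.summable_nat_rpow.2 (by linarith)
  obtain ⟨C, hC⟩ := LSeries_indicator_bound hc hw hA
  simpa using (hC f s rfl).1

/-! ### Smooth parts of Dirichlet series -/

/-- The sum is a finite Euler product of geometric series with ratios `p^(-x) < 1`. Hence the smooth
part of a Bergman function converges absolutely on all of `Re s > 0`, not only on `Re s > 1/2`. -/
theorem summable_indicator_smoothNumbers (d : ℕ) {x : ℝ} (hx : 0 < x) :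
    Summable ((Nat.smoothNumbers d).indicator fun n : ℕ => (n : ℝ) ^ (-x)) := by
  set f : ℕ →* ℝ :=
    { toFun := fun n => (n : ℝ) ^ (-x)
      map_one' := by simp
      map_mul' := fun m n => by
        push_cast
        exact Real.mul_rpow (Nat.cast_nonneg _) (Nat.cast_nonneg _) } with hf
  have h := (EulerProduct.summable_and_hasSum_smoothNumbers_prod_primesBelow_geometric (f := f)
    (fun {p} hp => by
      simp only [hf, MonoidHom.coe_mk, OneHom.coe_mk]
      rw [Real.norm_of_nonneg (by positivity)]
      exact Real.rpow_lt_one_of_one_lt_of_neg (by exact_mod_cast hp.one_lt) (by linarith)) d).1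
  have h' : Summable fun m : Nat.smoothNumbers d => f m := h.of_norm
  exact (summable_subtype_iff_indicator (f := f)).1 h'

/-- A product is smooth exactly when both factors are. So taking smooth parts is multiplicative on
Dirichlet series, and the smooth part of a power is the power of the smooth part. -/
theorem indicator_smoothNumbers_convolution (d : ℕ) (f g : ℕ → ℂ) :
    (Nat.smoothNumbers d).indicator (LSeries.convolution f g) =
      LSeries.convolution ((Nat.smoothNumbers d).indicator f)
        ((Nat.smoothNumbers d).indicator g) := by
  classical
  ext n
  simp only [LSeries.convolution_def]
  by_cases hn : n ∈ Nat.smoothNumbers d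
  · rw [indicator_of_mem hn]
    refine Finset.sum_congr rfl fun p hp => ?_
    have hp' := Nat.mem_divisorsAntidiagonal.1 hp
    rw [indicator_of_mem (Nat.mem_smoothNumbers_of_dvd hn ⟨p.2, hp'.1.symm⟩),
      indicator_of_mem (Nat.mem_smoothNumbers_of_dvd hn ⟨p.1, by rw [mul_comm]; exact hp'.1.symm⟩)]
  · rw [indicator_of_notMem hn]
    refine (Finset.sum_eq_zero fun p hp => ?_).symm
    have hp' := Nat.mem_divisorsAntidiagonal.1 hp
    by_cases h1 : p.1 ∈ Nat.smoothNumbers d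
    · have h2 : p.2 ∉ Nat.smoothNumbers d := fun h2 =>
        hn (hp'.1 ▸ Nat.mul_mem_smoothNumbers h1 h2)
      rw [indicator_of_notMem h2, mul_zero]
    · rw [indicator_of_notMem h1, zero_mul]

/-- If all powers of a Dirichlet series stay bounded in a Bergman space, then its smooth parts are
bounded by `1` on the right half-plane. -/
theorem norm_LSeries_smooth_le_one {h : BergmanDensity} {g : ℕ → BergmanSpace h} {B : ℝ}
    (hB : ∀ k, ‖g k‖ ≤ B)
    (hg : ∀ k, ∀ s : ℂ, 1 / 2 < s.re → (g k).eval s = (g 0).eval s ^ (k + 1)) (d : ℕ) {s : ℂ}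
    (hs : 0 < s.re) :
    LSeriesSummable ((Nat.smoothNumbers d).indicator (g 0).seq) s ∧
      ‖LSeries ((Nat.smoothNumbers d).indicator (g 0).seq) s‖ ≤ 1 := by
  -- The choice `ε = Re s` leaves the exponent `-Re s`, negative enough for a sum over smooth
  -- numbers.
  obtain ⟨c, hc, hw⟩ := exists_le_bergmanWeight h (ε := s.re) hs
  have hA : Summable ((Nat.smoothNumbers d).indicator fun n : ℕ =>
      (n : ℝ) ^ (s.re - 2 * s.re)) := by
    have := summable_indicator_smoothNumbers d hs
    rwa [show s.re - 2 * s.re = -s.re by ring]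
  obtain ⟨C, hC⟩ := LSeries_indicator_bound hc hw hA
  refine ⟨(hC _ s rfl).1, ?_⟩
  have habs : ∀ k, LSeries.abscissaOfAbsConv (g k).seq < ⊤ := fun k =>
    lt_of_le_of_lt (((g k).LSeriesSummable_seq (s := 1) (by norm_num)).abscissaOfAbsConv_le)
      (EReal.coe_lt_top _)
  -- Uniqueness of Dirichlet coefficients turns the pointwise identities between powers on `Re s >
  -- 1/2` into convolution identities.
  have hconv : ∀ k, ∀ n ≠ 0, (g (k + 1)).seq n =
      LSeries.convolution (g k).seq (g 0).seq n := by
    intro k n hn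
    refine LSeries.eq_of_LSeries_eventually_eq (habs _) ?_ ?_ hn
    · exact lt_of_le_of_lt (LSeriesSummable.convolution
        ((g k).LSeriesSummable_seq (s := 1) (by norm_num))
        ((g 0).LSeriesSummable_seq (s := 1) (by norm_num))).abscissaOfAbsConv_le
        (EReal.coe_lt_top _)
    · filter_upwards [eventually_gt_atTop (1 / 2)] with x hx
      have hx' : 1 / 2 < (x : ℂ).re := by simpa using hx
      rw [LSeries_convolution' ((g k).LSeriesSummable_seq hx') ((g 0).LSeriesSummable_seq hx')]
      simp only [← DirichletSpace.eval_eq_LSeries]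
      rw [hg (k + 1) x hx', hg k x hx', pow_succ]
  have hpow : ∀ k, LSeries ((Nat.smoothNumbers d).indicator (g k).seq) s =
      LSeries ((Nat.smoothNumbers d).indicator (g 0).seq) s ^ (k + 1) := by
    intro k
    induction k with
    | zero => simp
    | succ k ih =>
      rw [pow_succ, ← ih, ← LSeries_convolution' (hC _ s rfl).1 (hC _ s rfl).1,
        ← indicator_smoothNumbers_convolution]
      refine LSeries_congr (fun {n} hn => ?_) s
      simp only [indicator]
      split_ifs
      · exact hconv k n hn
      · rfl
  -- A value of modulus above `1` would have unbounded powers, whereas point evaluation of the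
  -- smooth parts is bounded by `|C|` times the norm, hence by `B |C|`.
  by_contra! h1
  have h2 : ∀ k : ℕ, ‖LSeries ((Nat.smoothNumbers d).indicator (g 0).seq) s‖ ^ (k + 1) ≤
      B * |C| := by
    intro k
    rw [← norm_pow, ← hpow]
    exact ((hC (g k) s rfl).2.trans (mul_le_mul_of_nonneg_left (le_abs_self C)
      (norm_nonneg _))).trans (mul_le_mul_of_nonneg_right (hB k) (abs_nonneg C))
  obtain ⟨k, hk⟩ := pow_unbounded_of_one_lt (B * |C|) h1
  have h3 := pow_le_pow_right₀ h1.le (Nat.le_succ k)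
  exact absurd (hk.trans_le (h3.trans (h2 k))) (lt_irrefl _)

/-- Every `n ≥ 1` is `d`-smooth once `d > n`, so it leaves the complement; only `0`, which is never
smooth, stays. In the application the term at `0` vanishes. -/
theorem tendsto_tsum_smoothNumbers_compl {u : ℕ → ℝ} (hu : Summable u) (hu0 : ∀ n, 0 ≤ u n) :
    Tendsto (fun d : ℕ => ∑' n, (Nat.smoothNumbers d)ᶜ.indicator u n) atTop (𝓝 (u 0)) := by
  classical
  have h := tendsto_tsum_of_dominated_convergence (𝓕 := atTop)
    (f := fun (d : ℕ) n => (Nat.smoothNumbers d)ᶜ.indicator u n)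
    (g := fun n => if n = 0 then u 0 else 0) hu (fun n => ?_) ?_
  · simpa using h
  · by_cases hn : n = 0
    · subst hn
      simp only [if_true]
      refine tendsto_const_nhds.congr fun d => ?_
      rw [indicator_of_mem]
      intro h0
      exact Nat.ne_zero_of_mem_smoothNumbers h0 rfl
    · rw [if_neg hn]
      refine tendsto_const_nhds.congr' ?_
      filter_upwards [eventually_gt_atTop n] with d hd
      rw [indicator_of_notMem]
      simpa using Nat.mem_smoothNumbers_of_lt (Nat.pos_of_ne_zero hn) hd
  · refine Eventually.of_forall fun d n => ?_
    rw [Real.norm_of_nonneg (indicator_nonneg (fun n _ => hu0 n) n)]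
    exact indicator_le_self' (fun n _ => hu0 n) n

/-- If a function which is bounded on smaller half-planes is represented by a Dirichlet series on
`Re s > 1/2` whose smooth parts are bounded by `1`, then it is bounded by `1`. -/
theorem norm_le_one_of_smooth {F : ℂ → ℂ} {b : ℕ → ℂ} (hF : DifferentiableOn ℂ F (halfPlane 0))
    (hFb : ∀ δ, 0 < δ → ∃ C, ∀ s : ℂ, δ ≤ s.re → ‖F s‖ ≤ C)
    (hb : ∀ s : ℂ, 1 / 2 < s.re → LSeriesSummable b s ∧ LSeries b s = F s)
    (hsm : ∀ (d : ℕ) (s : ℂ), 0 < s.re → LSeriesSummable ((Nat.smoothNumbers d).indicator b) s ∧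
      ‖LSeries ((Nat.smoothNumbers d).indicator b) s‖ ≤ 1) {s : ℂ} (hs : 0 < s.re) :
    ‖F s‖ ≤ 1 := by
  -- Three lines theorem on `δ ≤ Re ≤ U`, with `s` inside: on `Re = U` the smooth parts converge
  -- uniformly to `F` with error `e d → 0`, and on `Re = δ` the difference is at most `1 + C`. So
  -- they converge to `F` at `s` and pass on the bound `1`.
  set δ := s.re / 2 with hδ
  set U := s.re + 1 with hU
  obtain ⟨C, hC⟩ := hFb δ (by positivity)
  set L : ℕ → ℂ → ℂ := fun d => LSeries ((Nat.smoothNumbers d).indicator b) with hL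
  set u : ℕ → ℝ := fun n => ‖LSeries.term b (U : ℂ) n‖ with hu
  have hus : Summable u := (hb U (by simp [hU]; linarith)).1.norm
  set e : ℕ → ℝ := fun d => ∑' n, (Nat.smoothNumbers d)ᶜ.indicator u n with he
  have he0 : Tendsto e atTop (𝓝 0) := by
    have := tendsto_tsum_smoothNumbers_compl hus fun n => norm_nonneg _
    simpa [hu] using this
  have hLd : ∀ d, DifferentiableOn ℂ (L d) (halfPlane 0) := by
    intro d
    refine (LSeries_differentiableOn _).mono fun z hz => ?_
    have hz' : 0 < z.re := hz
    have h1 := (hsm d ((z.re / 2 : ℝ) : ℂ) (by simpa using hz')).1.abscissaOfAbsConv_le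
    refine lt_of_le_of_lt h1 ?_
    simp only [Complex.ofReal_re]
    exact_mod_cast half_lt_self hz'
  have hright : ∀ d, ∀ z ∈ Complex.re ⁻¹' {U}, ‖L d z - F z‖ ≤ e d := by
    intro d z hz
    have hz' : z.re = U := hz
    have hz0 : 1 / 2 < z.re := by rw [hz', hU]; linarith
    rw [norm_sub_rev, ← (hb z hz0).2, hL]
    simp only
    rw [← LSeries_sub (hb z hz0).1 (hsm d z (by linarith)).1]
    refine tsum_of_norm_bounded (hus.indicator _).hasSum fun n => ?_
    rw [LSeries.norm_term_eq, Pi.sub_apply]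
    by_cases hn : n ∈ Nat.smoothNumbers d
    · rw [indicator_of_mem hn, indicator_of_notMem (by simpa using hn)]
      simp
    · rw [indicator_of_notMem hn, indicator_of_mem (by simpa using hn), hu]
      simp only
      rw [LSeries.norm_term_eq, hz']
      simp
  have hbound : ∀ d, ∀ z : ℂ, δ ≤ z.re → ‖L d z - F z‖ ≤ 1 + C := fun d z hz =>
    (norm_sub_le _ _).trans (add_le_add (hsm d z (lt_of_lt_of_le (by positivity) hz)).2 (hC z hz))
  have hsub : closure (Complex.HadamardThreeLines.verticalStrip δ U) ⊆ halfPlane 0 := by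
    have hcl : IsClosed {z : ℂ | δ ≤ z.re} := isClosed_le continuous_const Complex.continuous_re
    refine (closure_minimal (fun z hz => ?_) hcl).trans fun z hz => ?_
    · exact (le_of_lt hz.1 : δ ≤ z.re)
    · exact lt_of_lt_of_le (by positivity : 0 < δ) hz
  have hkey : ∀ d, ‖L d s - F s‖ ≤ (1 + C) ^ (1 - (s.re - δ) / (U - δ)) *
      e d ^ ((s.re - δ) / (U - δ)) := by
    intro d
    refine Complex.HadamardThreeLines.norm_le_interp_of_mem_verticalClosedStrip'
      (f := fun z => L d z - F z) (by simp [hδ, hU]; linarith)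
      (show s.re ∈ Icc δ U from ⟨by linarith, by linarith⟩)
      (((hLd d).sub hF).mono hsub).diffContOnCl ?_ (fun z hz => ?_) (hright d)
    · refine ⟨1 + C, ?_⟩
      rintro _ ⟨z, hz, rfl⟩
      exact hbound d z hz.1
    · exact hbound d z (le_of_eq (show z.re = δ from hz).symm)
  have ht : 0 < (s.re - δ) / (U - δ) := by
    apply div_pos <;> simp only [hδ, hU] <;> linarith
  have hlim : Tendsto (fun d => (1 + C) ^ (1 - (s.re - δ) / (U - δ)) *
      e d ^ ((s.re - δ) / (U - δ))) atTop (𝓝 0) := by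
    have h1 := (he0.rpow_const (p := (s.re - δ) / (U - δ)) (Or.inr ht.le)).const_mul
      ((1 + C) ^ (1 - (s.re - δ) / (U - δ)))
    rwa [Real.zero_rpow ht.ne', mul_zero] at h1
  have h2 : Tendsto (fun d => ‖L d s - F s‖) atTop (𝓝 0) :=
    squeeze_zero (fun _ => norm_nonneg _) hkey hlim
  refine le_of_tendsto_of_tendsto tendsto_const_nhds (h2.add_const 1) (Eventually.of_forall
    fun d => ?_) |>.trans_eq (zero_add 1)
  calc ‖F s‖ = ‖L d s - (L d s - F s)‖ := by congr 1; ring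
    _ ≤ ‖L d s‖ + ‖L d s - F s‖ := norm_sub_le _ _
    _ ≤ ‖L d s - F s‖ + 1 := by linarith [(hsm d s hs).2]

/-! ### Symbols are self-maps of the right half-plane -/

theorem symbolMap_differentiableOn {c₀ : ℕ} {φ : ℂ → ℂ} (hφ : DifferentiableOn ℂ φ (halfPlane 0)) :
    DifferentiableOn ℂ (symbolMap c₀ φ) (halfPlane 0) :=
  (differentiableOn_id.const_mul _).add hφ

theorem symbolMap_re {c₀ : ℕ} {φ : ℂ → ℂ} (s : ℂ) :
    (symbolMap c₀ φ s).re = c₀ * s.re + (φ s).re := by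
  simp [symbolMap]

theorem symbolMap_im {c₀ : ℕ} {φ : ℂ → ℂ} (s : ℂ) :
    (symbolMap c₀ φ s).im = c₀ * s.im + (φ s).im := by
  simp [symbolMap]

/-- The monomials `2^(-(k+1)s)` have norm at most `1`, and their images are the powers of `2^(-Φ)`,
bounded in norm by the operator norm. Bounded powers force `|2^(-Φ)| ≤ 1` on `Re s > 0`; the bound
on `Im φ` enters through the boundedness of `φ` on smaller half-planes. -/
theorem IsSymbol.re_nonneg {h : BergmanDensity} {c₀ : ℕ} {φ : ℂ → ℂ} {M : ℝ}
    (hΦ : IsSymbol h c₀ φ) (hφ : DifferentiableOn ℂ φ (halfPlane 0))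
    (hM : ∀ s ∈ halfPlane 0, |(φ s).im| ≤ M) {s : ℂ} (hs : 0 < s.re) :
    0 ≤ (symbolMap c₀ φ s).re := by
  obtain ⟨T, hT⟩ := hΦ.bounded
  set F : ℂ → ℂ := fun z => (2 : ℂ) ^ (-symbolMap c₀ φ z) with hF
  have hFnorm : ∀ z, ‖F z‖ = (2 : ℝ) ^ (-(symbolMap c₀ φ z).re) := fun z => by
    have := Complex.norm_natCast_cpow_of_pos (n := 2) (by norm_num) (-symbolMap c₀ φ z)
    simpa [hF] using this
  set g : ℕ → BergmanSpace h := fun k =>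
    T (polynomial _ {2 ^ (k + 1)} fun _ => 1) with hgdef
  have hgF : ∀ k, ∀ z : ℂ, 1 / 2 < z.re → (g k).eval z = F z ^ (k + 1) := by
    intro k z hz
    rw [hgdef]
    simp only
    rw [hT _ z hz, eval_polynomial, Finset.sum_singleton, one_mul, hF]
    simp only [PNat.pow_coe, PNat.val_ofNat, Nat.cast_pow, Nat.cast_ofNat]
    rw [← Complex.cpow_nat_mul]
    exact_mod_cast (Complex.natCast_cpow_natCast_mul 2 (k + 1) _).symm
  have hB : ∀ k, ‖g k‖ ≤ ‖T‖ * 1 := by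
    intro k
    refine (T.le_opNorm _).trans (mul_le_mul_of_nonneg_left ?_ (norm_nonneg _))
    refine abs_le_of_sq_le_sq' ?_ zero_le_one |>.2
    rw [norm_sq_polynomial, Finset.sum_singleton]
    simpa using bergmanWeight_le_one h _
  have hle : ‖F s‖ ≤ 1 := by
    refine norm_le_one_of_smooth (b := (g 0).seq) ?_ ?_ (fun z hz => ⟨(g 0).LSeriesSummable_seq hz, ?_⟩)
      (fun d z hz => norm_LSeries_smooth_le_one hB (fun k z hz => ?_) d hz) hs
    · exact ((symbolMap_differentiableOn hφ).neg).const_cpow (Or.inl two_ne_zero)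
    · intro δ hδ
      obtain ⟨C, hC⟩ := hΦ.inClassD.bounded_of_abs_im_le hδ hφ hM
      refine ⟨2 ^ C, fun z hz => ?_⟩
      rw [hFnorm]
      refine Real.rpow_le_rpow_of_exponent_le one_le_two ?_
      rw [symbolMap_re]
      have h1 := (Complex.abs_re_le_norm (φ z)).trans (hC z hz)
      have h2 : 0 ≤ (c₀ : ℝ) * z.re := mul_nonneg (Nat.cast_nonneg _) (hδ.le.trans hz)
      linarith [(abs_le.1 h1).1]
    · rw [← DirichletSpace.eval_eq_LSeries, hgF 0 z hz, zero_add, pow_one]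
    · rw [hgF k z hz, hgF 0 z hz, zero_add, pow_one]
  rw [hFnorm] at hle
  by_contra! hneg
  exact absurd hle (not_le.2 (Real.one_lt_rpow one_lt_two (by linarith)))

/-- A symbol maps the right half-plane to itself. -/
theorem IsSymbol.mapsTo_halfPlane_zero {h : BergmanDensity} {c₀ : ℕ} {φ : ℂ → ℂ} {M : ℝ}
    (hΦ : IsSymbol h c₀ φ) (hφ : DifferentiableOn ℂ φ (halfPlane 0))
    (hM : ∀ s ∈ halfPlane 0, |(φ s).im| ≤ M) :
    MapsTo (symbolMap c₀ φ) (halfPlane 0) (halfPlane 0) := by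
  intro s hs
  -- If `Re Φ(s) = 0`, then `|exp(-Φ)|` is maximal at `s`, so `exp(-Φ)` is constant, contradicting
  -- `Re Φ(1) > 1/2`.
  refine lt_of_le_of_ne (hΦ.re_nonneg hφ hM hs) fun h0 => ?_
  set E : ℂ → ℂ := fun z => Complex.exp (-symbolMap c₀ φ z) with hE
  have hnorm : ∀ z, ‖E z‖ = Real.exp (-(symbolMap c₀ φ z).re) := fun z => by
    rw [hE, Complex.norm_exp, Complex.neg_re]
  have hmax : IsMaxOn (norm ∘ E) (halfPlane 0) s := by
    intro z hz
    show ‖E z‖ ≤ ‖E s‖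
    rw [hnorm, hnorm, ← h0]
    exact Real.exp_le_exp.2 (neg_le_neg (hΦ.re_nonneg hφ hM hz))
  have h1 := Complex.eqOn_of_isPreconnected_of_isMaxOn_norm (convex_halfPlane 0).isPreconnected
    (isOpen_halfPlane 0) (symbolMap_differentiableOn hφ).neg.cexp hs hmax
  have h2 : E 1 = E s := h1 (show (1 : ℂ) ∈ halfPlane 0 by simp [halfPlane])
  have h3 : (1 / 2 : ℝ) < (symbolMap c₀ φ 1).re :=
    hΦ.mapsTo (show (1 : ℂ) ∈ halfPlane (1 / 2) by norm_num [halfPlane])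
  have h4 := congrArg norm h2
  rw [hnorm, hnorm, ← h0, Real.exp_eq_exp] at h4
  linarith

end DirichletComposition

namespace DirichletComposition

/-! ### Mean values on vertical lines -/

theorem norm_integral_exp_le {l : ℝ} (hl : l ≠ 0) (T : ℝ) :
    ‖∫ t in -T..T, Complex.exp (l * Complex.I * t)‖ ≤ 2 / |l| := by
  have hc : (l : ℂ) * Complex.I ≠ 0 := mul_ne_zero (Complex.ofReal_ne_zero.2 hl) Complex.I_ne_zero
  rw [integral_exp_mul_complex hc, norm_div]
  have h1 : ∀ x : ℝ, ‖Complex.exp (l * Complex.I * x)‖ = 1 := fun x => by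
    rw [show (l : ℂ) * Complex.I * x = ((l * x : ℝ) : ℂ) * Complex.I by push_cast; ring,
      Complex.norm_exp_ofReal_mul_I]
  have h2 : ‖(l : ℂ) * Complex.I‖ = |l| := by simp
  rw [h2]
  gcongr
  refine (norm_sub_le _ _).trans ?_
  rw [h1, h1]
  norm_num

theorem integral_exp_zero (T : ℝ) :
    ∫ t in -T..T, Complex.exp (((0 : ℝ) : ℂ) * Complex.I * t) = 2 * T := by
  simp
  ring

theorem norm_exp_line (l t : ℝ) : ‖Complex.exp (l * Complex.I * t)‖ = 1 := by
  rw [show (l : ℂ) * Complex.I * t = ((l * t : ℝ) : ℂ) * Complex.I by push_cast; ring,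
    Complex.norm_exp_ofReal_mul_I]

theorem natCast_cpow_line {n : ℕ} (hn : n ≠ 0) (σ t : ℝ) :
    (n : ℂ) ^ ((σ : ℂ) + t * Complex.I) =
      (((n : ℝ) ^ σ : ℝ) : ℂ) * Complex.exp ((Real.log n : ℝ) * Complex.I * t) := by
  have hn0 : (n : ℂ) ≠ 0 := Nat.cast_ne_zero.2 hn
  rw [Complex.cpow_add _ _ hn0, Complex.ofReal_cpow (Nat.cast_nonneg n), Complex.ofReal_natCast,
    Complex.cpow_def_of_ne_zero hn0 (t * Complex.I), ← Complex.natCast_log]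
  congr 2
  ring

theorem natCast_cpow_neg_line {n : ℕ} (hn : n ≠ 0) (σ t : ℝ) :
    (n : ℂ) ^ (-((σ : ℂ) + t * Complex.I)) =
      (((n : ℝ) ^ (-σ) : ℝ) : ℂ) * Complex.exp ((-Real.log n : ℝ) * Complex.I * t) := by
  rw [show -((σ : ℂ) + t * Complex.I) = ((-σ : ℝ) : ℂ) + ((-t : ℝ) : ℂ) * Complex.I by
    push_cast; ring, natCast_cpow_line hn]
  push_cast
  congr 2
  ring

theorem continuous_line (σ : ℝ) : Continuous fun t : ℝ => (σ : ℂ) + t * Complex.I := by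
  fun_prop

theorem continuous_comp_line {F : ℂ → ℂ} {θ σ : ℝ} (hF : DifferentiableOn ℂ F (halfPlane θ))
    (hσ : θ < σ) : Continuous fun t : ℝ => F ((σ : ℂ) + t * Complex.I) :=
  hF.continuousOn.comp_continuous (continuous_line σ) fun t => by
    simpa [halfPlane] using hσ

/-- The mean value of a Dirichlet series against a character, on a line of absolute convergence. -/
theorem tendsto_mean_LSeries {c : ℕ → ℂ} {X : ℝ} (hc : LSeriesSummable c X) {n : ℕ} (hn : n ≠ 0) :
    Tendsto (fun T : ℝ => (2 * T : ℂ)⁻¹ * ∫ t in -T..T,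
      LSeries c ((X : ℂ) + t * Complex.I) * (n : ℂ) ^ ((X : ℂ) + t * Complex.I)) atTop
      (𝓝 (c n)) := by
  -- On the line, the `m`-th term times `n^s` is `k m` times a character of frequency `log n - log
  -- m`. Averaging keeps only `m = n`, and `∑ |k m| < ∞` allows the limit to be taken termwise.
  set k : ℕ → ℂ := fun m => LSeries.term c X m * (((n : ℝ) ^ X : ℝ) : ℂ) with hk
  have hks : Summable fun m => ‖k m‖ := (hc.mul_right _).norm
  have hterm : ∀ (m : ℕ) (t : ℝ), LSeries.term c ((X : ℂ) + t * Complex.I) m *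
      (n : ℂ) ^ ((X : ℂ) + t * Complex.I) =
      k m * Complex.exp ((Real.log n - Real.log m : ℝ) * Complex.I * t) := by
    intro m t
    by_cases hm : m = 0
    · simp [hm, hk]
    · rw [LSeries.term_of_ne_zero hm, hk]
      simp only
      rw [LSeries.term_of_ne_zero hm, natCast_cpow_line hm, natCast_cpow_line hn,
        Complex.ofReal_cpow (Nat.cast_nonneg m), Complex.ofReal_natCast, Complex.ofReal_sub,
        sub_mul, sub_mul, Complex.exp_sub]
      have h1 : (m : ℂ) ^ (X : ℂ) ≠ 0 := by simp [hm]
      field_simp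
  have hsum : ∀ t : ℝ, HasSum (fun m => k m *
      Complex.exp ((Real.log n - Real.log m : ℝ) * Complex.I * t))
      (LSeries c ((X : ℂ) + t * Complex.I) * (n : ℂ) ^ ((X : ℂ) + t * Complex.I)) := by
    intro t
    simp_rw [← hterm]
    refine HasSum.mul_right _ (Summable.hasSum (f := LSeries.term c _) ?_)
    exact (LSeriesSummable_iff_of_re_eq_re (by simp)).1 hc
  have hint : ∀ T : ℝ, HasSum (fun m => ∫ t in -T..T, k m *
      Complex.exp ((Real.log n - Real.log m : ℝ) * Complex.I * t))
      (∫ t in -T..T, LSeries c ((X : ℂ) + t * Complex.I) *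
        (n : ℂ) ^ ((X : ℂ) + t * Complex.I)) := by
    intro T
    refine intervalIntegral.hasSum_integral_of_dominated_convergence (fun m _ => ‖k m‖)
      (fun m => ?_) (fun m => ?_) ?_ ?_ ?_
    · exact Continuous.aestronglyMeasurable (by fun_prop)
    · refine Eventually.of_forall fun t _ => ?_
      rw [norm_mul, norm_exp_line, mul_one]
    · exact Eventually.of_forall fun t _ => hks
    · exact intervalIntegrable_const
    · exact Eventually.of_forall fun t _ => hsum t
  have hlim : Tendsto (fun T : ℝ => ∑' m, (2 * T : ℂ)⁻¹ * ∫ t in -T..T, k m *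
      Complex.exp ((Real.log n - Real.log m : ℝ) * Complex.I * t)) atTop
      (𝓝 (∑' m, if m = n then c n else 0)) := by
    refine tendsto_tsum_of_dominated_convergence hks (fun m => ?_) ?_
    · by_cases hm : m = 0
      · subst hm
        simp [hk, hn.symm]
      by_cases hmn : m = n
      · subst hmn
        rw [if_pos rfl]
        have hkm : k m = c m := by
          rw [hk]
          simp only
          rw [LSeries.term_of_ne_zero hm, Complex.ofReal_cpow (Nat.cast_nonneg m),
            Complex.ofReal_natCast]
          have h1 : (m : ℂ) ^ (X : ℂ) ≠ 0 := by simp [hm]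
          field_simp
        refine tendsto_const_nhds.congr' ?_
        filter_upwards [eventually_gt_atTop 0] with T hT
        rw [intervalIntegral.integral_const_mul, sub_self, integral_exp_zero, hkm]
        have : (T : ℂ) ≠ 0 := Complex.ofReal_ne_zero.2 hT.ne'
        field_simp
      · rw [if_neg hmn, tendsto_zero_iff_norm_tendsto_zero]
        have hl : Real.log n - Real.log m ≠ 0 := by
          rw [sub_ne_zero]
          intro h
          refine hmn (Nat.cast_injective (R := ℝ) ?_).symm
          exact Real.log_injOn_pos (by simpa using Nat.pos_of_ne_zero hn)
            (by simpa using Nat.pos_of_ne_zero hm) h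
        have h1 : Tendsto (fun T : ℝ => (2 * T)⁻¹ * (‖k m‖ *
            (2 / |Real.log n - Real.log m|))) atTop (𝓝 0) := by
          have := (tendsto_inv_atTop_zero.comp
            (tendsto_id.const_mul_atTop (two_pos (α := ℝ)))).mul_const
            (‖k m‖ * (2 / |Real.log n - Real.log m|))
          simpa using this
        refine squeeze_zero' (Eventually.of_forall fun _ => norm_nonneg _) ?_ h1
        filter_upwards [eventually_gt_atTop 0] with T hT
        rw [intervalIntegral.integral_const_mul, norm_mul, norm_mul, norm_inv, norm_mul,
          Complex.norm_ofNat, Complex.norm_real, Real.norm_of_nonneg hT.le]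
        gcongr
        exact norm_integral_exp_le hl T
    · filter_upwards [eventually_gt_atTop 0] with T hT m
      rw [norm_mul, norm_inv, norm_mul, Complex.norm_ofNat, Complex.norm_real,
        Real.norm_of_nonneg hT.le]
      have h1 : ‖∫ t in -T..T, k m *
          Complex.exp ((Real.log n - Real.log m : ℝ) * Complex.I * t)‖ ≤ ‖k m‖ * |T - -T| :=
        intervalIntegral.norm_integral_le_of_norm_le_const fun t _ => by
          rw [norm_mul, norm_exp_line, mul_one]
      rw [sub_neg_eq_add, ← two_mul, abs_of_pos (by positivity)] at h1
      rw [inv_mul_le_iff₀ (by positivity), mul_comm (2 * T)]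
      exact h1
  rw [tsum_ite_eq] at hlim
  refine hlim.congr fun T => ?_
  rw [tsum_mul_left, (hint T).tsum_eq]

/-- The mean value of a bounded analytic function does not depend on the vertical line. -/
theorem tendsto_mean_sub_mean {F : ℂ → ℂ} {σ X B : ℝ} (hσ : 0 < σ) (hX : σ ≤ X)
    (hF : DifferentiableOn ℂ F (halfPlane 0))
    (hB : ∀ s : ℂ, σ ≤ s.re → s.re ≤ X → ‖F s‖ ≤ B) :
    Tendsto (fun T : ℝ => (2 * T : ℂ)⁻¹ * (∫ t in -T..T, F ((X : ℂ) + t * Complex.I)) -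
      (2 * T : ℂ)⁻¹ * ∫ t in -T..T, F ((σ : ℂ) + t * Complex.I)) atTop (𝓝 0) := by
  rw [tendsto_zero_iff_norm_tendsto_zero]
  have h1 : Tendsto (fun T : ℝ => (2 * T)⁻¹ * (2 * (B * |X - σ|))) atTop (𝓝 0) := by
    have := (tendsto_inv_atTop_zero.comp
      (tendsto_id.const_mul_atTop (two_pos (α := ℝ)))).mul_const (2 * (B * |X - σ|))
    simpa using this
  refine squeeze_zero' (Eventually.of_forall fun _ => norm_nonneg _) ?_ h1
  filter_upwards [eventually_gt_atTop 0] with T hT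
  -- Cauchy's theorem on the rectangle: the two horizontal sides are bounded independently of `T`,
  -- so division by `2T` removes them.
  have hrect := Complex.integral_boundary_rect_eq_zero_of_differentiableOn F
    ((σ : ℂ) + (-T : ℝ) * Complex.I) ((X : ℂ) + (T : ℝ) * Complex.I) (hF.mono fun z hz => by
      have h2 := hz.1
      simp only [Complex.add_re, Complex.ofReal_re, Complex.mul_re, Complex.I_re, mul_zero,
        Complex.ofReal_im, Complex.I_im, mul_one, sub_self, add_zero, mem_preimage,
        uIcc_of_le hX] at h2
      exact lt_of_lt_of_le hσ h2.1)
  simp only [Complex.add_re, Complex.ofReal_re, Complex.mul_re, Complex.I_re, mul_zero,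
    Complex.ofReal_im, Complex.I_im, mul_one, sub_self, add_zero, Complex.add_im, Complex.mul_im,
    zero_add, smul_eq_mul] at hrect
  have hside : ∀ y : ℝ, ‖∫ x in σ..X, F ((x : ℂ) + y * Complex.I)‖ ≤ B * |X - σ| := fun y =>
    intervalIntegral.norm_integral_le_of_norm_le_const fun x hx => by
      rw [uIoc_of_le hX] at hx
      exact hB _ (by simpa using hx.1.le) (by simpa using hx.2)
  have heq : (∫ t in -T..T, F ((X : ℂ) + t * Complex.I)) -
      (∫ t in -T..T, F ((σ : ℂ) + t * Complex.I)) =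
      Complex.I * ((∫ x in σ..X, F ((x : ℂ) + (-T : ℝ) * Complex.I)) -
        ∫ x in σ..X, F ((x : ℂ) + (T : ℝ) * Complex.I)) := by
    linear_combination (-Complex.I) * hrect +
      ((∫ t in -T..T, F ((X : ℂ) + t * Complex.I)) -
      (∫ t in -T..T, F ((σ : ℂ) + t * Complex.I))) * Complex.I_mul_I
  rw [← mul_sub, heq, norm_mul, norm_mul, norm_inv, norm_mul, Complex.norm_ofNat, Complex.norm_real,
    Real.norm_of_nonneg hT.le, Complex.norm_I, one_mul]
  gcongr
  refine (norm_sub_le _ _).trans ?_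
  linarith [hside (-T), hside T]

/-- Carlson's formula for the coefficients of a Dirichlet series, on a line to which the function
extends boundedly. -/
theorem tendsto_mean_coeff {H : ℂ → ℂ} {c : ℕ → ℂ} {X : ℝ}
    (hH : DifferentiableOn ℂ H (halfPlane 0))
    (hHb : ∀ δ, 0 < δ → ∃ C, ∀ s : ℂ, δ ≤ s.re → ‖H s‖ ≤ C)
    (hc : ∀ s : ℂ, X < s.re → LSeriesSummable c s ∧ H s = LSeries c s)
    {σ : ℝ} (hσ : 0 < σ) {n : ℕ} (hn : n ≠ 0) :
    Tendsto (fun T : ℝ => (2 * T : ℂ)⁻¹ * ∫ t in -T..T,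
      H ((σ : ℂ) + t * Complex.I) * (n : ℂ) ^ ((σ : ℂ) + t * Complex.I)) atTop (𝓝 (c n)) := by
  set Y := max X σ + 1 with hY
  have hXY : X < Y := by rw [hY]; linarith [le_max_left X σ]
  have hσY : σ ≤ Y := by rw [hY]; linarith [le_max_right X σ]
  obtain ⟨C, hC⟩ := hHb σ hσ
  have hn0 : (n : ℂ) ≠ 0 := Nat.cast_ne_zero.2 hn
  have h1 := tendsto_mean_LSeries (hc Y (by simpa using hXY)).1 hn
  have h2 := tendsto_mean_sub_mean (F := fun s => H s * (n : ℂ) ^ s) (B := C * (n : ℝ) ^ Y) hσ hσY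
    (hH.mul (differentiableOn_id.const_cpow (Or.inl hn0))) fun s hs hs' => by
      rw [norm_mul, Complex.norm_natCast_cpow_of_pos (Nat.pos_of_ne_zero hn)]
      have : (1 : ℝ) ≤ n := by exact_mod_cast Nat.pos_of_ne_zero hn
      have hC0 : 0 ≤ C := (norm_nonneg _).trans (hC s hs)
      gcongr
      exact hC s hs
  have h3 := h1.sub h2
  rw [sub_zero] at h3
  refine h3.congr fun T => ?_
  have h4 : (∫ t in -T..T, LSeries c ((Y : ℂ) + t * Complex.I) * (n : ℂ) ^
      ((Y : ℂ) + t * Complex.I)) = ∫ t in -T..T, H ((Y : ℂ) + t * Complex.I) * (n : ℂ) ^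
      ((Y : ℂ) + t * Complex.I) :=
    intervalIntegral.integral_congr fun t _ => by
      rw [(hc _ (by simpa using hXY)).2]
  rw [h4]
  ring

/-- The value `∑_{n ∈ S} d n n^{-s}` of a Dirichlet polynomial. -/
noncomputable def dirichletSum (S : Finset ℕ+) (d : ℕ+ → ℂ) (s : ℂ) : ℂ :=
  ∑ n ∈ S, d n * ((n : ℕ) : ℂ) ^ (-s)

theorem differentiable_dirichletSum (S : Finset ℕ+) (d : ℕ+ → ℂ) :
    Differentiable ℂ (dirichletSum S d) := by
  refine Differentiable.fun_sum fun n _ => ?_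
  exact (differentiable_id.neg.const_cpow (Or.inl (Nat.cast_ne_zero.2 n.ne_zero))).const_mul _

theorem norm_dirichletSum_le (S : Finset ℕ+) (d : ℕ+ → ℂ) {s : ℂ} (hs : 0 ≤ s.re) :
    ‖dirichletSum S d s‖ ≤ ∑ n ∈ S, ‖d n‖ := by
  refine norm_sum_le_of_le _ fun n _ => ?_
  rw [norm_mul, Complex.norm_natCast_cpow_of_pos n.pos]
  refine mul_le_of_le_one_right (norm_nonneg _) ?_
  exact Real.rpow_le_one_of_one_le_of_nonpos (by exact_mod_cast one_le) (by simpa using hs)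

theorem hasDerivAt_dirichletSum (S : Finset ℕ+) (d : ℕ+ → ℂ) (s : ℂ) :
    HasDerivAt (dirichletSum S d)
      (dirichletSum S (fun n => -(Real.log n : ℝ) * d n) s) s := by
  have h : ∀ n ∈ S, HasDerivAt (fun z : ℂ => d n * ((n : ℕ) : ℂ) ^ (-z))
      (-(Real.log n : ℝ) * d n * ((n : ℕ) : ℂ) ^ (-s)) s := by
    intro n _
    have h1 := (((hasDerivAt_id s).neg).const_cpow (c := ((n : ℕ) : ℂ))
      (Or.inl (Nat.cast_ne_zero.2 n.ne_zero))).const_mul (d n)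
    convert! h1 using 1
    rw [Complex.ofReal_log (Nat.cast_nonneg _), Complex.ofReal_natCast]
    simp
    ring
  exact HasDerivAt.fun_sum h

theorem dirichletSum_eq_LSeries (S : Finset ℕ+) (c : ℕ → ℂ) (s : ℂ) :
    LSeriesSummable (((↑) '' (S : Set ℕ+) : Set ℕ).indicator c) s ∧
      dirichletSum S (fun n => c n) s = LSeries (((↑) '' (S : Set ℕ+) : Set ℕ).indicator c) s := by
  classical
  have h0 : ∀ n ∉ S.map ⟨_, PNat.coe_injective⟩,
      LSeries.term (((↑) '' (S : Set ℕ+) : Set ℕ).indicator c) s n = 0 := by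
    intro n hn
    rw [LSeries.term_def, indicator_of_notMem (by simpa using hn)]
    simp
  refine ⟨summable_of_ne_finset_zero h0, ?_⟩
  rw [LSeries, tsum_eq_sum h0, Finset.sum_map]
  refine Finset.sum_congr rfl fun n hn => ?_
  simp only [Function.Embedding.coeFn_mk]
  rw [LSeries.term_of_ne_zero n.ne_zero, indicator_of_mem (mem_image_of_mem _ (Finset.mem_coe.2 hn)), Complex.cpow_neg,
    div_eq_mul_inv]

/-- On a vertical line, conjugating `n^(-s)` gives a multiple of `n^s`. A mean against a conjugated
polynomial is thereby a combination of the coefficient means already computed. -/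
theorem conj_natCast_cpow_neg_line {n : ℕ} (hn : n ≠ 0) (σ t : ℝ) :
    (starRingEnd ℂ) ((n : ℂ) ^ (-((σ : ℂ) + t * Complex.I))) =
      (((n : ℝ) ^ (-2 * σ) : ℝ) : ℂ) * (n : ℂ) ^ ((σ : ℂ) + t * Complex.I) := by
  have hn0 : (0 : ℝ) < n := by exact_mod_cast Nat.pos_of_ne_zero hn
  rw [natCast_cpow_neg_line hn, natCast_cpow_line hn, map_mul, Complex.conj_ofReal,
    ← Complex.exp_conj, ← mul_assoc, ← Complex.ofReal_mul, ← Real.rpow_add hn0]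
  simp only [map_mul, Complex.conj_ofReal, Complex.conj_I]
  congr 2
  · congr 2
    ring
  · push_cast
    ring

/-- Mean values of `H` times the conjugate of a partial sum of its Dirichlet series. -/
theorem tendsto_mean_mul_conj {H : ℂ → ℂ} {c : ℕ → ℂ} {X : ℝ}
    (hH : DifferentiableOn ℂ H (halfPlane 0))
    (hHb : ∀ δ, 0 < δ → ∃ C, ∀ s : ℂ, δ ≤ s.re → ‖H s‖ ≤ C)
    (hc : ∀ s : ℂ, X < s.re → LSeriesSummable c s ∧ H s = LSeries c s)
    {σ : ℝ} (hσ : 0 < σ) (S : Finset ℕ+) (d : ℕ+ → ℂ) :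
    Tendsto (fun T : ℝ => (2 * T : ℂ)⁻¹ * ∫ t in -T..T, H ((σ : ℂ) + t * Complex.I) *
      (starRingEnd ℂ) (dirichletSum S d ((σ : ℂ) + t * Complex.I))) atTop
      (𝓝 (∑ n ∈ S, (starRingEnd ℂ) (d n) * (((n : ℝ) ^ (-2 * σ) : ℝ) : ℂ) * c n)) := by
  have h := tendsto_finsetSum S fun n (_ : n ∈ S) => (tendsto_mean_coeff hH hHb hc hσ
    n.ne_zero).const_mul ((starRingEnd ℂ) (d n) * (((n : ℝ) ^ (-2 * σ) : ℝ) : ℂ))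
  refine h.congr fun T => ?_
  have h1 : ∀ t : ℝ, H ((σ : ℂ) + t * Complex.I) *
      (starRingEnd ℂ) (dirichletSum S d ((σ : ℂ) + t * Complex.I)) =
      ∑ n ∈ S, ((starRingEnd ℂ) (d n) * (((n : ℝ) ^ (-2 * σ) : ℝ) : ℂ)) *
        (H ((σ : ℂ) + t * Complex.I) * ((n : ℕ) : ℂ) ^ ((σ : ℂ) + t * Complex.I)) := by
    intro t
    rw [dirichletSum, map_sum, Finset.mul_sum]
    refine Finset.sum_congr rfl fun n _ => ?_
    rw [map_mul, conj_natCast_cpow_neg_line n.ne_zero]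
    ring
  have hcont := continuous_comp_line hH hσ
  simp_rw [h1]
  rw [intervalIntegral.integral_finsetSum, Finset.mul_sum]
  · refine Finset.sum_congr rfl fun n _ => ?_
    rw [intervalIntegral.integral_const_mul]
    ring
  · intro n _
    refine Continuous.intervalIntegrable (continuous_const.mul (hcont.mul ?_)) _ _
    exact (continuous_line σ).const_cpow (Or.inl (Nat.cast_ne_zero.2 n.ne_zero))

/-- Bessel's inequality for mean values. -/
theorem exists_tendsto_le_mean_sq {H : ℂ → ℂ} {c : ℕ → ℂ} {X : ℝ}
    (hH : DifferentiableOn ℂ H (halfPlane 0))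
    (hHb : ∀ δ, 0 < δ → ∃ C, ∀ s : ℂ, δ ≤ s.re → ‖H s‖ ≤ C)
    (hc : ∀ s : ℂ, X < s.re → LSeriesSummable c s ∧ H s = LSeries c s)
    {σ : ℝ} (hσ : 0 < σ) (S : Finset ℕ+) :
    ∃ R : ℝ → ℝ, Tendsto R atTop (𝓝 (∑ n ∈ S, ‖c n‖ ^ 2 * (n : ℝ) ^ (-2 * σ))) ∧
      ∀ T, 0 < T → R T ≤ (2 * T)⁻¹ * ∫ t in -T..T, ‖H ((σ : ℂ) + t * Complex.I)‖ ^ 2 := by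
  classical
  set P : ℂ → ℂ := dirichletSum S fun n => c n with hP
  -- With `P` the partial sum of `H` over `S`, the witness `R` is the mean of `2 Re(H P̄) - |P|²`,
  -- which is at most `|H|²` pointwise. The means of `H P̄` and `|P|²` have the same limit;
  -- convergence of the mean of `|H|²` is not needed.
  have h1 := tendsto_mean_mul_conj hH hHb hc hσ S fun n => c n
  have h2 := tendsto_mean_mul_conj (H := P) (X := 0)
    (differentiable_dirichletSum S _).differentiableOn
    (fun δ hδ => ⟨_, fun s hs => norm_dirichletSum_le S _ (hδ.le.trans hs)⟩)
    (fun s _ => dirichletSum_eq_LSeries S c s) hσ S fun n => c n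
  have hlim1 : ∑ n ∈ S, (starRingEnd ℂ) (c n) * (((n : ℝ) ^ (-2 * σ) : ℝ) : ℂ) * c n =
      ((∑ n ∈ S, ‖c n‖ ^ 2 * (n : ℝ) ^ (-2 * σ) : ℝ) : ℂ) := by
    push_cast
    refine Finset.sum_congr rfl fun n _ => ?_
    rw [mul_right_comm, mul_comm _ (c n), Complex.mul_conj']
  have hlim2 : ∑ n ∈ S, (starRingEnd ℂ) (c n) * (((n : ℝ) ^ (-2 * σ) : ℝ) : ℂ) *
      (((↑) '' (S : Set ℕ+) : Set ℕ).indicator c n) =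
      ((∑ n ∈ S, ‖c n‖ ^ 2 * (n : ℝ) ^ (-2 * σ) : ℝ) : ℂ) := by
    rw [← hlim1]
    exact Finset.sum_congr rfl fun n hn => by rw [indicator_of_mem (mem_image_of_mem _ (Finset.mem_coe.2 hn))]
  rw [hlim1] at h1
  rw [hlim2] at h2
  have h3 := (Complex.continuous_re.tendsto _).comp ((h1.const_mul 2).sub h2)
  have hHc := continuous_comp_line hH hσ
  have hPc := continuous_comp_line (θ := 0) (differentiable_dirichletSum S
    fun n => c n).differentiableOn hσ
  have hval : ∀ x : ℝ, (2 * (x : ℂ) - x).re = x := fun x => by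
    rw [two_mul, add_sub_cancel_right, Complex.ofReal_re]
  rw [hval] at h3
  refine ⟨_, h3, ?_⟩
  · intro T hT
    simp only [Function.comp]
    set A : ℝ → ℂ := fun t => H ((σ : ℂ) + t * Complex.I) with hA
    set B : ℝ → ℂ := fun t => dirichletSum S (fun n => c n) ((σ : ℂ) + t * Complex.I) with hB
    have hre : ∀ f : ℝ → ℂ, Continuous f → ((2 * T : ℂ)⁻¹ * ∫ t in -T..T, f t).re =
        (2 * T)⁻¹ * ∫ t in -T..T, (f t).re := by
      intro f hf
      have h4 : (∫ t in -T..T, f t).re = ∫ t in -T..T, (f t).re :=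
        (Complex.reCLM.intervalIntegral_comp_comm (hf.intervalIntegrable _ _)).symm
      rw [show (2 * T : ℂ)⁻¹ = (((2 * T)⁻¹ : ℝ) : ℂ) by push_cast; ring, Complex.re_ofReal_mul, h4]
    have hAB : Continuous fun t => A t * (starRingEnd ℂ) (B t) :=
      hHc.mul (Complex.continuous_conj.comp hPc)
    have hBB : Continuous fun t => B t * (starRingEnd ℂ) (B t) :=
      hPc.mul (Complex.continuous_conj.comp hPc)
    have hAc : Continuous fun t => ‖A t‖ ^ 2 := hHc.norm.pow 2
    have h2re : ∀ z : ℂ, (2 * z).re = 2 * z.re := fun z => by simp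
    rw [Complex.sub_re, h2re]
    have e1 := hre _ hAB
    have e2 := hre _ hBB
    simp only [hA, hB] at e1 e2 ⊢
    rw [e1, e2, mul_left_comm, ← mul_sub, ← intervalIntegral.integral_const_mul,
      ← intervalIntegral.integral_sub]
    · refine mul_le_mul_of_nonneg_left ?_ (by positivity)
      refine intervalIntegral.integral_mono_on (by linarith) ?_ (hAc.intervalIntegrable _ _)
        fun t _ => ?_
      · exact (((Complex.continuous_re.comp hAB).const_mul 2).sub
          (Complex.continuous_re.comp hBB)).intervalIntegrable _ _
      · have key : ∀ a b : ℂ, 2 * (a * (starRingEnd ℂ) b).re - (b * (starRingEnd ℂ) b).re ≤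
            ‖a‖ ^ 2 := by
          intro a b
          rw [← Complex.normSq_eq_norm_sq, Complex.normSq_apply]
          simp
          nlinarith [sq_nonneg (a.re - b.re), sq_nonneg (a.im - b.im)]
        exact key _ _
    · exact ((Complex.continuous_re.comp hAB).const_mul 2).intervalIntegrable _ _
    · exact (Complex.continuous_re.comp hBB).intervalIntegrable _ _

theorem re_integral_exp_le (l T : ℝ) (z : ℂ) :
    (z * ∫ t in -T..T, Complex.exp (l * Complex.I * t)).re ≤
      if l = 0 then 2 * T * z.re else ‖z‖ * (2 / |l|) := by
  split_ifs with h
  · rw [h, integral_exp_zero]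
    simp
    linarith
  · refine (Complex.re_le_norm _).trans ?_
    rw [norm_mul]
    gcongr
    exact norm_integral_exp_le h T

/-- Upper bound for mean squares of Dirichlet polynomials without constant term. -/
theorem exists_integral_norm_sq_dirichletSum_le (S : Finset ℕ+) (d : ℕ+ → ℂ)
    (hS : ∀ n ∈ S, 2 ≤ (n : ℕ)) :
    ∃ C : ℝ, 0 ≤ C ∧ ∀ σ R : ℝ, 0 ≤ σ → 0 ≤ R →
      ∫ t in -R..R, ‖dirichletSum S d ((σ : ℂ) + t * Complex.I)‖ ^ 2 ≤
        2 * R * ∑ n ∈ S, ‖d n‖ ^ 2 * (n : ℝ) ^ (-2 * σ) + C * (4 : ℝ) ^ (-σ) := by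
  classical
  -- The constant collects the off-diagonal oscillating integrals, bounded uniformly in `R`. Their
  -- coefficients carry `(nm)^(-σ) ≤ 4^(-σ)` since `n, m ≥ 2`, a decay used later to integrate the
  -- error in `σ`.
  refine ⟨∑ n ∈ S, ∑ m ∈ S, ‖d n‖ * ‖d m‖ * (2 / |Real.log m - Real.log n|), by positivity,
    fun σ R hσ hR => ?_⟩
  set k : ℕ+ → ℕ+ → ℂ := fun n m =>
    d n * (starRingEnd ℂ) (d m) * (((n : ℝ) ^ (-σ) * (m : ℝ) ^ (-σ) : ℝ) : ℂ) with hk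
  have h1 : ∀ t : ℝ, ‖dirichletSum S d ((σ : ℂ) + t * Complex.I)‖ ^ 2 =
      (∑ n ∈ S, ∑ m ∈ S, k n m *
        Complex.exp ((Real.log m - Real.log n : ℝ) * Complex.I * t)).re := by
    intro t
    have h2 : ((‖dirichletSum S d ((σ : ℂ) + t * Complex.I)‖ ^ 2 : ℝ) : ℂ) =
        ∑ n ∈ S, ∑ m ∈ S, k n m *
          Complex.exp ((Real.log m - Real.log n : ℝ) * Complex.I * t) := by
      rw [Complex.ofReal_pow, ← Complex.mul_conj', dirichletSum, map_sum, Finset.sum_mul_sum]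
      refine Finset.sum_congr rfl fun n _ => Finset.sum_congr rfl fun m _ => ?_
      rw [map_mul, natCast_cpow_neg_line n.ne_zero, natCast_cpow_neg_line m.ne_zero, map_mul,
        Complex.conj_ofReal, ← Complex.exp_conj, hk]
      simp only [map_mul, Complex.conj_ofReal, Complex.conj_I]
      rw [show ((Real.log m - Real.log n : ℝ) : ℂ) * Complex.I * t =
        ((-Real.log n : ℝ) : ℂ) * Complex.I * t + ((-Real.log m : ℝ) : ℂ) * -Complex.I * t by
          push_cast; ring, Complex.exp_add]
      push_cast
      ring
    rw [← h2, Complex.ofReal_re]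
  simp_rw [h1]
  have hcont : ∀ n m, Continuous fun t : ℝ =>
      k n m * Complex.exp ((Real.log m - Real.log n : ℝ) * Complex.I * t) := by
    intro n m
    fun_prop
  have h3 : ∫ t in -R..R, (∑ n ∈ S, ∑ m ∈ S, k n m *
        Complex.exp ((Real.log m - Real.log n : ℝ) * Complex.I * t)).re =
      ∑ n ∈ S, ∑ m ∈ S, (k n m * ∫ t in -R..R,
        Complex.exp ((Real.log m - Real.log n : ℝ) * Complex.I * t)).re := by
    have h4 : ∫ t in -R..R, (∑ n ∈ S, ∑ m ∈ S, k n m *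
        Complex.exp ((Real.log m - Real.log n : ℝ) * Complex.I * t)).re =
        (∫ t in -R..R, ∑ n ∈ S, ∑ m ∈ S, k n m *
        Complex.exp ((Real.log m - Real.log n : ℝ) * Complex.I * t)).re :=
      Complex.reCLM.intervalIntegral_comp_comm
        ((continuous_finsetSum _ fun n _ => continuous_finsetSum _ fun m _ =>
          hcont n m).intervalIntegrable _ _)
    rw [h4, intervalIntegral.integral_finsetSum fun n _ =>
      (continuous_finsetSum _ fun m _ => hcont n m).intervalIntegrable _ _, Complex.re_sum]
    refine Finset.sum_congr rfl fun n _ => ?_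
    rw [intervalIntegral.integral_finsetSum fun m _ => (hcont n m).intervalIntegrable _ _,
      Complex.re_sum]
    exact Finset.sum_congr rfl fun m _ => by rw [intervalIntegral.integral_const_mul]
  rw [h3, Finset.mul_sum, Finset.sum_mul, ← Finset.sum_add_distrib]
  refine Finset.sum_le_sum fun n hn => ?_
  rw [Finset.sum_mul]
  have h5 : 2 * R * (‖d n‖ ^ 2 * (n : ℝ) ^ (-2 * σ)) =
      ∑ m ∈ S, if n = m then 2 * R * (‖d n‖ ^ 2 * (n : ℝ) ^ (-2 * σ)) else 0 := by
    rw [Finset.sum_ite_eq, if_pos hn]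
  rw [h5, ← Finset.sum_add_distrib]
  refine Finset.sum_le_sum fun m hm => (re_integral_exp_le _ R _).trans ?_
  have hnpos : (0 : ℝ) < ((n : ℕ) : ℝ) := by exact_mod_cast n.pos
  have hmpos : (0 : ℝ) < ((m : ℕ) : ℝ) := by exact_mod_cast m.pos
  by_cases hnm : n = m
  · subst hnm
    rw [if_pos (sub_self _), if_pos rfl, hk]
    simp only
    rw [Complex.mul_conj', ← Complex.ofReal_pow, ← Complex.ofReal_mul, Complex.ofReal_re,
      ← Real.rpow_add hnpos]
    have : -σ + -σ = -2 * σ := by ring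
    rw [this]
    simp
  · have hl : Real.log m - Real.log n ≠ 0 := by
      rw [sub_ne_zero]
      intro h
      refine hnm (PNat.coe_injective (Nat.cast_injective (R := ℝ) ?_)).symm
      exact Real.log_injOn_pos hmpos hnpos h
    rw [if_neg hl, if_neg hnm, zero_add, mul_right_comm]
    refine mul_le_mul_of_nonneg_right ?_ (by positivity)
    rw [hk]
    simp only
    rw [norm_mul, norm_mul, RCLike.norm_conj, Complex.norm_real, Real.norm_of_nonneg (by positivity)]
    refine mul_le_mul_of_nonneg_left ?_ (by positivity)
    rw [show (4 : ℝ) = 2 * 2 by norm_num, Real.mul_rpow (by norm_num) (by norm_num)]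
    have h2n : (2 : ℝ) ≤ n := by exact_mod_cast hS n hn
    have h2m : (2 : ℝ) ≤ m := by exact_mod_cast hS m hm
    exact mul_le_mul (Real.rpow_le_rpow_of_nonpos two_pos h2n (by linarith))
      (Real.rpow_le_rpow_of_nonpos two_pos h2m (by linarith)) (by positivity) (by positivity)

end DirichletComposition

namespace DirichletComposition

/-! ### Change of variables for analytic functions -/

/-- Superadditivity of the lower integral holds for arbitrary functions. No measurability is then
needed for the sums over preimages in the area formula. -/
theorem sum_lintegral_le {α ι : Type*} [MeasurableSpace α] (μ : Measure α) (s : Finset ι)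
    (f : ι → α → ℝ≥0∞) : ∑ i ∈ s, ∫⁻ x, f i x ∂μ ≤ ∫⁻ x, ∑ i ∈ s, f i x ∂μ := by
  classical
  induction s using Finset.induction_on with
  | empty => simp
  | insert a s ha ih =>
    simp_rw [Finset.sum_insert ha]
    exact (add_le_add_right ih _).trans (le_lintegral_add _ _)

theorem tsum_lintegral_le {α ι : Type*} [MeasurableSpace α] (μ : Measure α)
    (f : ι → α → ℝ≥0∞) : ∑' i, ∫⁻ x, f i x ∂μ ≤ ∫⁻ x, ∑' i, f i x ∂μ := by
  rw [ENNReal.tsum_eq_iSup_sum]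
  exact iSup_le fun s => (sum_lintegral_le μ s f).trans
    (lintegral_mono fun x => ENNReal.sum_le_tsum s)

theorem abs_det_restrictScalars_deriv (z : ℂ) :
    |((ContinuousLinearMap.toSpanSingleton ℂ z).restrictScalars ℝ : ℂ →L[ℝ] ℂ).det| =
      ‖z‖ ^ 2 := by
  have h : ((ContinuousLinearMap.toSpanSingleton ℂ z).restrictScalars ℝ : ℂ →L[ℝ] ℂ).det =
      Complex.normSq z := by
    simp [ContinuousLinearMap.det, LinearMap.det_restrictScalars, Algebra.norm_complex_eq]
  rw [h, Complex.normSq_eq_norm_sq, abs_of_nonneg (sq_nonneg _)]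

theorem exists_injOn_nhds {f : ℂ → ℂ} {s : ℂ} (hf : AnalyticAt ℂ f s) (h0 : deriv f s ≠ 0) :
    ∃ V, IsOpen V ∧ s ∈ V ∧ InjOn f V := by
  have h := hf.hasStrictDerivAt.hasStrictFDerivAt_equiv h0
  set e := h.toOpenPartialHomeomorph f
  exact ⟨e.source, e.open_source, h.mem_toOpenPartialHomeomorph_source, e.injOn⟩

/-- On a set where `f` is injective, the change of variables formula, with the weight `b` carried
along by the inverse. -/
theorem lintegral_injOn_eq {f : ℂ → ℂ} {A : Set ℂ} (hA : MeasurableSet A)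
    (hf : ∀ s ∈ A, DifferentiableAt ℂ f s) (hinj : InjOn f A) (u b : ℂ → ℝ≥0∞) :
    ∫⁻ s in A, ENNReal.ofReal (‖deriv f s‖ ^ 2) * (u (f s) * b s) =
      ∫⁻ w, (f '' A).indicator (fun w => u w * b (Function.invFunOn f A w)) w := by
  have hd : ∀ s ∈ A, HasFDerivWithinAt f
      ((ContinuousLinearMap.toSpanSingleton ℂ (deriv f s)).restrictScalars ℝ : ℂ →L[ℝ] ℂ) A s :=
    fun s hs => ((hf s hs).hasDerivAt.hasFDerivAt.restrictScalars ℝ).hasFDerivWithinAt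
  rw [lintegral_indicator (measurable_image_of_fderivWithin hA hd hinj),
    lintegral_image_eq_lintegral_abs_det_fderiv_mul volume hA hd hinj]
  refine setLIntegral_congr_fun hA fun s hs => ?_
  rw [abs_det_restrictScalars_deriv, hinj.leftInvOn_invFunOn hs]

/-- The area formula, as an inequality, for analytic functions that need not be injective. -/
theorem lintegral_comp_le_lintegral_tsum {f : ℂ → ℂ} {U Ω : Set ℂ} (hU : IsOpen U)
    (hf : DifferentiableOn ℂ f U) (hΩ : MeasurableSet Ω) (hΩU : Ω ⊆ U) (u b : ℂ → ℝ≥0∞) :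
    ∫⁻ s in Ω, ENNReal.ofReal (‖deriv f s‖ ^ 2) * (u (f s) * b s) ≤
      ∫⁻ w, u w * ∑' a : {a : ℂ // a ∈ Ω ∧ f a = w}, b a := by
  classical
  -- Critical points contribute nothing to the left side, because the Jacobian `|f'|²` vanishes
  -- there. Off them `f` is locally injective.
  set Z : Set ℂ := {s | deriv f s = 0} with hZ
  have hZm : MeasurableSet Z := (measurable_deriv f) (measurableSet_singleton 0)
  set Ω' := Ω \ Z with hΩ'
  have hΩ'm : MeasurableSet Ω' := hΩ.diff hZm
  have hsplit : ∫⁻ s in Ω, ENNReal.ofReal (‖deriv f s‖ ^ 2) * (u (f s) * b s) ≤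
      ∫⁻ s in Ω', ENNReal.ofReal (‖deriv f s‖ ^ 2) * (u (f s) * b s) := by
    rw [← lintegral_inter_add_sdiff _ Ω hZm, setLIntegral_congr_fun (g := fun _ => 0)
      (hΩ.inter hZm) fun s hs => by simp [show deriv f s = 0 from hs.2]]
    simp [hΩ']
  refine hsplit.trans ?_
  have hV : ∀ s ∈ Ω', ∃ V, IsOpen V ∧ s ∈ V ∧ InjOn f V := fun s hs =>
    exists_injOn_nhds (hf.analyticAt (hU.mem_nhds (hΩU hs.1))) hs.2
  choose! V hVo hVs hVi using hV
  obtain ⟨t, htΩ, htc, hcov⟩ := TopologicalSpace.countable_cover_nhdsWithin (f := V) (s := Ω')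
    fun s hs => nhdsWithin_le_nhds ((hVo s hs).mem_nhds (hVs s hs))
  rcases t.eq_empty_or_nonempty with rfl | hne
  · have : Ω' = ∅ := by simpa using hcov
    rw [this]
    simp
  obtain ⟨x, hx⟩ := htc.exists_eq_range hne
  have hxΩ : ∀ i, x i ∈ Ω' := fun i => htΩ (hx ▸ mem_range_self i)
  -- A countable cover by open sets of injectivity, made disjoint; the injective change of variables
  -- applies to each piece.
  set A : ℕ → Set ℂ := fun i => Ω' ∩ disjointed (fun i => V (x i)) i with hA
  have hAm : ∀ i, MeasurableSet (A i) := fun i =>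
    hΩ'm.inter (MeasurableSet.disjointed (fun i => (hVo _ (hxΩ i)).measurableSet) i)
  have hAd : Pairwise (Function.onFun Disjoint A) := fun i j hij =>
    ((disjoint_disjointed _) hij).mono inter_subset_right inter_subset_right
  have hAU : ⋃ i, A i = Ω' := by
    rw [hA, ← inter_iUnion, iUnion_disjointed, inter_eq_left]
    refine hcov.trans ?_
    rw [hx, biUnion_range]
  have hAinj : ∀ i, InjOn f (A i) := fun i =>
    (hVi _ (hxΩ i)).mono (inter_subset_right.trans (disjointed_subset _ _))
  have hAΩ : ∀ i, A i ⊆ Ω := fun i => inter_subset_left.trans sdiff_subset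
  rw [← hAU, lintegral_iUnion hAm hAd]
  simp_rw [fun i => lintegral_injOn_eq (hAm i) (fun s hs =>
    hf.differentiableAt (hU.mem_nhds (hΩU (hAΩ i hs)))) (hAinj i) u b]
  refine (tsum_lintegral_le _ _).trans (lintegral_mono fun w => ?_)
  simp only
  have h1 : ∑' i, (f '' A i).indicator (fun w => u w * b (Function.invFunOn f (A i) w)) w =
      ∑' i : {i // w ∈ f '' A i}, u w * b (Function.invFunOn f (A i) w) := by
    refine Eq.trans ?_ (tsum_subtype {i | w ∈ f '' A i}
      fun i => u w * b (Function.invFunOn f (A i) w)).symm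
    refine tsum_congr fun i => ?_
    by_cases hi : w ∈ f '' A i
    · rw [indicator_of_mem hi, indicator_of_mem (show i ∈ {i | w ∈ f '' A i} from hi)]
    · rw [indicator_of_notMem hi, indicator_of_notMem (show i ∉ {i | w ∈ f '' A i} from hi)]
  rw [h1, ENNReal.tsum_mul_left]
  refine mul_le_mul_right ?_ _
  -- Disjoint pieces meeting the fibre over `w` supply distinct points of it, so the sum over pieces
  -- is at most the sum over the fibre.
  set g : {i // w ∈ f '' A i} → {a : ℂ // a ∈ Ω ∧ f a = w} := fun i =>
    ⟨Function.invFunOn f (A i) w, hAΩ i (Function.invFunOn_mem i.2), Function.invFunOn_eq i.2⟩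
    with hg
  have hginj : Function.Injective g := by
    intro i j hij
    by_contra hne
    have hd := hAd (fun h => hne (Subtype.ext h) : (i : ℕ) ≠ j)
    have h2 : (g i : ℂ) ∈ A i := Function.invFunOn_mem i.2
    have h3 : (g j : ℂ) ∈ A j := Function.invFunOn_mem j.2
    rw [hij] at h2
    exact (Set.disjoint_left.1 hd) h2 h3
  exact ENNReal.tsum_comp_le_tsum_of_injective hginj fun a : {a : ℂ // a ∈ Ω ∧ f a = w} => b a

/-! ### Integrals over half-strips -/

/-- The half-strip `Re s > 0`, `|Im s| < T`. -/
def halfStrip (T : ℝ) : Set ℂ := {s | 0 < s.re ∧ s.im ∈ Ioo (-T) T}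

theorem measurableSet_halfStrip (T : ℝ) : MeasurableSet (halfStrip T) :=
  (measurableSet_lt measurable_const Complex.measurable_re).inter
    (Complex.measurable_im measurableSet_Ioo)

theorem lintegral_halfStrip (T : ℝ) {F : ℂ → ℝ≥0∞} (hF : Measurable F) :
    ∫⁻ s in halfStrip T, F s =
      ∫⁻ σ in Ioi (0 : ℝ), ∫⁻ t in Ioo (-T) T, F ((σ : ℂ) + t * Complex.I) := by
  have h1 : MeasurableEquiv.symm Complex.measurableEquivRealProd ⁻¹' halfStrip T =
      Ioi (0 : ℝ) ×ˢ Ioo (-T) T := by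
    ext p
    simp [halfStrip]
  rw [← (Complex.volume_preserving_equiv_real_prod.symm).setLIntegral_comp_preimage
    (measurableSet_halfStrip T) hF, h1, Measure.volume_eq_prod, setLIntegral_prod]
  · refine lintegral_congr fun σ => lintegral_congr fun t => ?_
    congr 1
    rw [Complex.measurableEquivRealProd_symm_apply]
    exact Complex.mk_eq_add_mul_I _ _
  · exact (hF.comp (MeasurableEquiv.measurable _)).aemeasurable

/-- The Littlewood–Paley integral of `f ∘ Φ` over a half-strip is controlled by that of `f` over a
larger one, weighted by a bound for the counting function. -/
theorem lintegral_deriv_comp_le {Φ f f' : ℂ → ℂ} {c M T : ℝ} (hc : 0 < c)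
    (hΦ : DifferentiableOn ℂ Φ (halfPlane 0)) (hmaps : MapsTo Φ (halfPlane 0) (halfPlane 0))
    (him : ∀ s ∈ halfPlane 0, |(Φ s).im - c * s.im| ≤ M)
    (hf : ∀ s, HasDerivAt f (f' s) s) (hf' : Measurable f')
    {B κ : ℝ → ℝ≥0∞} (hB : Measurable B) (hκ : Measurable κ)
    (hN : ∀ w ∈ halfPlane 0, ∑' a : {a : ℂ // a ∈ halfPlane 0 ∧ Φ a = w}, B a.1.re ≤ κ w.re) :
    ∫⁻ σ in Ioi 0, B σ * ∫⁻ t in Ioo (-T) T,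
        ENNReal.ofReal (‖deriv (f ∘ Φ) ((σ : ℂ) + t * Complex.I)‖ ^ 2) ≤
      ∫⁻ σ in Ioi 0, κ σ * ∫⁻ t in Ioo (-(c * T + M)) (c * T + M),
        ENNReal.ofReal (‖f' ((σ : ℂ) + t * Complex.I)‖ ^ 2) := by
  classical
  have hline : ∀ σ t : ℝ, ((σ : ℂ) + t * Complex.I).re = σ := fun σ t => by simp
  have hD : Measurable fun s => ENNReal.ofReal (‖deriv (f ∘ Φ) s‖ ^ 2) :=
    (((measurable_deriv (f ∘ Φ)).norm.pow_const 2)).ennreal_ofReal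
  have hD' : Measurable fun s => ENNReal.ofReal (‖f' s‖ ^ 2) :=
    ((hf'.norm.pow_const 2)).ennreal_ofReal
  have hleft : ∫⁻ σ in Ioi 0, B σ * ∫⁻ t in Ioo (-T) T,
        ENNReal.ofReal (‖deriv (f ∘ Φ) ((σ : ℂ) + t * Complex.I)‖ ^ 2) =
      ∫⁻ s in halfStrip T, B s.re * ENNReal.ofReal (‖deriv (f ∘ Φ) s‖ ^ 2) := by
    refine Eq.trans ?_ (lintegral_halfStrip T
      (F := fun s => B s.re * ENNReal.ofReal (‖deriv (f ∘ Φ) s‖ ^ 2))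
      ((hB.comp Complex.measurable_re).mul hD)).symm
    refine lintegral_congr fun σ => ?_
    simp_rw [hline]
    rw [lintegral_const_mul]
    exact hD.comp (continuous_line σ).measurable
  have hright : ∫⁻ σ in Ioi 0, κ σ * ∫⁻ t in Ioo (-(c * T + M)) (c * T + M),
        ENNReal.ofReal (‖f' ((σ : ℂ) + t * Complex.I)‖ ^ 2) =
      ∫⁻ s in halfStrip (c * T + M), κ s.re * ENNReal.ofReal (‖f' s‖ ^ 2) := by
    refine Eq.trans ?_ (lintegral_halfStrip _
      (F := fun s => κ s.re * ENNReal.ofReal (‖f' s‖ ^ 2))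
      ((hκ.comp Complex.measurable_re).mul hD')).symm
    refine lintegral_congr fun σ => ?_
    simp_rw [hline]
    rw [lintegral_const_mul]
    exact hD'.comp (continuous_line σ).measurable
  rw [hleft, hright]
  set u : ℂ → ℝ≥0∞ := (halfStrip (c * T + M)).indicator fun w => ENNReal.ofReal (‖f' w‖ ^ 2)
    with hu
  have hsub : halfStrip T ⊆ halfPlane 0 := fun s hs => hs.1
  -- The bound on `Im Φ - c Im s` enters here: the height grows by the factor `c` plus an additive
  -- `M`.
  have hstrip : ∀ s ∈ halfStrip T, Φ s ∈ halfStrip (c * T + M) := by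
    intro s hs
    have h1 := abs_le.1 (him s (hsub hs))
    have h2 := mul_lt_mul_of_pos_left hs.2.1 hc
    have h3 := mul_lt_mul_of_pos_left hs.2.2 hc
    exact ⟨hmaps (hsub hs), by linarith [h1.1], by linarith [h1.2]⟩
  calc ∫⁻ s in halfStrip T, B s.re * ENNReal.ofReal (‖deriv (f ∘ Φ) s‖ ^ 2)
      = ∫⁻ s in halfStrip T, ENNReal.ofReal (‖deriv Φ s‖ ^ 2) * (u (Φ s) * B s.re) := by
        refine setLIntegral_congr_fun (measurableSet_halfStrip T) fun s hs => ?_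
        have h1 : deriv (f ∘ Φ) s = f' (Φ s) * deriv Φ s :=
          ((hf (Φ s)).comp s (differentiableAt_of_halfPlane hΦ (hsub hs)).hasDerivAt).deriv
        rw [h1, hu, indicator_of_mem (hstrip s hs), norm_mul, mul_pow,
          ENNReal.ofReal_mul (sq_nonneg _)]
        ring
    _ ≤ ∫⁻ w, u w * ∑' a : {a : ℂ // a ∈ halfStrip T ∧ Φ a = w}, B a.1.re :=
        lintegral_comp_le_lintegral_tsum (isOpen_halfPlane 0) hΦ (measurableSet_halfStrip T) hsub u
          fun s => B s.re
    _ ≤ ∫⁻ w, (halfStrip (c * T + M)).indicator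
          (fun s => κ s.re * ENNReal.ofReal (‖f' s‖ ^ 2)) w := by
        refine lintegral_mono fun w => ?_
        simp only [hu]
        by_cases hw : w ∈ halfStrip (c * T + M)
        · rw [indicator_of_mem hw, indicator_of_mem hw, mul_comm]
          refine mul_le_mul_left (le_trans ?_ (hN w hw.1)) _
          exact ENNReal.tsum_mono_subtype (fun a : ℂ => B a.re)
            (s := {a | a ∈ halfStrip T ∧ Φ a = w}) (t := {a | a ∈ halfPlane 0 ∧ Φ a = w})
            fun a ha => ⟨hsub ha.1, ha.2⟩
        · rw [indicator_of_notMem hw, indicator_of_notMem hw, zero_mul]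
    _ = _ := lintegral_indicator (measurableSet_halfStrip _) _

end DirichletComposition

namespace DirichletComposition

/-! ### Littlewood–Paley estimates -/

theorem ofReal_integral_norm_sq {f : ℝ → ℂ} (hf : Continuous f) {T : ℝ} (hT : 0 ≤ T) :
    ENNReal.ofReal (∫ t in -T..T, ‖f t‖ ^ 2) =
      ∫⁻ t in Ioo (-T) T, ENNReal.ofReal (‖f t‖ ^ 2) := by
  rw [intervalIntegral.integral_of_le (by linarith), ofReal_integral_eq_lintegral_ofReal,
    restrict_Ioo_eq_restrict_Ioc]
  · exact (hf.norm.pow 2).integrableOn_Icc.mono_set Ioc_subset_Icc_self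
  · exact Eventually.of_forall fun t => sq_nonneg _

/-- Weighted lower bound for the mean squares of an analytic function by the coefficients of its
Dirichlet series. -/
theorem lintegral_sum_le_liminf {H : ℂ → ℂ} {c : ℕ → ℂ} {X : ℝ}
    (hH : DifferentiableOn ℂ H (halfPlane 0))
    (hHb : ∀ δ, 0 < δ → ∃ C, ∀ s : ℂ, δ ≤ s.re → ‖H s‖ ≤ C)
    (hc : ∀ s : ℂ, X < s.re → LSeriesSummable c s ∧ H s = LSeries c s)
    (hHm : Measurable H) {B : ℝ → ℝ≥0∞} (hB : Measurable B) (hBtop : ∀ σ, 0 < σ → B σ ≠ ∞)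
    (S : Finset ℕ+) :
    ∫⁻ σ in Ioi (0 : ℝ), B σ * ENNReal.ofReal (∑ n ∈ S, ‖c n‖ ^ 2 * (n : ℝ) ^ (-2 * σ)) ≤
      liminf (fun k : ℕ => ENNReal.ofReal (2 * (k : ℝ))⁻¹ * ∫⁻ σ in Ioi (0 : ℝ), B σ *
        ∫⁻ t in Ioo (-(k : ℝ)) k, ENNReal.ofReal (‖H ((σ : ℂ) + t * Complex.I)‖ ^ 2)) atTop := by
  set I : ℕ → ℝ → ℝ≥0∞ := fun k σ => ENNReal.ofReal (2 * (k : ℝ))⁻¹ * (B σ *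
    ∫⁻ t in Ioo (-(k : ℝ)) k, ENNReal.ofReal (‖H ((σ : ℂ) + t * Complex.I)‖ ^ 2)) with hI
  have hIm' : ∀ k : ℕ, Measurable fun σ : ℝ =>
      B σ * ∫⁻ t in Ioo (-(k : ℝ)) k, ENNReal.ofReal (‖H ((σ : ℂ) + t * Complex.I)‖ ^ 2) := by
    intro k
    refine hB.mul (Measurable.lintegral_prod_right' (f := fun p : ℝ × ℝ =>
      ENNReal.ofReal (‖H ((p.1 : ℂ) + p.2 * Complex.I)‖ ^ 2)) ?_)
    refine ((hHm.comp ?_).norm.pow_const 2).ennreal_ofReal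
    exact Continuous.measurable (by fun_prop)
  have hIm : ∀ k, Measurable (I k) := fun k => (hIm' k).const_mul _
  have h1 : ∀ σ ∈ Ioi (0 : ℝ),
      B σ * ENNReal.ofReal (∑ n ∈ S, ‖c n‖ ^ 2 * (n : ℝ) ^ (-2 * σ)) ≤
        liminf (fun k => I k σ) atTop := by
    intro σ hσ
    obtain ⟨R, hR, hRle⟩ := exists_tendsto_le_mean_sq hH hHb hc hσ S
    have h2 : Tendsto (fun k : ℕ => B σ * ENNReal.ofReal (R k)) atTop
        (𝓝 (B σ * ENNReal.ofReal (∑ n ∈ S, ‖c n‖ ^ 2 * (n : ℝ) ^ (-2 * σ)))) :=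
      ENNReal.Tendsto.const_mul (ENNReal.tendsto_ofReal (hR.comp tendsto_natCast_atTop_atTop))
        (Or.inr (hBtop σ hσ))
    rw [← h2.liminf_eq]
    refine liminf_le_liminf ?_
    filter_upwards [eventually_gt_atTop 0] with k hk
    have hk' : (0 : ℝ) < k := by exact_mod_cast hk
    rw [hI]
    simp only
    rw [mul_left_comm]
    refine mul_le_mul_right ?_ _
    rw [← ofReal_integral_norm_sq (continuous_comp_line hH hσ) hk'.le, ← ENNReal.ofReal_mul (by positivity)]
    exact ENNReal.ofReal_le_ofReal (hRle k hk')
  -- Fatou's lemma moves the lower limit in the height `k` outside the integral in `σ`.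
  refine (setLIntegral_mono' measurableSet_Ioi h1).trans ((lintegral_liminf_le hIm).trans_eq ?_)
  refine congrArg (fun F => liminf F atTop) (funext fun k => ?_)
  exact lintegral_const_mul _ (hIm' k)

theorem lintegral_mul_ofReal_sum {κ : ℝ → ℝ≥0∞} (hκ : Measurable κ) (S : Finset ℕ+) (d : ℕ+ → ℝ)
    (hd : ∀ n ∈ S, 0 ≤ d n) :
    ∫⁻ σ in Ioi (0 : ℝ), κ σ * ENNReal.ofReal (∑ n ∈ S, d n * (n : ℝ) ^ (-2 * σ)) =
      ∑ n ∈ S, ENNReal.ofReal (d n) *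
        ∫⁻ σ in Ioi (0 : ℝ), κ σ * ENNReal.ofReal ((n : ℝ) ^ (-2 * σ)) := by
  have hm : ∀ n : ℕ+, Measurable fun σ : ℝ => κ σ * ENNReal.ofReal (((n : ℕ) : ℝ) ^ (-2 * σ)) := by
    intro n
    have : Continuous fun σ : ℝ => ((n : ℕ) : ℝ) ^ (-2 * σ) :=
      continuous_const.rpow (by fun_prop) fun _ => Or.inl (Nat.cast_ne_zero.2 n.ne_zero)
    exact hκ.mul this.measurable.ennreal_ofReal
  simp_rw [← lintegral_const_mul _ (hm _)]
  rw [← lintegral_finsetSum _ fun n _ => (hm n).const_mul _]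
  refine lintegral_congr fun σ => ?_
  rw [ENNReal.ofReal_sum_of_nonneg fun n hn => mul_nonneg (hd n hn) (by positivity),
    Finset.mul_sum]
  refine Finset.sum_congr rfl fun n hn => ?_
  rw [ENNReal.ofReal_mul (hd n hn), mul_left_comm]

/-- Weighted upper bound for the mean squares of a Dirichlet polynomial without constant term. -/
theorem exists_lintegral_dirichletSum_le (S : Finset ℕ+) (d : ℕ+ → ℂ)
    (hS : ∀ n ∈ S, 2 ≤ (n : ℕ)) {κ : ℝ → ℝ≥0∞} (hκ : Measurable κ) {Q : ℕ+ → ℝ}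
    (hQ0 : ∀ n ∈ S, 0 ≤ Q n) {J : ℝ} (hJ0 : 0 ≤ J)
    (hQ : ∀ n ∈ S, ∫⁻ σ in Ioi (0 : ℝ), κ σ * ENNReal.ofReal ((n : ℝ) ^ (-2 * σ)) ≤
      ENNReal.ofReal (Q n))
    (hJ : ∫⁻ σ in Ioi (0 : ℝ), κ σ * ENNReal.ofReal ((4 : ℝ) ^ (-σ)) ≤ ENNReal.ofReal J) :
    ∃ C : ℝ, ∀ R : ℝ, 0 ≤ R → ∫⁻ σ in Ioi (0 : ℝ), κ σ * ∫⁻ t in Ioo (-R) R,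
        ENNReal.ofReal (‖dirichletSum S d ((σ : ℂ) + t * Complex.I)‖ ^ 2) ≤
      ENNReal.ofReal (2 * R * ∑ n ∈ S, ‖d n‖ ^ 2 * Q n + C) := by
  obtain ⟨C, hC0, hC⟩ := exists_integral_norm_sq_dirichletSum_le S d hS
  refine ⟨C * J, fun R hR => ?_⟩
  have hm4 : Measurable fun σ : ℝ => κ σ * ENNReal.ofReal ((4 : ℝ) ^ (-σ)) := by
    have : Continuous fun σ : ℝ => (4 : ℝ) ^ (-σ) :=
      continuous_const.rpow (by fun_prop) fun _ => Or.inl (by norm_num)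
    exact hκ.mul this.measurable.ennreal_ofReal
  have hd0 : ∀ n ∈ S, 0 ≤ 2 * R * ‖d n‖ ^ 2 := fun n _ => by positivity
  calc ∫⁻ σ in Ioi (0 : ℝ), κ σ * ∫⁻ t in Ioo (-R) R,
        ENNReal.ofReal (‖dirichletSum S d ((σ : ℂ) + t * Complex.I)‖ ^ 2)
      ≤ ∫⁻ σ in Ioi (0 : ℝ), (κ σ * ENNReal.ofReal
          (∑ n ∈ S, (2 * R * ‖d n‖ ^ 2) * (n : ℝ) ^ (-2 * σ)) +
          ENNReal.ofReal C * (κ σ * ENNReal.ofReal ((4 : ℝ) ^ (-σ)))) := by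
        refine setLIntegral_mono' measurableSet_Ioi fun σ hσ => ?_
        have hσ' : (0 : ℝ) < σ := hσ
        rw [mul_left_comm, ← mul_add, ← ENNReal.ofReal_mul hC0, ← ENNReal.ofReal_add
          (Finset.sum_nonneg fun n hn => mul_nonneg (hd0 n hn) (by positivity)) (by positivity),
          ← ofReal_integral_norm_sq (continuous_comp_line (θ := 0)
            (differentiable_dirichletSum S d).differentiableOn hσ) hR]
        refine mul_le_mul_right (ENNReal.ofReal_le_ofReal ((hC σ R hσ'.le hR).trans_eq ?_)) _
        rw [Finset.mul_sum]
        simp_rw [mul_assoc]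
    _ = ∑ n ∈ S, ENNReal.ofReal (2 * R * ‖d n‖ ^ 2) *
          (∫⁻ σ in Ioi (0 : ℝ), κ σ * ENNReal.ofReal ((n : ℝ) ^ (-2 * σ))) +
          ENNReal.ofReal C * ∫⁻ σ in Ioi (0 : ℝ), κ σ * ENNReal.ofReal ((4 : ℝ) ^ (-σ)) := by
        rw [lintegral_add_right _ (hm4.const_mul _), lintegral_mul_ofReal_sum hκ S _ hd0,
          lintegral_const_mul _ hm4]
    _ ≤ ∑ n ∈ S, ENNReal.ofReal (2 * R * ‖d n‖ ^ 2) * ENNReal.ofReal (Q n) +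
          ENNReal.ofReal C * ENNReal.ofReal J := by
        gcongr with n hn
        exact hQ n hn
    _ = _ := by
        rw [← ENNReal.ofReal_mul hC0, Finset.mul_sum, ENNReal.ofReal_add, ENNReal.ofReal_sum_of_nonneg]
        · congr 1
          refine Finset.sum_congr rfl fun n hn => ?_
          rw [← ENNReal.ofReal_mul (hd0 n hn), mul_assoc]
        · exact fun n hn => mul_nonneg (by positivity) (mul_nonneg (sq_nonneg _) (hQ0 n hn))
        · exact Finset.sum_nonneg fun n hn =>
            mul_nonneg (by positivity) (mul_nonneg (sq_nonneg _) (hQ0 n hn))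
        · positivity

/-- Comparison of coefficients of `f ∘ Φ` and `f`, for a Dirichlet polynomial `f`. -/
theorem sum_coeff_comp_le {Φ : ℂ → ℂ} {c M : ℝ} (hc : 0 < c) (hM : 0 ≤ M)
    (hΦ : DifferentiableOn ℂ Φ (halfPlane 0)) (hmaps : MapsTo Φ (halfPlane 0) (halfPlane 0))
    (him : ∀ s ∈ halfPlane 0, |(Φ s).im - c * s.im| ≤ M)
    {B κ : ℝ → ℝ≥0∞} (hB : Measurable B) (hBtop : ∀ σ, 0 < σ → B σ ≠ ∞) (hκ : Measurable κ)
    (hN : ∀ w ∈ halfPlane 0, ∑' a : {a : ℂ // a ∈ halfPlane 0 ∧ Φ a = w}, B a.1.re ≤ κ w.re)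
    {w : ℕ+ → ℝ} (hw0 : ∀ n, 0 ≤ w n)
    (hBw : ∀ n : ℕ+, n ≠ 1 → ∫⁻ σ in Ioi (0 : ℝ), B σ * ENNReal.ofReal ((n : ℝ) ^ (-2 * σ)) =
      ENNReal.ofReal (w n / (4 * Real.log n ^ 2)))
    (S : Finset ℕ+) (a : ℕ+ → ℂ) {D J : ℝ} (hD : 0 ≤ D) (hJ0 : 0 ≤ J)
    (hκw : ∀ n ∈ S.erase 1, ∫⁻ σ in Ioi (0 : ℝ), κ σ * ENNReal.ofReal ((n : ℝ) ^ (-2 * σ)) ≤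
      ENNReal.ofReal (D * (w n / (4 * Real.log n ^ 2))))
    (hJ : ∫⁻ σ in Ioi (0 : ℝ), κ σ * ENNReal.ofReal ((4 : ℝ) ^ (-σ)) ≤ ENNReal.ofReal J)
    {b : ℕ → ℂ} (hb : ∀ s : ℂ, 1 / 2 < s.re → LSeriesSummable b s ∧
      dirichletSum S a (Φ s) = LSeries b s)
    (S' : Finset ℕ+) (hS' : 1 ∉ S') :
    ∑ n ∈ S', ‖b n‖ ^ 2 * w n ≤ c * D * ∑ n ∈ S.erase 1, ‖a n‖ ^ 2 * w n := by
  classical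
  have hlog : ∀ n : ℕ+, n ≠ 1 → 0 < Real.log n := fun n hn => by
    refine Real.log_pos ?_
    exact_mod_cast lt_of_le_of_ne (one_le) hn.symm
  set f := dirichletSum S a with hf
  set d : ℕ+ → ℂ := fun n => -(Real.log n : ℝ) * a n with hd
  -- The factor `log 1 = 0` removes the constant term. This is why the index `1` is absent from both
  -- sides of the estimate and why the frequencies here are at least `2`.
  set f' := dirichletSum (S.erase 1) d with hf'
  have hfd : ∀ s, HasDerivAt f (f' s) s := by
    intro s
    have h1 := hasDerivAt_dirichletSum S a s
    have h2 : dirichletSum S d s = f' s := by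
      rw [hf', dirichletSum, dirichletSum]
      refine (Finset.sum_subset (Finset.erase_subset _ _) fun n hn hn' => ?_).symm
      have : n = 1 := by
        by_contra h
        exact hn' (Finset.mem_erase.2 ⟨h, hn⟩)
      simp [this, hd]
    rw [← h2]
    exact h1
  set G := f ∘ Φ with hG
  have hGd : DifferentiableOn ℂ G (halfPlane 0) := fun s hs =>
    ((hfd (Φ s)).differentiableAt.comp_differentiableWithinAt s (hΦ s hs))
  have hGb : ∀ s ∈ halfPlane 0, ‖G s‖ ≤ ∑ n ∈ S, ‖a n‖ := fun s hs =>
    norm_dirichletSum_le S a (le_of_lt (hmaps hs))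
  have hHd : DifferentiableOn ℂ (deriv G) (halfPlane 0) := hGd.deriv (isOpen_halfPlane 0)
  have hHb : ∀ δ, 0 < δ → ∃ C, ∀ s : ℂ, δ ≤ s.re → ‖deriv G s‖ ≤ C := by
    intro δ hδ
    refine ⟨2 * (∑ n ∈ S, ‖a n‖) / δ, fun s hs => ?_⟩
    refine (norm_deriv_le_of_bounded hGd hGb (lt_of_lt_of_le hδ hs)).trans ?_
    rw [sub_zero]
    gcongr
  -- Termwise differentiation: the coefficients of `G'` are `-b n log n`, and the square of the
  -- logarithm cancels the one in the Littlewood–Paley integral.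
  have hLd : ∀ s : ℂ, 1 / 2 < s.re → LSeriesSummable (-(LSeries.logMul b)) s ∧
      deriv G s = LSeries (-(LSeries.logMul b)) s := by
    intro s hs
    have habs : LSeries.abscissaOfAbsConv b < s.re := by
      have h1 := (hb (((1 / 2 + s.re) / 2 : ℝ) : ℂ) (by
        rw [Complex.ofReal_re]; linarith)).1.abscissaOfAbsConv_le
      refine lt_of_le_of_lt h1 ?_
      rw [Complex.ofReal_re]
      exact_mod_cast (by linarith : (1 / 2 + s.re) / 2 < s.re)
    refine ⟨(LSeriesSummable_logMul_of_lt_re habs).neg, ?_⟩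
    rw [LSeries_neg, ← LSeries_deriv habs]
    refine Filter.EventuallyEq.deriv_eq ?_
    filter_upwards [(isOpen_halfPlane (1 / 2)).mem_nhds hs] with z hz using (hb z hz).2
  have hlow := lintegral_sum_le_liminf hHd hHb hLd (measurable_deriv G) hB hBtop S'
  have hS2 : ∀ n ∈ S.erase 1, 2 ≤ (n : ℕ) := by
    intro n hn
    have := (Finset.mem_erase.1 hn).1
    exact_mod_cast (lt_of_le_of_ne (one_le) this.symm : 1 < n)
  obtain ⟨C, hC⟩ := exists_lintegral_dirichletSum_le (S.erase 1) d hS2 hκ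
    (Q := fun n => D * (w n / (4 * Real.log n ^ 2)))
    (fun n _ => mul_nonneg hD (div_nonneg (hw0 n) (by positivity))) hJ0 hκw hJ
  set A := ∑ n ∈ S.erase 1, ‖d n‖ ^ 2 * (D * (w n / (4 * Real.log n ^ 2))) with hA
  have hAval : A = D * (∑ n ∈ S.erase 1, ‖a n‖ ^ 2 * w n) / 4 := by
    rw [hA, Finset.mul_sum, Finset.sum_div]
    refine Finset.sum_congr rfl fun n hn => ?_
    have := (hlog n (Finset.mem_erase.1 hn).1).ne'
    rw [hd]
    simp only
    rw [norm_mul, norm_neg, Complex.norm_real, mul_pow, Real.norm_eq_abs, sq_abs]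
    field_simp
  have hlhs : ∫⁻ σ in Ioi (0 : ℝ), B σ * ENNReal.ofReal
      (∑ n ∈ S', ‖(-(LSeries.logMul b)) n‖ ^ 2 * (n : ℝ) ^ (-2 * σ)) =
      ENNReal.ofReal ((∑ n ∈ S', ‖b n‖ ^ 2 * w n) / 4) := by
    rw [lintegral_mul_ofReal_sum hB S' (fun n => ‖(-(LSeries.logMul b)) n‖ ^ 2)
      fun n _ => sq_nonneg _, Finset.sum_div, ENNReal.ofReal_sum_of_nonneg]
    · refine Finset.sum_congr rfl fun n hn => ?_
      have hn1 : n ≠ 1 := fun h => hS' (h ▸ hn)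
      have := (hlog n hn1).ne'
      rw [hBw n hn1, ← ENNReal.ofReal_mul (sq_nonneg _)]
      congr 1
      rw [Pi.neg_apply, norm_neg, LSeries.logMul, norm_mul, Complex.natCast_log.symm,
        Complex.norm_real, mul_pow, Real.norm_eq_abs, sq_abs]
      field_simp
    · exact fun n _ => div_nonneg (mul_nonneg (sq_nonneg _) (hw0 n)) (by norm_num)
  rw [hlhs] at hlow
  have hup : ∀ k : ℕ, ENNReal.ofReal (2 * (k : ℝ))⁻¹ * ∫⁻ σ in Ioi (0 : ℝ), B σ *
      ∫⁻ t in Ioo (-(k : ℝ)) k, ENNReal.ofReal (‖deriv G ((σ : ℂ) + t * Complex.I)‖ ^ 2) ≤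
      ENNReal.ofReal ((2 * (k : ℝ))⁻¹ * (2 * (c * k + M) * A + C)) := by
    intro k
    rw [ENNReal.ofReal_mul (by positivity)]
    refine mul_le_mul_right ?_ _
    exact (lintegral_deriv_comp_le hc hΦ hmaps him hfd
      (differentiable_dirichletSum _ _).continuous.measurable hB hκ hN).trans
      (hC _ (by positivity))
  -- After division by `2k`, both the widening `M` of the strip and the off-diagonal error `C`
  -- disappear; only the dilation factor `c` remains.
  have hlim : Tendsto (fun k : ℕ => (2 * (k : ℝ))⁻¹ * (2 * (c * k + M) * A + C)) atTop
      (𝓝 (c * A)) := by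
    have h1 : Tendsto (fun k : ℕ => c * A + (k : ℝ)⁻¹ * (M * A + C / 2)) atTop
        (𝓝 (c * A + 0 * (M * A + C / 2))) :=
      tendsto_const_nhds.add ((tendsto_inv_atTop_zero.comp
        tendsto_natCast_atTop_atTop).mul_const _)
    rw [zero_mul, add_zero] at h1
    refine h1.congr' ?_
    filter_upwards [eventually_gt_atTop 0] with k hk
    have hk' : (k : ℝ) ≠ 0 := by exact_mod_cast hk.ne'
    field_simp
    ring
  have hfin := hlow.trans ((liminf_le_liminf (Eventually.of_forall hup)).trans_eq
    (ENNReal.tendsto_ofReal hlim).liminf_eq)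
  have hA0 : 0 ≤ c * A := by
    rw [hAval]
    have : 0 ≤ ∑ n ∈ S.erase 1, ‖a n‖ ^ 2 * w n :=
      Finset.sum_nonneg fun n _ => mul_nonneg (sq_nonneg _) (hw0 n)
    positivity
  rw [ENNReal.ofReal_le_ofReal_iff hA0, hAval] at hfin
  linarith

end DirichletComposition

namespace DirichletComposition

/-! ### Littlewood–Paley weights -/

theorem lintegral_mul_exp_neg {r : ℝ} (hr : 0 < r) :
    ∫⁻ σ in Ioi (0 : ℝ), ENNReal.ofReal σ * ENNReal.ofReal (Real.exp (-(r * σ))) =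
      ENNReal.ofReal (1 / r ^ 2) := by
  have h1 := Real.integral_rpow_mul_exp_neg_mul_Ioi (a := 2) two_pos hr
  have h2 : ∫ σ in Ioi (0 : ℝ), σ * Real.exp (-(r * σ)) = 1 / r ^ 2 := by
    have h3 : ∀ σ : ℝ, σ ^ ((2 : ℝ) - 1) = σ := fun σ => by norm_num
    simp_rw [h3] at h1
    rw [h1, Real.Gamma_two]
    norm_num
  have hint : IntegrableOn (fun σ : ℝ => σ * Real.exp (-(r * σ))) (Ioi 0) := by
    -- A non-integrable function has Bochner integral `0`, so a nonzero value proves integrability.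
    refine Integrable.of_integral_ne_zero ?_
    rw [h2]
    positivity
  rw [← h2, ofReal_integral_eq_lintegral_ofReal hint]
  · refine setLIntegral_congr_fun measurableSet_Ioi fun σ hσ => ?_
    exact (ENNReal.ofReal_mul (le_of_lt hσ)).symm
  · filter_upwards [ae_restrict_mem measurableSet_Ioi] with σ hσ
    exact mul_nonneg (le_of_lt hσ) (Real.exp_pos _).le

theorem one_lt_cast_of_ne_one {n : ℕ+} (hn : n ≠ 1) : (1 : ℝ) < ((n : ℕ) : ℝ) := by
  exact_mod_cast lt_of_le_of_ne one_le hn.symm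

theorem rpow_neg_two_mul_eq_exp (n : ℕ+) (σ : ℝ) :
    ((n : ℕ) : ℝ) ^ (-2 * σ) = Real.exp (-(2 * Real.log n * σ)) := by
  rw [Real.rpow_def_of_pos (by exact_mod_cast n.pos)]
  congr 1
  ring

theorem lintegral_mul_rpow {n : ℕ+} (hn : n ≠ 1) :
    ∫⁻ σ in Ioi (0 : ℝ), ENNReal.ofReal σ * ENNReal.ofReal ((n : ℝ) ^ (-2 * σ)) =
      ENNReal.ofReal (1 / (4 * Real.log n ^ 2)) := by
  simp_rw [rpow_neg_two_mul_eq_exp]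
  rw [lintegral_mul_exp_neg (mul_pos two_pos (Real.log_pos (one_lt_cast_of_ne_one hn)))]
  congr 2
  ring

/-- A weight `β` on the half-line together with the sequence of its Littlewood–Paley
coefficients. -/
structure IsLittlewoodPaley (β : ℝ → ℝ) (w : Weight) : Prop where
  pos : ∀ σ, 0 < σ → 0 < β σ
  le_self : ∀ σ, 0 < σ → β σ ≤ σ
  -- That is, `β(σ) / σ` is nondecreasing. This transfers Littlewood's inequality from `σ` to `β`
  -- and makes `β` itself nondecreasing.
  le_div_mul : ∀ x y, 0 < x → x ≤ y → β x ≤ x / y * β y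
  lintegral_eq : ∀ n : ℕ+, n ≠ 1 →
    ∫⁻ σ in Ioi (0 : ℝ), ENNReal.ofReal (β σ) * ENNReal.ofReal ((n : ℝ) ^ (-2 * σ)) =
      ENNReal.ofReal (w.toFun n / (4 * Real.log n ^ 2))

theorem isLittlewoodPaley_hardy : IsLittlewoodPaley (fun σ => σ) hardyWeight where
  pos _ h := h
  le_self _ _ := le_rfl
  le_div_mul x y hx hxy := by rw [div_mul_cancel₀ _ (hx.trans_le hxy).ne']
  lintegral_eq n hn := lintegral_mul_rpow hn

/-! ### The weight `β_h` and its Littlewood–Paley integrals -/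

namespace BergmanDensity

variable (h : BergmanDensity)

theorem lintegral_eq_one : ∫⁻ u in Ioi (0 : ℝ), ENNReal.ofReal (h.toFun u) = 1 := by
  rw [← ofReal_integral_eq_lintegral_ofReal h.integrable, h.integral_eq_one, ENNReal.ofReal_one]
  filter_upwards [ae_restrict_mem measurableSet_Ioi] with σ hσ using h.nonneg σ hσ

/-- `ENNReal.ofReal` truncates `σ - u` to its positive part, so the domain of integration no longer
depends on `σ`. Comparisons become pointwise and Tonelli applies. -/
theorem ofReal_betaFun {σ : ℝ} (hσ : 0 < σ) :
    ENNReal.ofReal (betaFun h σ) =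
      ∫⁻ u in Ioi (0 : ℝ), ENNReal.ofReal (σ - u) * ENNReal.ofReal (h.toFun u) := by
  have hsub : Ioc 0 σ ⊆ Ioi (0 : ℝ) := fun x hx => hx.1
  have hint : IntegrableOn (fun u => (σ - u) * h.toFun u) (Ioc 0 σ) := by
    refine Integrable.bdd_mul (c := σ) (h.integrable.mono_set hsub)
      (by fun_prop : Continuous fun u : ℝ => σ - u).aestronglyMeasurable ?_
    filter_upwards [ae_restrict_mem measurableSet_Ioc] with u hu
    rw [Real.norm_eq_abs, abs_of_nonneg (by linarith [hu.2])]
    linarith [hu.1]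
  rw [betaFun, intervalIntegral.integral_of_le hσ.le, ofReal_integral_eq_lintegral_ofReal hint,
    ← lintegral_inter_add_sdiff (fun u => ENNReal.ofReal (σ - u) * ENNReal.ofReal (h.toFun u))
      (Ioi 0) (measurableSet_Iic (a := σ))]
  · have h1 : ∫⁻ u in Ioi 0 \ Iic σ, ENNReal.ofReal (σ - u) * ENNReal.ofReal (h.toFun u) = 0 := by
      rw [setLIntegral_congr_fun (g := fun _ => 0) (measurableSet_Ioi.diff measurableSet_Iic)]
      · simp
      · intro u hu
        have : σ < u := not_le.1 hu.2
        simp only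
        rw [ENNReal.ofReal_of_nonpos (by linarith), zero_mul]
    rw [h1, add_zero, Ioi_inter_Iic]
    refine setLIntegral_congr_fun measurableSet_Ioc fun u hu => ?_
    exact ENNReal.ofReal_mul (by linarith [hu.2])
  · filter_upwards [ae_restrict_mem measurableSet_Ioc] with u hu
    exact mul_nonneg (by linarith [hu.2]) (h.nonneg u hu.1)

theorem betaFun_pos {σ : ℝ} (hσ : 0 < σ) : 0 < betaFun h σ := by
  rw [← ENNReal.ofReal_pos, h.ofReal_betaFun hσ]
  have h0 := h.zero_mem_support (σ / 2) (by positivity)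
  have hsub : Ioo 0 (σ / 2) ⊆ Ioi (0 : ℝ) := fun x hx => hx.1
  have h1 : 0 < ENNReal.ofReal (σ / 2) * ENNReal.ofReal (∫ u in Ioo 0 (σ / 2), h.toFun u) :=
    ENNReal.mul_pos (ENNReal.ofReal_pos.2 (by positivity)).ne' (ENNReal.ofReal_pos.2 h0).ne'
  refine h1.trans_le ?_
  rw [ofReal_integral_eq_lintegral_ofReal (h.integrable.mono_set hsub),
    ← lintegral_const_mul' _ _ ENNReal.ofReal_ne_top]
  · refine (setLIntegral_mono' measurableSet_Ioo fun u hu => ?_).trans (lintegral_mono_set hsub)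
    exact mul_le_mul_left (ENNReal.ofReal_le_ofReal (by linarith [hu.2])) _
  · filter_upwards [ae_restrict_mem measurableSet_Ioo] with u hu using h.nonneg u hu.1

theorem betaFun_le_self {σ : ℝ} (hσ : 0 < σ) : betaFun h σ ≤ σ := by
  rw [← ENNReal.ofReal_le_ofReal_iff hσ.le, h.ofReal_betaFun hσ]
  calc _ ≤ ∫⁻ u in Ioi (0 : ℝ), ENNReal.ofReal σ * ENNReal.ofReal (h.toFun u) := by
        refine setLIntegral_mono' measurableSet_Ioi fun u hu => ?_
        have hu' : (0 : ℝ) < u := hu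
        exact mul_le_mul_left (ENNReal.ofReal_le_ofReal (by linarith)) _
    _ = _ := by
        rw [lintegral_const_mul' _ _ ENNReal.ofReal_ne_top, h.lintegral_eq_one, mul_one]

/-- Pointwise in `u`, the positive parts satisfy `(x - u)₊ ≤ (x / y) (y - u)₊` for `0 < x ≤ y` and
`u > 0`. -/
theorem betaFun_le_div_mul {x y : ℝ} (hx : 0 < x) (hxy : x ≤ y) :
    betaFun h x ≤ x / y * betaFun h y := by
  have hy := hx.trans_le hxy
  have hb := h.betaFun_pos hy
  rw [← ENNReal.ofReal_le_ofReal_iff (by positivity), ENNReal.ofReal_mul (by positivity),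
    h.ofReal_betaFun hx, h.ofReal_betaFun hy, ← lintegral_const_mul' _ _ ENNReal.ofReal_ne_top]
  refine setLIntegral_mono' measurableSet_Ioi fun u hu => ?_
  have hu' : (0 : ℝ) < u := hu
  rw [← mul_assoc]
  refine mul_le_mul_left ?_ _
  rw [← ENNReal.ofReal_mul (by positivity)]
  refine ENNReal.ofReal_le_ofReal ?_
  rw [div_mul_eq_mul_div, le_div_iff₀ hy]
  nlinarith

/-- By Tonelli, `σ` is integrated first. The translation `σ = v + u` takes out the factor `n^(-2u)`
and leaves the integral of the Hardy case; integrating `n^(-2u)` against `h` gives the weight. -/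
theorem lintegral_betaFun_eq {n : ℕ+} (hn : n ≠ 1) :
    ∫⁻ σ in Ioi (0 : ℝ), ENNReal.ofReal (betaFun h σ) * ENNReal.ofReal ((n : ℝ) ^ (-2 * σ)) =
      ENNReal.ofReal ((bergmanWeight h).toFun n / (4 * Real.log n ^ 2)) := by
  have hn0 : (0 : ℝ) < ((n : ℕ) : ℝ) := by exact_mod_cast n.pos
  have hpm : Measurable fun σ : ℝ => ENNReal.ofReal (((n : ℕ) : ℝ) ^ (-2 * σ)) := by
    have : Continuous fun σ : ℝ => ((n : ℕ) : ℝ) ^ (-2 * σ) :=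
      continuous_const.rpow (by fun_prop) fun _ => Or.inl hn0.ne'
    exact this.measurable.ennreal_ofReal
  have hhm : AEMeasurable (fun u => ENNReal.ofReal (h.toFun u)) (volume.restrict (Ioi 0)) :=
    h.integrable.aestronglyMeasurable.aemeasurable.ennreal_ofReal
  have hinner : ∀ u : ℝ, 0 < u → ∫⁻ σ in Ioi (0 : ℝ),
      ENNReal.ofReal (σ - u) * ENNReal.ofReal ((n : ℝ) ^ (-2 * σ)) =
      ENNReal.ofReal ((n : ℝ) ^ (-2 * u)) * ENNReal.ofReal (1 / (4 * Real.log n ^ 2)) := by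
    intro u hu
    rw [← lintegral_mul_rpow hn, ← lintegral_const_mul' _ _ ENNReal.ofReal_ne_top,
      ← lintegral_indicator measurableSet_Ioi, ← lintegral_indicator measurableSet_Ioi,
      ← lintegral_add_right_eq_self (fun σ => (Ioi (0 : ℝ)).indicator (fun σ =>
        ENNReal.ofReal (σ - u) * ENNReal.ofReal (((n : ℕ) : ℝ) ^ (-2 * σ))) σ) u]
    refine lintegral_congr fun v => ?_
    by_cases hv : 0 < v
    · rw [indicator_of_mem (show v + u ∈ Ioi (0 : ℝ) from add_pos hv hu),
        indicator_of_mem (show v ∈ Ioi (0 : ℝ) from hv), add_sub_cancel_right, mul_add,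
        Real.rpow_add hn0, ENNReal.ofReal_mul (by positivity)]
      ring
    · rw [indicator_of_notMem (show v ∉ Ioi (0 : ℝ) from hv)]
      simp only [indicator]
      split_ifs
      · rw [add_sub_cancel_right, ENNReal.ofReal_of_nonpos (not_lt.1 hv), zero_mul]
      · rfl
  have hw : ENNReal.ofReal ((bergmanWeight h).toFun n) = ∫⁻ u in Ioi (0 : ℝ),
      ENNReal.ofReal ((n : ℝ) ^ (-2 * u)) * ENNReal.ofReal (h.toFun u) := by
    refine (ofReal_integral_eq_lintegral_ofReal (integrableOn_bergmanWeight h n) ?_).trans ?_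
    · filter_upwards [ae_restrict_mem measurableSet_Ioi] with u hu
      exact mul_nonneg (by positivity) (h.nonneg u hu)
    · exact lintegral_congr fun u => ENNReal.ofReal_mul (by positivity)
  calc ∫⁻ σ in Ioi (0 : ℝ), ENNReal.ofReal (betaFun h σ) * ENNReal.ofReal ((n : ℝ) ^ (-2 * σ))
      = ∫⁻ σ in Ioi (0 : ℝ), ∫⁻ u in Ioi (0 : ℝ), ENNReal.ofReal (σ - u) *
          ENNReal.ofReal (h.toFun u) * ENNReal.ofReal ((n : ℝ) ^ (-2 * σ)) := by
        refine setLIntegral_congr_fun measurableSet_Ioi fun σ hσ => ?_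
        rw [h.ofReal_betaFun hσ, lintegral_mul_const' _ _ ENNReal.ofReal_ne_top]
    _ = ∫⁻ u in Ioi (0 : ℝ), ∫⁻ σ in Ioi (0 : ℝ), ENNReal.ofReal (σ - u) *
          ENNReal.ofReal (h.toFun u) * ENNReal.ofReal ((n : ℝ) ^ (-2 * σ)) := by
        refine lintegral_lintegral_swap (f := fun σ u => ENNReal.ofReal (σ - u) *
          ENNReal.ofReal (h.toFun u) * ENNReal.ofReal ((n : ℝ) ^ (-2 * σ))) ?_
        have h1 : Measurable fun p : ℝ × ℝ => ENNReal.ofReal (p.1 - p.2) :=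
          (measurable_fst.sub measurable_snd).ennreal_ofReal
        have h2 : AEMeasurable (fun p : ℝ × ℝ => ENNReal.ofReal (h.toFun p.2))
            ((volume.restrict (Ioi (0 : ℝ))).prod (volume.restrict (Ioi (0 : ℝ)))) := hhm.comp_snd
        exact (h1.aemeasurable.mul h2).mul (hpm.comp measurable_fst).aemeasurable
    _ = ∫⁻ u in Ioi (0 : ℝ), ENNReal.ofReal ((n : ℝ) ^ (-2 * u)) * ENNReal.ofReal (h.toFun u) *
          ENNReal.ofReal (1 / (4 * Real.log n ^ 2)) := by
        refine setLIntegral_congr_fun measurableSet_Ioi fun u hu => ?_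
        rw [mul_right_comm, ← hinner u hu, ← lintegral_mul_const' _ _ ENNReal.ofReal_ne_top]
        exact lintegral_congr fun σ => mul_right_comm _ _ _
    _ = _ := by
        rw [lintegral_mul_const' _ _ ENNReal.ofReal_ne_top, ← hw,
          ← ENNReal.ofReal_mul ((bergmanWeight h).pos n).le, mul_one_div]

theorem isLittlewoodPaley : IsLittlewoodPaley (betaFun h) (bergmanWeight h) where
  pos _ hσ := h.betaFun_pos hσ
  le_self _ hσ := h.betaFun_le_self hσ
  le_div_mul _ _ hx hxy := h.betaFun_le_div_mul hx hxy
  lintegral_eq _ hn := h.lintegral_betaFun_eq hn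

end BergmanDensity

/-! ### Monotonicity, lower bounds and tails of Littlewood–Paley weights -/

namespace IsLittlewoodPaley

variable {β : ℝ → ℝ} {w : Weight}

theorem le_of_le (hβ : IsLittlewoodPaley β w) {x y : ℝ} (hx : 0 < x) (hxy : x ≤ y) :
    β x ≤ β y := by
  have hy := hx.trans_le hxy
  exact (hβ.le_div_mul x y hx hxy).trans
    (mul_le_of_le_one_left (hβ.pos y hy).le ((div_le_one hy).2 hxy))

/-- Nothing is known of `β` on the negative axis. Replaced by `0` there, it is monotone on the whole
line, hence measurable. -/
theorem measurable_indicator (hβ : IsLittlewoodPaley β w) :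
    Measurable ((Ioi (0 : ℝ)).indicator β) := by
  refine Monotone.measurable fun x y hxy => ?_
  by_cases hx : 0 < x
  · rw [indicator_of_mem (show x ∈ Ioi (0 : ℝ) from hx),
      indicator_of_mem (show y ∈ Ioi (0 : ℝ) from hx.trans_le hxy)]
    exact hβ.le_of_le hx hxy
  · rw [indicator_of_notMem (show x ∉ Ioi (0 : ℝ) from hx)]
    exact indicator_nonneg (fun y hy => (hβ.pos y hy).le) y

/-- The integral is restricted to `(θ/4, θ/2)`, of length `θ/4`, where `β ≥ β(θ/4)` and `n^(-2σ) ≥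
n^(-θ)`. -/
theorem exists_le_weight (hβ : IsLittlewoodPaley β w) {θ : ℝ} (hθ : 0 < θ) :
    ∃ k : ℝ, 0 < k ∧ ∀ n : ℕ+, n ≠ 1 →
      k * (n : ℝ) ^ (-θ) ≤ w.toFun n / (4 * Real.log n ^ 2) := by
  have hb := hβ.pos (θ / 4) (by positivity)
  refine ⟨θ / 4 * β (θ / 4), by positivity, fun n hn => ?_⟩
  have hn1 := one_lt_cast_of_ne_one hn
  have hw := w.pos n
  rw [← ENNReal.ofReal_le_ofReal_iff (by positivity), ← hβ.lintegral_eq n hn]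
  have hsub : Ioo (θ / 4) (θ / 2) ⊆ Ioi (0 : ℝ) := fun x hx => lt_trans (by positivity) hx.1
  refine le_trans ?_ (lintegral_mono_set hsub)
  calc ENNReal.ofReal (θ / 4 * β (θ / 4) * (n : ℝ) ^ (-θ))
      = ∫⁻ _ in Ioo (θ / 4) (θ / 2), ENNReal.ofReal (β (θ / 4) * (n : ℝ) ^ (-θ)) := by
        rw [setLIntegral_const, Real.volume_Ioo, ← ENNReal.ofReal_mul (by positivity)]
        congr 1
        ring
    _ ≤ _ := by
        refine setLIntegral_mono' measurableSet_Ioo fun σ hσ => ?_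
        rw [ENNReal.ofReal_mul hb.le]
        refine mul_le_mul' (ENNReal.ofReal_le_ofReal (hβ.le_of_le (by positivity) hσ.1.le))
          (ENNReal.ofReal_le_ofReal (Real.rpow_le_rpow_of_exponent_le hn1.le ?_))
        linarith [hσ.2]

/-- The part of the Littlewood–Paley integral away from the boundary is negligible for large
`n`. -/
theorem eventually_tail_le (hβ : IsLittlewoodPaley β w) {θ ε : ℝ} (hθ : 0 < θ) (hε : 0 < ε) :
    ∃ m : ℕ+, ∀ n : ℕ+, m < n → ∫⁻ σ in Ici θ, ENNReal.ofReal (β σ) *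
      ENNReal.ofReal ((n : ℝ) ^ (-2 * σ)) ≤
        ENNReal.ofReal (ε * (w.toFun n / (4 * Real.log n ^ 2))) := by
  obtain ⟨k, hk, hkw⟩ := hβ.exists_le_weight hθ
  -- For `σ ≥ θ` and `n ≥ 2`, `n^(-2σ) ≤ n^(-3θ/2) 2^(-σ/2)`, and `2^(-σ/2) = exp(-rσ)`. The tail is
  -- thus `O(n^(-3θ/2))`, which is small compared with the lower bound `k n^(-θ)`.
  set r := Real.log 2 / 2 with hr
  have hr0 : 0 < r := by
    have := Real.log_pos one_lt_two
    positivity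
  have hlim : Tendsto (fun n : ℕ => 1 / r ^ 2 * (n : ℝ) ^ (-(θ / 2))) atTop (𝓝 0) := by
    have := ((tendsto_rpow_neg_atTop (half_pos hθ)).comp
      tendsto_natCast_atTop_atTop).const_mul (1 / r ^ 2)
    simpa using this
  obtain ⟨m, hm⟩ := eventually_atTop.1 (hlim.eventually_le_const (mul_pos hε hk))
  refine ⟨m.succPNat, fun n hn => ?_⟩
  have hn1 : n ≠ 1 := by
    rintro rfl
    exact absurd hn (not_lt.2 one_le)
  have hn0 : (0 : ℝ) < ((n : ℕ) : ℝ) := by exact_mod_cast n.pos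
  have hn2 : (2 : ℝ) ≤ ((n : ℕ) : ℝ) := by
    exact_mod_cast (lt_of_le_of_ne one_le hn1.symm : 1 < n)
  have hmn : m ≤ (n : ℕ) := by
    have h1 : (m.succPNat : ℕ) < n := hn
    rw [Nat.succPNat_coe] at h1
    omega
  have hsub : Ici θ ⊆ Ioi (0 : ℝ) := fun x hx => lt_of_lt_of_le hθ hx
  calc ∫⁻ σ in Ici θ, ENNReal.ofReal (β σ) * ENNReal.ofReal ((n : ℝ) ^ (-2 * σ))
      ≤ ∫⁻ σ in Ici θ, ENNReal.ofReal ((n : ℝ) ^ (-(3 * θ / 2))) *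
          (ENNReal.ofReal σ * ENNReal.ofReal (Real.exp (-(r * σ)))) := by
        refine setLIntegral_mono' measurableSet_Ici fun σ hσ => ?_
        have hσ' : θ ≤ σ := hσ
        have hσ0 : 0 < σ := lt_of_lt_of_le hθ hσ
        rw [mul_left_comm]
        refine mul_le_mul' (ENNReal.ofReal_le_ofReal (hβ.le_self σ hσ0)) ?_
        rw [← ENNReal.ofReal_mul (by positivity)]
        refine ENNReal.ofReal_le_ofReal ?_
        have h1 : Real.exp (-(r * σ)) = (2 : ℝ) ^ (-(σ / 2)) := by
          rw [Real.rpow_def_of_pos two_pos, hr]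
          congr 1
          ring
        have h2 : ((n : ℕ) : ℝ) ^ (-(σ / 2)) ≤ (2 : ℝ) ^ (-(σ / 2)) :=
          Real.rpow_le_rpow_of_nonpos two_pos hn2 (by linarith)
        rw [h1]
        refine le_trans ?_ (mul_le_mul_of_nonneg_left h2 (by positivity))
        rw [← Real.rpow_add hn0]
        exact Real.rpow_le_rpow_of_exponent_le (by linarith) (by linarith)
    _ ≤ ENNReal.ofReal ((n : ℝ) ^ (-(3 * θ / 2))) * ENNReal.ofReal (1 / r ^ 2) := by
        rw [lintegral_const_mul' _ _ ENNReal.ofReal_ne_top, ← lintegral_mul_exp_neg hr0]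
        exact mul_le_mul_right (lintegral_mono_set hsub) _
    _ ≤ _ := by
        rw [← ENNReal.ofReal_mul (by positivity)]
        refine ENNReal.ofReal_le_ofReal ?_
        have h1 := mul_le_mul_of_nonneg_right (hm n hmn)
          (Real.rpow_nonneg hn0.le (-θ))
        have h2 : (n : ℝ) ^ (-(3 * θ / 2)) * (1 / r ^ 2) =
            1 / r ^ 2 * (n : ℝ) ^ (-(θ / 2)) * (n : ℝ) ^ (-θ) := by
          rw [mul_assoc, ← Real.rpow_add hn0, mul_comm]
          congr 2
          ring
        rw [h2]
        refine h1.trans ?_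
        rw [mul_assoc]
        exact mul_le_mul_of_nonneg_left (hkw n hn1) hε.le

end IsLittlewoodPaley

/-! ### Bounds for counting functions -/

/-- The sum over the fibre is the supremum of its finite subsums, each controlled by Littlewood's
inequality. -/
theorem nevanlinna_id_le {Φ : ℂ → ℂ} {c C : ℝ} (hc : 0 < c)
    (hΦ : DifferentiableOn ℂ Φ (halfPlane 0)) (hmaps : MapsTo Φ (halfPlane 0) (halfPlane 0))
    (h : ∀ᶠ x : ℝ in atTop, ‖Φ x - c * x‖ ≤ C) {s : ℂ} (hs : 0 < s.re) :
    nevanlinna (fun σ => σ) Φ s ≤ ENNReal.ofReal (s.re / c) := by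
  rw [nevanlinna, ENNReal.tsum_eq_iSup_sum]
  refine iSup_le fun F => ?_
  rw [← ENNReal.ofReal_sum_of_nonneg fun a _ => le_of_lt a.2.1]
  refine ENNReal.ofReal_le_ofReal ?_
  have h1 := sum_re_le_of_selfMap hc hΦ hmaps h hs (F.map (Function.Embedding.subtype _))
    fun a ha => by
      obtain ⟨b, _, rfl⟩ := Finset.mem_map.1 ha
      exact b.2
  rwa [Finset.sum_map] at h1

/-- Littlewood's inequality for a single preimage gives `Re a ≤ Re s / c ≤ Re s`; this is where `c ≥
1` matters. Then `β(Re a) ≤ (β(Re s) / Re s) Re a`, and the sum reduces to the case `β(σ) = σ`. -/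
theorem IsLittlewoodPaley.nevanlinna_le {β : ℝ → ℝ} {w : Weight} (hβ : IsLittlewoodPaley β w)
    {Φ : ℂ → ℂ} {c C : ℝ} (hc : 1 ≤ c)
    (hΦ : DifferentiableOn ℂ Φ (halfPlane 0)) (hmaps : MapsTo Φ (halfPlane 0) (halfPlane 0))
    (h : ∀ᶠ x : ℝ in atTop, ‖Φ x - c * x‖ ≤ C) {s : ℂ} (hs : 0 < s.re) :
    nevanlinna β Φ s ≤ ENNReal.ofReal (1 / c) * ENNReal.ofReal (β s.re) := by
  have hc0 : 0 < c := one_pos.trans_le hc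
  have hb := hβ.pos s.re hs
  have h1 : ∀ a : {a : ℂ // a ∈ halfPlane 0 ∧ Φ a = s},
      ENNReal.ofReal (β a.1.re) ≤ ENNReal.ofReal (β s.re / s.re) * ENNReal.ofReal a.1.re := by
    intro a
    have ha : 0 < a.1.re := a.2.1
    have h2 := sum_re_le_of_selfMap hc0 hΦ hmaps h hs {a.1} fun b hb => by
      rw [Finset.mem_singleton.1 hb]
      exact a.2
    rw [Finset.sum_singleton] at h2
    have h3 : a.1.re ≤ s.re := h2.trans (div_le_self hs.le hc)
    rw [← ENNReal.ofReal_mul (by positivity)]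
    refine ENNReal.ofReal_le_ofReal ((hβ.le_div_mul _ _ ha h3).trans_eq ?_)
    ring
  calc nevanlinna β Φ s ≤ ∑' a : {a : ℂ // a ∈ halfPlane 0 ∧ Φ a = s},
        ENNReal.ofReal (β s.re / s.re) * ENNReal.ofReal a.1.re := ENNReal.tsum_le_tsum h1
    _ = ENNReal.ofReal (β s.re / s.re) * nevanlinna (fun σ => σ) Φ s := ENNReal.tsum_mul_left
    _ ≤ ENNReal.ofReal (β s.re / s.re) * ENNReal.ofReal (s.re / c) :=
        mul_le_mul_right (nevanlinna_id_le hc0 hΦ hmaps h hs) _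
    _ = _ := by
        rw [← ENNReal.ofReal_mul (by positivity), ← ENNReal.ofReal_mul (by positivity)]
        congr 1
        field_simp

theorem exists_nevanlinna_le_of_limsup_lt {β : ℝ → ℝ} {Φ : ℂ → ℂ} {l : ℝ≥0∞}
    (hβ : ∀ σ, 0 < σ → 0 < β σ) (h : nevanlinnaLimsup β Φ < l) :
    ∃ θ : ℝ, 0 < θ ∧ ∀ s : ℂ, 0 < s.re → s.re < θ →
      nevanlinna β Φ s ≤ l * ENNReal.ofReal (β s.re) := by
  have h1 := eventually_lt_of_limsup_lt h
  rw [eventually_comap] at h1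
  obtain ⟨θ, hθ, hsub⟩ := mem_nhdsGT_iff_exists_Ioo_subset.1 h1
  refine ⟨θ, hθ, fun s hs hsθ => ?_⟩
  have h2 := hsub ⟨hs, hsθ⟩ s rfl
  rw [← ENNReal.div_le_iff (ENNReal.ofReal_pos.2 (hβ _ hs)).ne' ENNReal.ofReal_ne_top]
  exact h2.le

theorem nevanlinnaLimsup_le {β : ℝ → ℝ} {Φ : ℂ → ℂ} {l : ℝ≥0∞}
    (hβ : ∀ σ, 0 < σ → 0 < β σ)
    (h : ∀ s : ℂ, 0 < s.re → nevanlinna β Φ s ≤ l * ENNReal.ofReal (β s.re)) :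
    nevanlinnaLimsup β Φ ≤ l := by
  refine limsup_le_of_le (by isBoundedDefault) ?_
  rw [eventually_comap]
  filter_upwards [self_mem_nhdsWithin] with x hx s hs
  subst hs
  rw [ENNReal.div_le_iff (ENNReal.ofReal_pos.2 (hβ _ hx)).ne' ENNReal.ofReal_ne_top]
  exact h s hx

end DirichletComposition

namespace DirichletComposition

/-! ### Coefficient estimates for `f ∘ Φ` -/

/-- An analytic self-map `Φ` of the right half-plane which behaves like `c * s` at `+∞` and whose
imaginary part differs from that of `c * s` by at most `M`. -/
structure IsTameSelfMap (Φ : ℂ → ℂ) (c M C : ℝ) : Prop where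
  one_le : 1 ≤ c
  differentiableOn : DifferentiableOn ℂ Φ (halfPlane 0)
  mapsTo : MapsTo Φ (halfPlane 0) (halfPlane 0)
  im_le : ∀ s ∈ halfPlane 0, |(Φ s).im - c * s.im| ≤ M
  growth : ∀ᶠ x : ℝ in atTop, ‖Φ x - c * x‖ ≤ C

/-! ### Behaviour at `+∞` and the constant coefficient -/

namespace IsTameSelfMap

variable {Φ : ℂ → ℂ} {c M C : ℝ}

theorem pos (hΦ : IsTameSelfMap Φ c M C) : 0 < c := one_pos.trans_le hΦ.one_le

theorem nonneg (hΦ : IsTameSelfMap Φ c M C) : 0 ≤ M :=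
  (abs_nonneg _).trans (hΦ.im_le 1 (by simp [halfPlane]))

theorem tendsto_re (hΦ : IsTameSelfMap Φ c M C) :
    Tendsto (fun x : ℝ => (Φ x).re) atTop atTop := by
  have h1 : Tendsto (fun x : ℝ => c * x - C) atTop atTop :=
    tendsto_atTop_add_const_right _ _ (tendsto_id.const_mul_atTop hΦ.pos)
  refine tendsto_atTop_mono' _ ?_ h1
  filter_upwards [hΦ.growth] with x hx
  have h2 := (abs_le.1 ((Complex.abs_re_le_norm _).trans hx)).1
  have h3 : (Φ x - c * x).re = (Φ x).re - c * x := by simp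
  linarith

/-- Composition with `Φ` does not change the constant coefficient. -/
theorem coeff_one_comp (hΦ : IsTameSelfMap Φ c M C) {S : Finset ℕ+} {a : ℕ+ → ℂ} {b : ℕ → ℂ}
    (hb : ∀ s : ℂ, 1 / 2 < s.re → LSeriesSummable b s ∧ dirichletSum S a (Φ s) = LSeries b s) :
    b 1 = if 1 ∈ S then a 1 else 0 := by
  have h1 : Tendsto (fun x : ℝ => LSeries b x) atTop (𝓝 (b 1)) := by
    refine LSeries.tendsto_atTop (lt_of_le_of_lt
      (hb (1 : ℂ) (by norm_num)).1.abscissaOfAbsConv_le ?_)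
    exact EReal.coe_lt_top _
  have h2 : ∀ n ∈ S, Tendsto (fun x : ℝ => a n * ((n : ℕ) : ℂ) ^ (-Φ x)) atTop
      (𝓝 (if n = 1 then a 1 else 0)) := by
    intro n _
    by_cases hn : n = 1
    · subst hn
      simp
    · rw [if_neg hn, ← mul_zero (a n)]
      refine Tendsto.const_mul _ ?_
      rw [tendsto_zero_iff_norm_tendsto_zero]
      have h3 := (tendsto_rpow_atBot_of_base_gt_one _ (one_lt_cast_of_ne_one hn)).comp
        (tendsto_neg_atTop_atBot.comp hΦ.tendsto_re)
      refine h3.congr fun x => ?_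
      rw [Complex.norm_natCast_cpow_of_pos n.pos]
      rfl
  have h4 := tendsto_finsetSum S h2
  rw [Finset.sum_ite_eq' S 1 fun _ => a 1] at h4
  refine tendsto_nhds_unique h1 (h4.congr' ?_)
  filter_upwards [eventually_gt_atTop (1 / 2 : ℝ)] with x hx
  exact (hb x (by simpa using hx)).2

end IsTameSelfMap

/-! ### Coefficient inequalities on Dirichlet polynomials -/

namespace IsLittlewoodPaley

variable {β : ℝ → ℝ} {w : Weight} {Φ : ℂ → ℂ} {c M C : ℝ}

theorem setLIntegral_indicator (hβ : IsLittlewoodPaley β w) {n : ℕ+} (hn : n ≠ 1) :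
    ∫⁻ σ in Ioi (0 : ℝ), ENNReal.ofReal ((Ioi (0 : ℝ)).indicator β σ) *
      ENNReal.ofReal ((n : ℝ) ^ (-2 * σ)) =
      ENNReal.ofReal (w.toFun n / (4 * Real.log n ^ 2)) := by
  rw [← hβ.lintegral_eq n hn]
  exact setLIntegral_congr_fun measurableSet_Ioi fun σ hσ => by rw [indicator_of_mem hσ]

/-- The general comparison with the constant term put back: composition preserves it, and the
derivative does not see it. The domination of `κ` by `K β` only makes the error integral finite, so
`K` does not enter the conclusion. -/
theorem sum_coeff_comp_le (hβ : IsLittlewoodPaley β w) (hΦ : IsTameSelfMap Φ c M C)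
    {κ : ℝ → ℝ≥0∞} (hκ : Measurable κ) {K : ℝ≥0∞} (hK : K ≠ ∞)
    (hκK : ∀ σ, 0 < σ → κ σ ≤ K * ENNReal.ofReal (β σ))
    (hN : ∀ s : ℂ, 0 < s.re → nevanlinna β Φ s ≤ κ s.re)
    (S : Finset ℕ+) (a : ℕ+ → ℂ) {D : ℝ} (hD : 0 ≤ D)
    (hκw : ∀ n ∈ S.erase 1, ∫⁻ σ in Ioi (0 : ℝ), κ σ * ENNReal.ofReal ((n : ℝ) ^ (-2 * σ)) ≤
      ENNReal.ofReal (D * (w.toFun n / (4 * Real.log n ^ 2))))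
    {b : ℕ → ℂ} (hb : ∀ s : ℂ, 1 / 2 < s.re → LSeriesSummable b s ∧
      dirichletSum S a (Φ s) = LSeries b s) (S' : Finset ℕ+) :
    ∑ n ∈ S', ‖b n‖ ^ 2 * w.toFun n ≤
      ‖if 1 ∈ S then a 1 else 0‖ ^ 2 * w.toFun 1 +
        c * D * ∑ n ∈ S.erase 1, ‖a n‖ ^ 2 * w.toFun n := by
  have htwo : (2 : ℕ+) ≠ 1 := by decide
  -- Since `4^(-σ) = 2^(-2σ)`, this is bounded by the Littlewood–Paley integral for `n = 2`.
  have hJ : ∫⁻ σ in Ioi (0 : ℝ), κ σ * ENNReal.ofReal ((4 : ℝ) ^ (-σ)) ≤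
      K * ENNReal.ofReal (w.toFun 2 / (4 * Real.log (2 : ℕ+) ^ 2)) := by
    rw [← hβ.lintegral_eq 2 htwo, ← lintegral_const_mul' _ _ hK]
    refine setLIntegral_mono' measurableSet_Ioi fun σ hσ => ?_
    rw [← mul_assoc]
    refine mul_le_mul' (hκK σ hσ) (le_of_eq ?_)
    congr 1
    have h4 : (4 : ℝ) = 2 ^ (2 : ℝ) := by norm_num
    rw [h4, ← Real.rpow_mul two_pos.le]
    norm_num
  have hJtop := ENNReal.mul_ne_top hK (ENNReal.ofReal_ne_top
    (r := w.toFun 2 / (4 * Real.log (2 : ℕ+) ^ 2)))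
  rw [← ENNReal.ofReal_toReal hJtop] at hJ
  have hmain := DirichletComposition.sum_coeff_comp_le hΦ.pos hΦ.nonneg hΦ.differentiableOn
    hΦ.mapsTo hΦ.im_le (B := fun σ => ENNReal.ofReal ((Ioi (0 : ℝ)).indicator β σ))
    hβ.measurable_indicator.ennreal_ofReal (fun _ _ => ENNReal.ofReal_ne_top) hκ
    (fun s hs => by
      refine le_trans (le_of_eq ?_) (hN s hs)
      exact tsum_congr fun z => by rw [indicator_of_mem (show z.1.re ∈ Ioi (0 : ℝ) from z.2.1)])
    (fun n => (w.pos n).le) (fun n hn => hβ.setLIntegral_indicator hn) S a hD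
    ENNReal.toReal_nonneg hκw hJ hb (S'.erase 1) (Finset.notMem_erase _ _)
  have h1 : ∑ n ∈ S', ‖b n‖ ^ 2 * w.toFun n ≤
      ‖b 1‖ ^ 2 * w.toFun 1 + ∑ n ∈ S'.erase 1, ‖b n‖ ^ 2 * w.toFun n := by
    have h2 := Finset.sum_insert (f := fun n : ℕ+ => ‖b n‖ ^ 2 * w.toFun n)
      (Finset.notMem_erase 1 S')
    rw [PNat.one_coe] at h2
    rw [← h2]
    exact Finset.sum_le_sum_of_subset_of_nonneg (Finset.subset_insert_iff.2 subset_rfl)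
      fun n _ _ => mul_nonneg (sq_nonneg _) (w.pos n).le
  rw [hΦ.coeff_one_comp hb] at h1
  linarith

/-- Composition with `Φ` is a contraction on Dirichlet polynomials. -/
theorem sum_coeff_comp_le_sum (hβ : IsLittlewoodPaley β w) (hΦ : IsTameSelfMap Φ c M C)
    (S : Finset ℕ+) (a : ℕ+ → ℂ) {b : ℕ → ℂ} (hb : ∀ s : ℂ, 1 / 2 < s.re → LSeriesSummable b s ∧
      dirichletSum S a (Φ s) = LSeries b s) (S' : Finset ℕ+) :
    ∑ n ∈ S', ‖b n‖ ^ 2 * w.toFun n ≤ ∑ n ∈ S, ‖a n‖ ^ 2 * w.toFun n := by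
  have hc := hΦ.pos
  -- The global bound `N ≤ β / c` allows `D = 1 / c`, which cancels the dilation factor `c`.
  have h1 := hβ.sum_coeff_comp_le hΦ
    (κ := fun σ => ENNReal.ofReal (1 / c) * ENNReal.ofReal ((Ioi (0 : ℝ)).indicator β σ))
    (hβ.measurable_indicator.ennreal_ofReal.const_mul _) (K := ENNReal.ofReal (1 / c))
    ENNReal.ofReal_ne_top
    (fun σ hσ => by rw [indicator_of_mem (show σ ∈ Ioi (0 : ℝ) from hσ)])
    (fun s hs => by
      rw [indicator_of_mem (show s.re ∈ Ioi (0 : ℝ) from hs)]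
      exact hβ.nevanlinna_le hΦ.one_le hΦ.differentiableOn hΦ.mapsTo hΦ.growth hs)
    S a (D := 1 / c) (by positivity)
    (fun n hn => by
      simp_rw [mul_assoc]
      rw [lintegral_const_mul' _ _ ENNReal.ofReal_ne_top,
        hβ.setLIntegral_indicator (Finset.mem_erase.1 hn).1, ← ENNReal.ofReal_mul (by positivity)])
    hb S'
  refine h1.trans (le_of_eq ?_)
  rw [mul_one_div_cancel hc.ne', one_mul]
  by_cases h : (1 : ℕ+) ∈ S
  · rw [if_pos h]
    exact Finset.add_sum_erase S (fun n => ‖a n‖ ^ 2 * w.toFun n) h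
  · rw [if_neg h, Finset.erase_eq_of_notMem h]
    simp

/-- For polynomials with only high frequencies, the contraction constant improves to the upper
limit of the counting function. -/
theorem exists_sum_coeff_comp_le (hβ : IsLittlewoodPaley β w) (hΦ : IsTameSelfMap Φ c M C)
    {l ε : ℝ} (hl : 0 ≤ l) (hε : 0 < ε) (hL : nevanlinnaLimsup β Φ < ENNReal.ofReal l) :
    ∃ m : ℕ+, ∀ (S : Finset ℕ+) (a : ℕ+ → ℂ) (b : ℕ → ℂ), (∀ n ∈ S, m < n) →
      (∀ s : ℂ, 1 / 2 < s.re → LSeriesSummable b s ∧ dirichletSum S a (Φ s) = LSeries b s) →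
      ∀ S' : Finset ℕ+, ∑ n ∈ S', ‖b n‖ ^ 2 * w.toFun n ≤
        (c * l + ε) * ∑ n ∈ S, ‖a n‖ ^ 2 * w.toFun n := by
  have hc := hΦ.pos
  obtain ⟨θ, hθ, hθN⟩ := exists_nevanlinna_le_of_limsup_lt hβ.pos hL
  obtain ⟨m, hm⟩ := hβ.eventually_tail_le hθ (ε := ε / c) (by positivity)
  refine ⟨m, fun S a b hS hb S' => ?_⟩
  set B : ℝ → ℝ≥0∞ := fun σ => ENNReal.ofReal ((Ioi (0 : ℝ)).indicator β σ) with hB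
  have hBm : Measurable B := hβ.measurable_indicator.ennreal_ofReal
  have hBval : ∀ σ, 0 < σ → B σ = ENNReal.ofReal (β σ) := fun σ hσ => by
    rw [hB]
    simp only
    rw [indicator_of_mem (show σ ∈ Ioi (0 : ℝ) from hσ)]
  have hS1 : (1 : ℕ+) ∉ S := fun h => absurd (hS 1 h) (not_lt.2 one_le)
  -- The majorant is `l β` near the boundary, with an extra `β` on `Re ≥ θ` where only Littlewood's
  -- bound is available. For frequencies above `m` the extra part costs at most `ε / c`, hence `D =
  -- l + ε / c`.
  have h1 := hβ.sum_coeff_comp_le hΦ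
    (κ := fun σ => ENNReal.ofReal l * B σ + (Ici θ).indicator B σ)
    ((hBm.const_mul _).add (hBm.indicator measurableSet_Ici)) (K := ENNReal.ofReal l + 1)
    (ENNReal.add_ne_top.2 ⟨ENNReal.ofReal_ne_top, ENNReal.one_ne_top⟩)
    (fun σ hσ => by
      rw [add_mul, one_mul, ← hBval σ hσ]
      exact add_le_add_right (indicator_le_self _ _ _) _)
    (fun s hs => by
      by_cases h : s.re < θ
      · rw [hBval _ hs]
        exact (hθN s hs h).trans le_self_add
      · rw [indicator_of_mem (show s.re ∈ Ici θ from not_lt.1 h), hBval _ hs]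
        refine (hβ.nevanlinna_le hΦ.one_le hΦ.differentiableOn hΦ.mapsTo hΦ.growth hs).trans
          (le_trans ?_ le_add_self)
        refine mul_le_of_le_one_left' ?_
        rw [ENNReal.ofReal_le_one]
        exact (div_le_one hc).2 hΦ.one_le)
    S a (D := l + ε / c) (by positivity)
    (fun n hn => by
      obtain ⟨hn1, hnS⟩ := Finset.mem_erase.1 hn
      have hw := (w.pos n).le
      have hind : ∀ σ : ℝ, (Ici θ).indicator B σ * ENNReal.ofReal ((n : ℝ) ^ (-2 * σ)) =
          (Ici θ).indicator (fun σ => B σ * ENNReal.ofReal ((n : ℝ) ^ (-2 * σ))) σ := fun σ => by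
        by_cases h : σ ∈ Ici θ
        · rw [indicator_of_mem h, indicator_of_mem h]
        · rw [indicator_of_notMem h, indicator_of_notMem h, zero_mul]
      have hpm : Measurable fun σ : ℝ => ENNReal.ofReal (((n : ℕ) : ℝ) ^ (-2 * σ)) := by
        have : Continuous fun σ : ℝ => ((n : ℕ) : ℝ) ^ (-2 * σ) :=
          continuous_const.rpow (by fun_prop)
            fun _ => Or.inl (by exact_mod_cast n.pos.ne' : ((n : ℕ) : ℝ) ≠ 0)
        exact this.measurable.ennreal_ofReal
      have hBp : Measurable fun σ : ℝ => ENNReal.ofReal l *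
          (B σ * ENNReal.ofReal (((n : ℕ) : ℝ) ^ (-2 * σ))) := (hBm.mul hpm).const_mul _
      simp_rw [add_mul, hind, mul_assoc]
      rw [lintegral_add_left hBp,
        lintegral_const_mul' _ _ ENNReal.ofReal_ne_top, hβ.setLIntegral_indicator hn1,
        ENNReal.ofReal_add (by positivity) (by positivity), ENNReal.ofReal_mul hl]
      refine add_le_add_right ?_ _
      rw [lintegral_indicator measurableSet_Ici, Measure.restrict_restrict measurableSet_Ici,
        inter_eq_left.2 (Ici_subset_Ioi.2 hθ)]
      refine le_trans (le_of_eq ?_) (hm n (hS n hnS))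
      exact setLIntegral_congr_fun measurableSet_Ici fun σ hσ => by
        rw [hBval σ (lt_of_lt_of_le hθ hσ)])
    hb S'
  rw [if_neg hS1, Finset.erase_eq_of_notMem hS1] at h1
  refine h1.trans (le_of_eq ?_)
  have h2 : c * (l + ε / c) = c * l + ε := by field_simp
  rw [h2]
  simp

end IsLittlewoodPaley

/-! ### Essential norms on Dirichlet spaces -/

theorem DirichletSpace.ext {w : Weight} {f g : DirichletSpace w}
    (h : ∀ n, f.coeff n = g.coeff n) : f = g := Subtype.ext (funext h)

/-- The coefficient functional `f ↦ a n`. -/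
noncomputable def coeffCLM (w : Weight) (n : ℕ+) : DirichletSpace w →L[ℂ] ℂ :=
  LinearMap.mkContinuous
    { toFun := fun f => f.coeff n
      map_add' := fun f g => f.coeff_add g n
      map_smul' := fun c f => f.coeff_smul c n } (Real.sqrt (w.toFun n))⁻¹
    fun f => (f.norm_coeff_le n).trans_eq (div_eq_inv_mul _ _)

theorem coeffCLM_apply (w : Weight) (n : ℕ+) (f : DirichletSpace w) :
    coeffCLM w n f = f.coeff n := rfl

/-- The operator keeping only the coefficients with index in `F`. -/
noncomputable def truncation (w : Weight) (F : Finset ℕ+) : DirichletSpace w →L[ℂ] DirichletSpace w :=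
  ∑ n ∈ F, (coeffCLM w n).smulRight (polynomial w {n} 1)

theorem coeff_truncation (w : Weight) (F : Finset ℕ+) (f : DirichletSpace w) (k : ℕ+) :
    (truncation w F f).coeff k = if k ∈ F then f.coeff k else 0 := by
  rw [← coeffCLM_apply, truncation, sum_apply, map_sum]
  have h : ∀ n ∈ F, coeffCLM w k ((coeffCLM w n).smulRight (polynomial w {n} 1) f) =
      if k = n then f.coeff k else 0 := by
    intro n _
    rw [ContinuousLinearMap.smulRight_apply, map_smul, coeffCLM_apply, coeffCLM_apply,
      coeff_polynomial]
    by_cases h : k = n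
    · simp [h]
    · simp [h]
  rw [Finset.sum_congr rfl h, Finset.sum_ite_eq]

theorem isCompactOperator_truncation (w : Weight) (F : Finset ℕ+) :
    IsCompactOperator (truncation w F) := by
  classical
  rw [truncation]
  induction F using Finset.induction_on with
  | empty => exact isCompactOperator_zero
  | insert n F hn ih =>
    rw [Finset.sum_insert hn]
    refine IsCompactOperator.add ?_ ih
    exact (isCompactOperator_of_locallyCompactSpace_dom (coeffCLM w n)).clm_comp
      ((ContinuousLinearMap.id ℂ ℂ).smulRight (polynomial w {n} 1))

theorem DirichletSpace.norm_sq_le_of_sum_le {w : Weight} {f : DirichletSpace w} {E : ℝ}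
    (h : ∀ S : Finset ℕ+, ∑ n ∈ S, ‖f.coeff n‖ ^ 2 * w.toFun n ≤ E) : ‖f‖ ^ 2 ≤ E := by
  rw [f.norm_sq]
  exact f.summable.tsum_le_of_sum_le h

theorem essNorm_nonneg {E : Type*} [NormedAddCommGroup E] [NormedSpace ℂ E] (T : E →L[ℂ] E) :
    0 ≤ essNorm T := by
  refine Real.sInf_nonneg ?_
  rintro r ⟨K, _, rfl⟩
  exact norm_nonneg _

theorem essNorm_le {E : Type*} [NormedAddCommGroup E] [NormedSpace ℂ E] (T : E →L[ℂ] E)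
    {K : E →L[ℂ] E} (hK : IsCompactOperator K) : essNorm T ≤ ‖T - K‖ := by
  refine csInf_le ⟨0, ?_⟩ ⟨K, hK, rfl⟩
  rintro r ⟨K, _, rfl⟩
  exact norm_nonneg _

/-- Subtracting the finite-rank operator `T ∘ truncation` leaves `T` acting on series with
frequencies above `m`. There the hypothesis on polynomials extends by density, and truncation does
not increase norms. -/
theorem essNorm_sq_le_of_polynomial {w : Weight} (T : DirichletSpace w →L[ℂ] DirichletSpace w)
    {m : ℕ+} {E : ℝ} (hE : 0 ≤ E)
    (h : ∀ (S : Finset ℕ+) (a : ℕ+ → ℂ), (∀ n ∈ S, m < n) →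
      ‖T (polynomial w S a)‖ ^ 2 ≤ E * ‖polynomial w S a‖ ^ 2) : essNorm T ^ 2 ≤ E := by
  classical
  have hcomp : IsCompactOperator (T ∘L truncation w (Finset.Icc 1 m)) :=
    (isCompactOperator_truncation w _).clm_comp T
  have hbound : ‖T - T ∘L truncation w (Finset.Icc 1 m)‖ ≤ Real.sqrt E := by
    refine ContinuousLinearMap.opNorm_le_bound _ (Real.sqrt_nonneg _) fun f => ?_
    set g := f - truncation w (Finset.Icc 1 m) f with hg
    have hgc : ∀ n, g.coeff n = if n ≤ m then 0 else f.coeff n := by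
      intro n
      rw [hg, DirichletSpace.coeff_sub, coeff_truncation]
      by_cases hn : n ≤ m
      · simp [hn]
      · simp [hn]
    have hpoly : ∀ S, ‖T (polynomial w S g.coeff)‖ ^ 2 ≤ E * ‖polynomial w S g.coeff‖ ^ 2 := by
      intro S
      have heq : polynomial w S g.coeff = polynomial w (S.filter (m < ·)) g.coeff := by
        refine DirichletSpace.ext fun n => ?_
        rw [coeff_polynomial, coeff_polynomial, hgc]
        by_cases hn : n ≤ m
        · simp [hn]
        · simp [hn, not_le.1 hn]
      rw [heq]
      exact h _ _ fun n hn => (Finset.mem_filter.1 hn).2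
    have hTg : ‖T g‖ ^ 2 ≤ E * ‖g‖ ^ 2 :=
      le_of_tendsto_of_tendsto' (((T.continuous.tendsto g).comp (tendsto_polynomial g)).norm.pow 2)
        (((tendsto_polynomial g).norm.pow 2).const_mul E) hpoly
    have hgf : ‖g‖ ^ 2 ≤ ‖f‖ ^ 2 := by
      refine DirichletSpace.norm_sq_le_of_sum_le fun S => ?_
      refine (Finset.sum_le_sum fun n _ => ?_).trans (f.sum_le_norm_sq S)
      rw [hgc]
      have := (w.pos n).le
      split_ifs
      · rw [norm_zero, zero_pow two_ne_zero, zero_mul]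
        positivity
      · exact le_rfl
    have hval : (T - T ∘L truncation w (Finset.Icc 1 m)) f = T g := by
      rw [hg, map_sub]
      rfl
    rw [hval]
    refine abs_le_of_sq_le_sq' ?_ (by positivity) |>.2
    rw [mul_pow, Real.sq_sqrt hE]
    exact hTg.trans (mul_le_mul_of_nonneg_left hgf hE)
  calc essNorm T ^ 2 ≤ Real.sqrt E ^ 2 :=
        pow_le_pow_left₀ (essNorm_nonneg T) ((essNorm_le T hcomp).trans hbound) 2
    _ = E := Real.sq_sqrt hE

/-! ### The upper bound -/

/-- The coefficients of the image of a Dirichlet polynomial under a composition operator. -/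
theorem IsCompositionOperator.LSeries_polynomial {w : Weight} {Φ : ℂ → ℂ}
    {T : DirichletSpace w →L[ℂ] DirichletSpace w} (hT : IsCompositionOperator Φ T)
    (hs : ∀ (f : DirichletSpace w) (s : ℂ), 1 / 2 < s.re → LSeriesSummable f.seq s)
    (S : Finset ℕ+) (a : ℕ+ → ℂ) (s : ℂ) (hs' : 1 / 2 < s.re) :
    LSeriesSummable (T (polynomial w S a)).seq s ∧
      dirichletSum S a (Φ s) = LSeries (T (polynomial w S a)).seq s := by
  refine ⟨hs _ s hs', ?_⟩
  rw [← DirichletSpace.eval_eq_LSeries, hT _ s hs', eval_polynomial, dirichletSum]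

theorem IsLittlewoodPaley.essNorm_sq_le {β : ℝ → ℝ} {w : Weight} {Φ : ℂ → ℂ} {c M C : ℝ}
    (hβ : IsLittlewoodPaley β w) (hΦ : IsTameSelfMap Φ c M C)
    {T : DirichletSpace w →L[ℂ] DirichletSpace w} (hT : IsCompositionOperator Φ T)
    (hs : ∀ (f : DirichletSpace w) (s : ℂ), 1 / 2 < s.re → LSeriesSummable f.seq s) :
    ENNReal.ofReal (essNorm T ^ 2) ≤ ENNReal.ofReal c * nevanlinnaLimsup β Φ := by
  have hc := hΦ.pos
  have hLtop : nevanlinnaLimsup β Φ ≠ ∞ := ne_top_of_le_ne_top ENNReal.ofReal_ne_top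
    (nevanlinnaLimsup_le hβ.pos fun s hs' =>
      hβ.nevanlinna_le hΦ.one_le hΦ.differentiableOn hΦ.mapsTo hΦ.growth hs')
  set L := (nevanlinnaLimsup β Φ).toReal with hLdef
  have hL0 : 0 ≤ L := ENNReal.toReal_nonneg
  rw [← ENNReal.ofReal_toReal hLtop, ← ENNReal.ofReal_mul hc.le]
  refine ENNReal.ofReal_le_ofReal (le_of_forall_pos_le_add fun δ hδ => ?_)
  -- The excess over `L` and the `ε` of the coefficient estimate each contribute `δ / 2` to the
  -- final bound `c L + δ`. The upper limit is finite by Littlewood's inequality.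
  have hlt : nevanlinnaLimsup β Φ < ENNReal.ofReal (L + δ / (2 * c)) := by
    rw [← ENNReal.ofReal_toReal hLtop]
    have : 0 < δ / (2 * c) := by positivity
    exact (ENNReal.ofReal_lt_ofReal_iff (by positivity)).2 (by linarith)
  obtain ⟨m, hm⟩ := hβ.exists_sum_coeff_comp_le hΦ (by positivity) (half_pos hδ) hlt
  have h1 := essNorm_sq_le_of_polynomial T (m := m) (E := c * (L + δ / (2 * c)) + δ / 2)
    (by positivity) fun S a hS => by
      refine DirichletSpace.norm_sq_le_of_sum_le fun S' => ?_
      have h2 := hm S a _ hS (hT.LSeries_polynomial hs S a) S'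
      simp_rw [DirichletSpace.seq_coe] at h2
      rwa [norm_sq_polynomial]
  refine h1.trans (le_of_eq ?_)
  field_simp
  ring

/-! ### The Hardy space operator -/

theorem DirichletSpace.coeff_mk {w : Weight} {a : ℕ+ → ℂ} (h : a ∈ coeffs w) (n : ℕ+) :
    DirichletSpace.coeff (w := w) ⟨a, h⟩ n = a n := rfl

/-- The same Dirichlet series as an element of the space with weight `w'`. -/
def DirichletSpace.changeWeight {w w' : Weight} (f : DirichletSpace w)
    (h : Summable fun n => ‖f.coeff n‖ ^ 2 * w'.toFun n) : DirichletSpace w' :=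
  ⟨f.coeff, h⟩

theorem DirichletSpace.coeff_changeWeight {w w' : Weight} (f : DirichletSpace w)
    (h : Summable fun n => ‖f.coeff n‖ ^ 2 * w'.toFun n) (n : ℕ+) :
    (f.changeWeight h).coeff n = f.coeff n := by
  rw [DirichletSpace.changeWeight]
  exact DirichletSpace.coeff_mk h n

theorem DirichletSpace.seq_changeWeight {w w' : Weight} (f : DirichletSpace w)
    (h : Summable fun n => ‖f.coeff n‖ ^ 2 * w'.toFun n) :
    (f.changeWeight h).seq = f.seq := by
  funext n
  rw [DirichletSpace.seq, DirichletSpace.seq]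
  exact dite_congr rfl (fun _ => f.coeff_changeWeight h _) fun _ => rfl

theorem DirichletSpace.eval_changeWeight {w w' : Weight} (f : DirichletSpace w)
    (h : Summable fun n => ‖f.coeff n‖ ^ 2 * w'.toFun n) (s : ℂ) :
    (f.changeWeight h).eval s = f.eval s := by
  simp only [DirichletSpace.eval, DirichletSpace.coeff_changeWeight]

/-- A linear map into a Dirichlet space, as a map into the space with weight `w'`. -/
def changeWeightMap {w w' : Weight} {E : Type*} [AddCommGroup E] [Module ℂ E]
    (A : E →ₗ[ℂ] DirichletSpace w)
    (h : ∀ f, Summable fun n => ‖(A f).coeff n‖ ^ 2 * w'.toFun n) : E →ₗ[ℂ] DirichletSpace w' where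
  toFun f := (A f).changeWeight (h f)
  map_add' f g := DirichletSpace.ext fun n => by
    rw [DirichletSpace.coeff_changeWeight, map_add, DirichletSpace.coeff_add,
      DirichletSpace.coeff_add, DirichletSpace.coeff_changeWeight,
      DirichletSpace.coeff_changeWeight]
  map_smul' k f := DirichletSpace.ext fun n => by
    rw [DirichletSpace.coeff_changeWeight, map_smul, DirichletSpace.coeff_smul,
      RingHom.id_apply, DirichletSpace.coeff_smul, DirichletSpace.coeff_changeWeight]

theorem changeWeightMap_apply {w w' : Weight} {E : Type*} [AddCommGroup E] [Module ℂ E]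
    (A : E →ₗ[ℂ] DirichletSpace w)
    (h : ∀ f, Summable fun n => ‖(A f).coeff n‖ ^ 2 * w'.toFun n) (f : E) :
    changeWeightMap A h f = (A f).changeWeight (h f) := rfl

theorem HardySpace.summable_bergmanWeight (h : BergmanDensity) (f : HardySpace) :
    Summable fun n => ‖f.coeff n‖ ^ 2 * (bergmanWeight h).toFun n :=
  f.summable.of_nonneg_of_le (fun n => mul_nonneg (sq_nonneg _) ((bergmanWeight h).pos n).le)
    fun n => mul_le_mul_of_nonneg_left (bergmanWeight_le_one h n) (sq_nonneg _)

/-- The inclusion of `ℋ²` in `𝒜²_μ`. -/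
noncomputable def hardyInclusion (h : BergmanDensity) : HardySpace →ₗ[ℂ] BergmanSpace h :=
  changeWeightMap LinearMap.id fun f => HardySpace.summable_bergmanWeight h f

theorem hardyInclusion_apply (h : BergmanDensity) (f : HardySpace) :
    hardyInclusion h f = f.changeWeight (f.summable_bergmanWeight h) := by
  rw [hardyInclusion, changeWeightMap_apply]
  rfl

theorem coeff_hardyInclusion (h : BergmanDensity) (f : HardySpace) :
    (hardyInclusion h f).coeff = f.coeff := by
  rw [hardyInclusion_apply]
  exact funext fun n => DirichletSpace.coeff_changeWeight _ _ n

theorem hardySpace_LSeriesSummable_seq (h : BergmanDensity) (f : HardySpace) {s : ℂ}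
    (hs : 1 / 2 < s.re) : LSeriesSummable f.seq s := by
  rw [← f.seq_changeWeight (f.summable_bergmanWeight h)]
  exact DirichletSpace.LSeriesSummable_seq _ hs

/-- Each coefficient of the image is continuous for the Bergman norm, so a finite sum of
coefficients is a limit over polynomials. On polynomials the contraction estimate is applied with
the Hardy weight, although the operator is the Bergman one. -/
theorem IsTameSelfMap.sum_coeff_hardyInclusion_le {h : BergmanDensity} {Φ : ℂ → ℂ} {c M C : ℝ}
    (hΦ : IsTameSelfMap Φ c M C) {T : BergmanSpace h →L[ℂ] BergmanSpace h}
    (hT : IsCompositionOperator Φ T) (f : HardySpace) (S' : Finset ℕ+) :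
    ∑ n ∈ S', ‖(T (hardyInclusion h f)).coeff n‖ ^ 2 ≤ ‖f‖ ^ 2 := by
  have hlim : Tendsto (fun S => ∑ n ∈ S',
      ‖(T (polynomial (bergmanWeight h) S f.coeff)).coeff n‖ ^ 2) atTop
      (𝓝 (∑ n ∈ S', ‖(T (hardyInclusion h f)).coeff n‖ ^ 2)) := by
    refine tendsto_finsetSum S' fun n _ => Tendsto.pow (Tendsto.norm ?_) 2
    rw [← coeff_hardyInclusion h f]
    exact (((coeffCLM _ n).continuous.comp T.continuous).tendsto _).comp
      (tendsto_polynomial (hardyInclusion h f))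
  refine le_of_tendsto' hlim fun S => ?_
  have h1 := isLittlewoodPaley_hardy.sum_coeff_comp_le_sum hΦ S f.coeff
    (hT.LSeries_polynomial (fun f _ hs => f.LSeriesSummable_seq hs) S f.coeff) S'
  refine le_trans (le_of_eq ?_) (h1.trans (f.sum_le_norm_sq S))
  refine Finset.sum_congr rfl fun n _ => ?_
  rw [DirichletSpace.seq_coe]
  exact (mul_one _).symm

/-- The operator is the restriction of the Bergman one to `ℋ² ⊂ 𝒜²_μ`: its values have square
summable coefficients, with norm at most that of the argument. -/
theorem IsTameSelfMap.exists_hardy_compositionOperator {h : BergmanDensity} {Φ : ℂ → ℂ}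
    {c M C : ℝ} (hΦ : IsTameSelfMap Φ c M C) {T : BergmanSpace h →L[ℂ] BergmanSpace h}
    (hT : IsCompositionOperator Φ T) :
    ∃ T' : HardySpace →L[ℂ] HardySpace, IsCompositionOperator Φ T' := by
  obtain ⟨A, hA⟩ : ∃ A : HardySpace →ₗ[ℂ] BergmanSpace h, ∀ f, A f = T (hardyInclusion h f) :=
    ⟨(T : BergmanSpace h →ₗ[ℂ] BergmanSpace h) ∘ₗ hardyInclusion h, fun _ => rfl⟩
  have hle : ∀ (f : HardySpace) (S : Finset ℕ+), ∑ n ∈ S, ‖(A f).coeff n‖ ^ 2 ≤ ‖f‖ ^ 2 := by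
    intro f S
    rw [hA]
    exact hΦ.sum_coeff_hardyInclusion_le hT f S
  have hsum : ∀ f : HardySpace, Summable fun n =>
      ‖(A f).coeff n‖ ^ 2 * hardyWeight.toFun n := fun f =>
    (summable_of_sum_le (fun n => sq_nonneg _) (hle f)).congr fun n => (mul_one _).symm
  refine ⟨(changeWeightMap A hsum).mkContinuous 1 fun f => ?_, fun f s hs => ?_⟩
  · rw [one_mul, changeWeightMap_apply]
    refine abs_le_of_sq_le_sq' ?_ (norm_nonneg _) |>.2
    refine DirichletSpace.norm_sq_le_of_sum_le fun S => ?_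
    refine le_trans (le_of_eq ?_) (hle f S)
    refine Finset.sum_congr rfl fun n _ => ?_
    rw [DirichletSpace.coeff_changeWeight]
    exact mul_one _
  · rw [LinearMap.mkContinuous_apply, changeWeightMap_apply, DirichletSpace.eval_changeWeight, hA,
      hT _ s hs, hardyInclusion_apply, DirichletSpace.eval_changeWeight]

theorem IsSymbol.isTameSelfMap {h : BergmanDensity} {c₀ : ℕ} (hc₀ : 1 ≤ c₀) {φ : ℂ → ℂ} {M : ℝ}
    (hΦ : IsSymbol h c₀ φ) (hφ : DifferentiableOn ℂ φ (halfPlane 0))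
    (hM : ∀ s ∈ halfPlane 0, |(φ s).im| ≤ M) :
    ∃ C, IsTameSelfMap (symbolMap c₀ φ) c₀ M C := by
  obtain ⟨X, C, hC⟩ := hΦ.inClassD.exists_bound
  refine ⟨C, by exact_mod_cast hc₀, symbolMap_differentiableOn hφ,
    hΦ.mapsTo_halfPlane_zero hφ hM, fun s hs => ?_, ?_⟩
  · rw [symbolMap_im, add_sub_cancel_left]
    exact hM s hs
  · filter_upwards [eventually_ge_atTop X] with x hx
    have h1 := hC x (by simpa using hx)
    simpa [symbolMap] using h1

end DirichletComposition

/-! ### The theorem for both spaces -/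

theorem mainTheorem2 (h : BergmanDensity) (c₀ : ℕ) (hc₀ : 1 ≤ c₀) (φ : ℂ → ℂ)
    (hΦ : IsSymbol h c₀ φ)
    (hφ : DifferentiableOn ℂ φ (halfPlane 0))
    (hIm : BddAbove ((fun s : ℂ => |(φ s).im|) '' halfPlane 0)) :
    (∃ T : BergmanSpace h →L[ℂ] BergmanSpace h,
      IsCompositionOperator (symbolMap c₀ φ) T ∧
      ENNReal.ofReal (essNorm T ^ 2) ≤
        ENNReal.ofReal (2 * sSup ((fun s : ℂ => |(φ s).im|) '' halfPlane 0) + c₀) *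
          nevanlinnaLimsup (betaFun h) (symbolMap c₀ φ)) ∧
    (∃ T : HardySpace →L[ℂ] HardySpace,
      IsCompositionOperator (symbolMap c₀ φ) T ∧
      ENNReal.ofReal (essNorm T ^ 2) ≤
        ENNReal.ofReal (2 * sSup ((fun s : ℂ => |(φ s).im|) '' halfPlane 0) + c₀) *
          nevanlinnaLimsup (fun σ => σ) (symbolMap c₀ φ)) := by
  have hM : ∀ s ∈ halfPlane 0, |(φ s).im| ≤ sSup ((fun s : ℂ => |(φ s).im|) '' halfPlane 0) :=
    fun s hs => le_csSup hIm ⟨s, hs, rfl⟩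
  obtain ⟨C, htame⟩ := hΦ.isTameSelfMap hc₀ hφ hM
  -- The estimates hold with the constant `c₀`; the supremum is nonnegative, so the stated constant
  -- is weaker.
  have hc : ENNReal.ofReal (c₀ : ℝ) ≤
      ENNReal.ofReal (2 * sSup ((fun s : ℂ => |(φ s).im|) '' halfPlane 0) + c₀) :=
    ENNReal.ofReal_le_ofReal (by linarith [htame.nonneg])
  obtain ⟨T, hT⟩ := hΦ.bounded
  obtain ⟨T', hT'⟩ := htame.exists_hardy_compositionOperator hT
  refine ⟨⟨T, hT, ?_⟩, ⟨T', hT', ?_⟩⟩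
  · exact (h.isLittlewoodPaley.essNorm_sq_le htame hT
      fun f s hs => f.LSeriesSummable_seq hs).trans (mul_le_mul_left hc _)
  · exact (isLittlewoodPaley_hardy.essNorm_sq_le htame hT'
      fun f s hs => hardySpace_LSeriesSummable_seq h f hs).trans (mul_le_mul_left hc _)
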